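/- Let $X_0,\dots,X_n$ ($n\ge 0$), $Z_0,Z_1,Z_2$ be variables in finite-dimensional real inner product spaces, and write $\mathcal X=(X_0,\dots,X_n)$, $\mathcal Z=(Z_0,Z_1,Z_2)$. Consider the problem of minimizing $$\phi(\mathcal X,\mathcal Z)=F(\mathcal X)+\sum_{i=0}^n f_i(X_i)+h(Z_0)+g_1(Z_0,Z_1)+g_2(Z_2)$$ subject to $C(\mathcal X,\mathcal Z)=0$, where $$C(\mathcal X,\mathcal Z)=A(\mathcal X,Z_0)+Q(Z_1,Z_2)=\begin{bmatrix}A_1(\mathcal X,Z_0)+Q_1(Z_1)\\ A_2(\mathcal X)+Q_2(Z_2)\end{bmatrix},$$ $A_1,A_2$ are multiaffine (affine in each block separately) and $Q_1,Q_2$ are linear. Each of the two rows may itself be a finite system of constraints. For $\rho>0$ and multipliers $\mathcal W=(W_1,W_2)$ let $$\mathcal L_\rho(\mathcal X,\mathcal Z,\mathcal W)=\phi(\mathcal X,\mathcal Z)+\langle \mathcal W,C(\mathcal X,\mathcal Z)\rangle+\tfrac{\rho}{2}\|C(\mathcal X,\mathcal Z)\|^2 .$$ Given $(\mathcal X^0,\mathcal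 Z^0,\mathcal W^0)$, an ADMM sequence satisfies, for $k=0,1,2,\dots$, $X_i^{k+1}\in\operatorname{argmin}_{X_i}\mathcal L_\rho(X_0^{k+1},\dots,X_{i-1}^{k+1},X_i,X_{i+1}^k,\dots,X_n^k,\mathcal Z^k,\mathcal W^k)$ for $i=0,\dots,n$ in this order, then $\mathcal Z^{k+1}\in\operatorname{argmin}_{\mathcal Z}\mathcal L_\rho(\mathcal X^{k+1},\mathcal Z,\mathcal W^k)$, then $\mathcal W^{k+1}=\mathcal W^k+\rho\,C(\mathcal X^{k+1},\mathcal Z^{k+1})$; here $\operatorname{argmin}$ of a function that is identically $\infty$ is empty. A function is Lipschitz differentiable if it is differentiable with Lipschitz gradient. For $f$ with values in $\mathbb R\cup\{\infty\}$ and $f(x)<\infty$, $v$ is a regular subgradient of $f$ at $x$ if $f(y)\ge f(x)+\langle v,y-x\rangle+o(\|y-x\|)$, and $\partial f(x)$ is the set of limits $v=\lim v_k$ with $v_k$ a regular subgradient at $x_k$, $x_k\to x$, $f(x_k)\to f(x)$. A proper lower semicontinuous $f$ is a Kurdyka–Łojasiewicz (K-Ł) function if for every $x$ with $\partial f(x)\neq\emptyset$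 there are $\eta\in(0,\infty]$, a neighborhood $U$ of $x$ and a continuous concave $\varphi:[0,\eta)\to\mathbb R$ with $\varphi(0)=0$, $\varphi$ continuously differentiable with $\varphi'>0$ on $(0,\eta)$, and $\varphi'(f(y)-f(x))\operatorname{dist}(0,\partial f(y))\ge 1$ for all $y\in U$ with $f(x)<f(y)<f(x)+\eta$ (where $\operatorname{dist}(0,\emptyset)=\infty$). Assume: 1. for all sufficiently large $\rho$, every ADMM subproblem (minimization of $\mathcal L_\rho$ over one $X_i$ or over $\mathcal Z$, all else fixed) attains its optimal value; 2. $\operatorname{Im}(Q)\supseteq\operatorname{Im}(A)$, and $Q_2$ is injective; 3. $\phi$ is coercive on the feasible set: $\phi(u_k)\to\infty$ for every sequence of feasible points with $\|u_k\|\to\infty$; 4. $h$ is proper, convex and lower semicontinuous; $g_1$ is convex, Lipschitz differentiable and strongly convex with some modulus $m_1>0$ as a function of $(Z_0,Z_1)$ jointly; $g_2$ is Lipschitz differentiable; 5. $F$ is Lipschitz differentiable, and each $f_i$ is proper, lower semicontinuous, and continuous on $\operatorname{dom}(f_i)=\{f_i<\infty\}$; 6. for every $\ell=0,\dots,n$: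 some constraint of the system, with index $r=r(\ell)$, has $A_{r}(\mathcal X,Z_0)=R_\ell(X_\ell)+A'_\ell(\mathcal X_{\ne\ell},Z_0)$ with $R_\ell$ an injective linear map and $A'_\ell$ multiaffine; and $f_\ell$ is either convex or real-valued and Lipschitz differentiable. Then there is $\rho_0>0$ such that for every $\rho>\rho_0$ for which $\mathcal L_\rho(\mathcal X,\mathcal Z,\mathcal W)$ is a K-Ł function: from every starting point with $\phi(\mathcal X^0,\mathcal Z^0)<\infty$ there is an ADMM sequence, and every ADMM sequence $(\mathcal X^k,\mathcal Z^k,\mathcal W^k)$, from any starting point, converges to a single limit $(\mathcal X^*,\mathcal Z^*,\mathcal W^*)$, which is a constrained stationary point, that is, $C(\mathcal X^*,\mathcal Z^*)=0$ and $0\in\partial\phi(\mathcal X^*,\mathcal Z^*)+\nabla C(\mathcal X^*,\mathcal Z^*)^T\mathcal W^*$. -/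

import Mathlib

namespace MultiaffineADMM

open Filter Topology

/-! Extended-real-valued functions. Functions into `ℝ ∪ {∞}` are functions into `EReal`;
properness excludes the value `⊥`. -/

section Extended

variable {H : Type*} [NormedAddCommGroup H] [InnerProductSpace ℝ H]

/-- Proper: never `-∞`, and finite somewhere. -/
def IsProper (f : H → EReal) : Prop :=
  (∀ x, f x ≠ ⊥) ∧ ∃ x, f x ≠ ⊤

/-- Convexity of an extended-real-valued function: its epigraph is convex. -/
def IsConvex (f : H → EReal) : Prop :=
  Convex ℝ {p : H × ℝ | f p.1 ≤ (p.2 : EReal)}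

/-- The minimizers of `f`. As usual for functions into `ℝ ∪ {∞}`, the set of minimizers of the
constant function `∞` is empty. -/
def argmin {α : Type*} (f : α → EReal) : Set α :=
  {x | f x ≠ ⊤ ∧ ∀ y, f x ≤ f y}

/-- `f` attains its infimum (which may be `∞`). -/
def Attains {α : Type*} (f : α → EReal) : Prop :=
  ∃ x, ∀ y, f x ≤ f y

/-- `v` is a regular subgradient of `f` at `x ∈ dom f`:
`f y ≥ f x + ⟪v, y - x⟫ + o(‖y - x‖)`. -/
def IsRegularSubgradient (f : H → EReal) (x v : H) : Prop :=
  f x ≠ ⊤ ∧ ∀ ε : ℝ, 0 < ε → ∀ᶠ y in 𝓝 x,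
    f x + ((inner ℝ v (y - x) - ε * ‖y - x‖ : ℝ) : EReal) ≤ f y

/-- The set `∂f(x)` of general (limiting) subgradients of `f` at `x`. -/
def generalSubgradient (f : H → EReal) (x : H) : Set H :=
  {v | f x ≠ ⊤ ∧ ∃ (xs vs : ℕ → H),
    Tendsto xs atTop (𝓝 x) ∧ Tendsto (fun k => f (xs k)) atTop (𝓝 (f x)) ∧
    (∀ k, IsRegularSubgradient f (xs k) (vs k)) ∧ Tendsto vs atTop (𝓝 v)}

/-- The Kurdyka–Łojasiewicz property of `f` at `x`, with `θ` the desingularizing function on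
`[0, η)`, `η ∈ (0, ∞]`. The last clause says `θ'(f y - f x) * dist(0, ∂f(y)) ≥ 1`, where the
distance to the empty set is `∞`. -/
def KLPropertyAt (f : H → EReal) (x : H) : Prop :=
  ∃ (η : EReal) (U : Set H) (θ : ℝ → ℝ),
    0 < η ∧ U ∈ 𝓝 x ∧
    ContinuousOn θ {s : ℝ | 0 ≤ s ∧ (s : EReal) < η} ∧
    ConcaveOn ℝ {s : ℝ | 0 ≤ s ∧ (s : EReal) < η} θ ∧
    θ 0 = 0 ∧
    ContDiffOn ℝ 1 θ {s : ℝ | 0 < s ∧ (s : EReal) < η} ∧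
    (∀ s : ℝ, 0 < s → (s : EReal) < η → 0 < deriv θ s) ∧
    ∀ y ∈ U, f x < f y → f y < f x + η →
      ∀ v ∈ generalSubgradient f y, 1 ≤ deriv θ ((f y).toReal - (f x).toReal) * ‖v‖

/-- A K-Ł function: proper, lower semicontinuous, with the K-Ł property on `dom ∂f`. -/
def IsKLFunction (f : H → EReal) : Prop :=
  IsProper f ∧ LowerSemicontinuous f ∧
    ∀ x, (generalSubgradient f x).Nonempty → KLPropertyAt f x

/-- `g` is `M`-Lipschitz differentiable. The gradient is represented by the derivative; the Riesz
isometry makes the two Lipschitz conditions identical. -/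
def IsLipschitzDifferentiable (M : ℝ) (g : H → ℝ) : Prop :=
  Differentiable ℝ g ∧ ∀ x y, ‖fderiv ℝ g x - fderiv ℝ g y‖ ≤ M * ‖x - y‖

/-- `g` is `(m, M)`-strongly convex. -/
def IsStronglyConvex (m M : ℝ) (g : H → ℝ) : Prop :=
  ConvexOn ℝ Set.univ g ∧ IsLipschitzDifferentiable M g ∧
    ∀ x y, g x + fderiv ℝ g x (y - x) + m / 2 * ‖y - x‖ ^ 2 ≤ g y

/-- `φ` is coercive on the set `Ω`. -/
def CoerciveOn (φ : H → EReal) (Ω : Set H) : Prop :=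
  ∀ u : ℕ → H, (∀ k, u k ∈ Ω) → Tendsto (fun k => ‖u k‖) atTop atTop →
    Tendsto (fun k => φ (u k)) atTop (𝓝 ⊤)

end Extended

section Multiaffine

/-- `M` is multiaffine: affine in each block when the other blocks are fixed. -/
def IsMultiaffine {κ : Type*} [DecidableEq κ] {E : κ → Type*} {V : Type*}
    [∀ i, AddCommGroup (E i)] [∀ i, Module ℝ (E i)] [AddCommGroup V] [Module ℝ V]
    (M : (∀ i, E i) → V) : Prop :=
  ∀ (i : κ) (x : ∀ i, E i), ∃ g : E i →ᵃ[ℝ] V, ∀ y, M (Function.update x i y) = g y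

/-- `M` is a multiaffine map of the blocks `x i` together with one more block `z`. -/
def IsMultiaffineWith {κ : Type*} [DecidableEq κ] {E : κ → Type*} {G V : Type*}
    [∀ i, AddCommGroup (E i)] [∀ i, Module ℝ (E i)] [AddCommGroup G] [Module ℝ G]
    [AddCommGroup V] [Module ℝ V] (M : (∀ i, E i) → G → V) : Prop :=
  (∀ z, IsMultiaffine fun x => M x z) ∧ ∀ x, ∃ g : G →ᵃ[ℝ] V, ∀ z, M x z = g z

/-- The only term of the constraint map `B` involving the block `ℓ` is an injective linear map:
`B(X, z) = R(X_ℓ) + A'(X_{≠ℓ}, z)` with `R` linear injective and `A'` multiaffine. -/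
def HasInjectiveLinearTerm {κ : Type*} [DecidableEq κ] {E : κ → Type*} {G V : Type*}
    [∀ i, AddCommGroup (E i)] [∀ i, Module ℝ (E i)] [AddCommGroup G] [Module ℝ G]
    [AddCommGroup V] [Module ℝ V] (B : (∀ i, E i) → G → V) (ℓ : κ) : Prop :=
  ∃ (R : E ℓ →ₗ[ℝ] V) (A' : (∀ j : {j : κ // j ≠ ℓ}, E j) → G → V),
    Function.Injective R ∧ IsMultiaffineWith A' ∧
    ∀ X z, B X z = R (X ℓ) + A' (fun j => X j) z

end Multiaffine

/-- The block `𝒳 = (X_0, …, X_n)`. -/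
abbrev XSpace {n : ℕ} (E : Fin (n + 1) → Type*) := PiLp 2 E

/-- The block `𝒵 = ((Z_0, Z_1), Z_2)`, grouped so that `z.fst` is the sub-block
`Z_S = (Z_0, Z_1)`. -/
abbrev ZSpace (G₀ G₁ G₂ : Type*) := WithLp 2 (WithLp 2 (G₀ × G₁) × G₂)

/-- The space of constraint values and of multipliers `𝒲 = (W_1, W_2)`. Each of the two block
rows is itself a finite system of constraints, indexed by `ι₁` and `ι₂`. -/
abbrev WSpace {ι₁ ι₂ : Type*} (V₁ : ι₁ → Type*) (V₂ : ι₂ → Type*) :=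
  WithLp 2 (PiLp 2 V₁ × PiLp 2 V₂)

/-- The data of the problem: minimize
`φ(𝒳, 𝒵) = F(𝒳) + ∑ i, f_i(X_i) + h(Z_0) + g₁(Z_0, Z_1) + g₂(Z_2)` subject to
`A₁(𝒳, Z_0) + Q₁ Z_1 = 0` and `A₂(𝒳) + Q₂ Z_2 = 0`. -/
structure Problem {n : ℕ} (E : Fin (n + 1) → Type*) (G₀ G₁ G₂ : Type*)
    {ι₁ ι₂ : Type*} (V₁ : ι₁ → Type*) (V₂ : ι₂ → Type*)
    [∀ i, NormedAddCommGroup (E i)] [∀ i, InnerProductSpace ℝ (E i)]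
    [NormedAddCommGroup G₀] [InnerProductSpace ℝ G₀]
    [NormedAddCommGroup G₁] [InnerProductSpace ℝ G₁]
    [NormedAddCommGroup G₂] [InnerProductSpace ℝ G₂]
    [∀ r, NormedAddCommGroup (V₁ r)] [∀ r, InnerProductSpace ℝ (V₁ r)]
    [∀ r, NormedAddCommGroup (V₂ r)] [∀ r, InnerProductSpace ℝ (V₂ r)] where
  A₁ : (∀ i, E i) → G₀ → PiLp 2 V₁
  A₂ : (∀ i, E i) → PiLp 2 V₂
  Q₁ : G₁ →ₗ[ℝ] PiLp 2 V₁
  Q₂ : G₂ →ₗ[ℝ] PiLp 2 V₂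
  F : XSpace E → ℝ
  f : ∀ i, E i → EReal
  h : G₀ → EReal
  g₁ : WithLp 2 (G₀ × G₁) → ℝ
  g₂ : G₂ → ℝ

namespace Problem

variable {n : ℕ} {E : Fin (n + 1) → Type*} {G₀ G₁ G₂ : Type*}
  {ι₁ ι₂ : Type*} [Fintype ι₁] [Fintype ι₂] {V₁ : ι₁ → Type*} {V₂ : ι₂ → Type*}
  [∀ i, NormedAddCommGroup (E i)] [∀ i, InnerProductSpace ℝ (E i)]
  [NormedAddCommGroup G₀] [InnerProductSpace ℝ G₀]
  [NormedAddCommGroup G₁] [InnerProductSpace ℝ G₁]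
  [NormedAddCommGroup G₂] [InnerProductSpace ℝ G₂]
  [∀ r, NormedAddCommGroup (V₁ r)] [∀ r, InnerProductSpace ℝ (V₁ r)]
  [∀ r, NormedAddCommGroup (V₂ r)] [∀ r, InnerProductSpace ℝ (V₂ r)]

/-- The objective `φ(𝒳, 𝒵)`. -/
noncomputable def objective (P : Problem E G₀ G₁ G₂ V₁ V₂)
    (p : WithLp 2 (XSpace E × ZSpace G₀ G₁ G₂)) : EReal :=
  (P.F p.fst : EReal) + ∑ i, P.f i (p.fst i) + P.h p.snd.fst.fst
    + (P.g₁ p.snd.fst : EReal) + (P.g₂ p.snd.snd : EReal)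

/-- The constraint map `A(𝒳, Z_0) + Q(Z_1, Z_2)`. -/
noncomputable def constraint (P : Problem E G₀ G₁ G₂ V₁ V₂)
    (p : WithLp 2 (XSpace E × ZSpace G₀ G₁ G₂)) : WSpace V₁ V₂ :=
  WithLp.toLp 2 (P.A₁ p.fst.ofLp p.snd.fst.fst + P.Q₁ p.snd.fst.snd,
    P.A₂ p.fst.ofLp + P.Q₂ p.snd.snd)

/-- The augmented Lagrangian with penalty parameter `ρ`, as a function of `((𝒳, 𝒵), 𝒲)`. -/
noncomputable def augLagrangian (P : Problem E G₀ G₁ G₂ V₁ V₂) (ρ : ℝ)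
    (q : WithLp 2 (WithLp 2 (XSpace E × ZSpace G₀ G₁ G₂) × WSpace V₁ V₂)) : EReal :=
  P.objective q.fst
    + ((inner ℝ q.snd (P.constraint q.fst) + ρ / 2 * ‖P.constraint q.fst‖ ^ 2 : ℝ) : EReal)

/-- The objective of the ADMM subproblem in the block `X_i`, the other blocks being fixed. -/
noncomputable def xSubproblem (P : Problem E G₀ G₁ G₂ V₁ V₂) (ρ : ℝ) (X : XSpace E)
    (Z : ZSpace G₀ G₁ G₂) (W : WSpace V₁ V₂) (i : Fin (n + 1)) (x : E i) : EReal :=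
  P.augLagrangian ρ
    (WithLp.toLp 2 (WithLp.toLp 2 (WithLp.toLp 2 (Function.update X.ofLp i x), Z), W))

/-- The objective of the ADMM subproblem in the block `𝒵`, the other blocks being fixed. -/
noncomputable def zSubproblem (P : Problem E G₀ G₁ G₂ V₁ V₂) (ρ : ℝ) (X : XSpace E)
    (W : WSpace V₁ V₂) (z : ZSpace G₀ G₁ G₂) : EReal :=
  P.augLagrangian ρ (WithLp.toLp 2 (WithLp.toLp 2 (X, z), W))

/-- The point `(X_0', …, X_{i-1}', X_i, …, X_n)`: the blocks before `i` have been updated. -/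
def sweep (Xnew Xold : XSpace E) (i : Fin (n + 1)) : XSpace E :=
  WithLp.toLp 2 fun j => if j < i then Xnew j else Xold j

/-- `(𝒳^k, 𝒵^k, 𝒲^k)` is a sequence produced by ADMM with penalty parameter `ρ`: Gauss–Seidel
minimization over `X_0, …, X_n`, then joint minimization over `𝒵`, then the multiplier update.
Any choice of minimizers is allowed. -/
def IsADMMSequence (P : Problem E G₀ G₁ G₂ V₁ V₂) (ρ : ℝ) (X : ℕ → XSpace E)
    (Z : ℕ → ZSpace G₀ G₁ G₂) (W : ℕ → WSpace V₁ V₂) : Prop :=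
  ∀ k : ℕ,
    (∀ i, X (k + 1) i ∈ argmin (P.xSubproblem ρ (sweep (X (k + 1)) (X k) i) (Z k) (W k) i)) ∧
    Z (k + 1) ∈ argmin (P.zSubproblem ρ (X (k + 1)) (W k)) ∧
    W (k + 1) = W k + ρ • P.constraint (WithLp.toLp 2 (X (k + 1), Z (k + 1)))

/-- `(𝒳, 𝒵)` is a constrained stationary point with multiplier `𝒲`: it is feasible and
`0 ∈ ∂φ(𝒳, 𝒵) + ∇C(𝒳, 𝒵)ᵀ 𝒲`, where `C` is the constraint map. -/
def IsConstrainedStationary (P : Problem E G₀ G₁ G₂ V₁ V₂)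
    (p : WithLp 2 (XSpace E × ZSpace G₀ G₁ G₂)) (w : WSpace V₁ V₂) : Prop :=
  P.constraint p = 0 ∧ ∃ v ∈ generalSubgradient P.objective p,
    ∀ d, inner ℝ v d + inner ℝ w (fderiv ℝ P.constraint p d) = 0

/-- The standing assumptions on the problem. -/
structure Assumptions (P : Problem E G₀ G₁ G₂ V₁ V₂) : Prop where
  multiaffine₁ : IsMultiaffineWith P.A₁
  multiaffine₂ : IsMultiaffine P.A₂
  /-- For large `ρ` every ADMM subproblem attains its optimal value. -/
  attained : ∃ ρ₁ : ℝ, ∀ ρ > ρ₁, ∀ (X : XSpace E) (Z : ZSpace G₀ G₁ G₂) (W : WSpace V₁ V₂),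
    (∀ i, Attains (P.xSubproblem ρ X Z W i)) ∧ Attains (P.zSubproblem ρ X W)
  /-- `Im(Q) ⊇ Im(A)`. -/
  image_subset : Set.range (fun u : (∀ i, E i) × G₀ => (P.A₁ u.1 u.2, P.A₂ u.1)) ⊆
    Set.range (fun z : G₁ × G₂ => (P.Q₁ z.1, P.Q₂ z.2))
  coercive : CoerciveOn P.objective {p | P.constraint p = 0}
  h_proper : IsProper P.h
  h_convex : IsConvex P.h
  h_lsc : LowerSemicontinuous P.h
  /-- `g₁` is a strongly convex function of `(Z_0, Z_1)`. -/
  g₁_strong : ∃ m M : ℝ, 0 < m ∧ IsStronglyConvex m M P.g₁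
  g₂_lip : ∃ M : ℝ, IsLipschitzDifferentiable M P.g₂
  Q₂_inj : Function.Injective P.Q₂
  F_lip : ∃ M : ℝ, IsLipschitzDifferentiable M P.F
  f_proper : ∀ i, IsProper (P.f i)
  f_lsc : ∀ i, LowerSemicontinuous (P.f i)
  f_cont : ∀ i, ContinuousOn (P.f i) {x | P.f i x < ⊤}
  /-- For every `ℓ = 0, …, n`, some constraint of the system involves `X_ℓ` only through an
  injective linear map. -/
  x_injective : ∀ ℓ, (∃ r, HasInjectiveLinearTerm (fun X z => P.A₁ X z r) ℓ) ∨
    (∃ r, HasInjectiveLinearTerm (fun X (_ : G₀) => P.A₂ X r) ℓ)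
  /-- Each `f_ℓ` is convex or (real-valued and) Lipschitz differentiable. -/
  f_convex_or_lip : ∀ ℓ, IsConvex (P.f ℓ) ∨
    ∃ (M : ℝ) (u : E ℓ → ℝ), (∀ x, P.f ℓ x = (u x : EReal)) ∧ IsLipschitzDifferentiable M u

end Problem

end MultiaffineADMM

/-!
The problem is first brought into a split form `SplitProblem` (`Problem.toSplit`): the smooth part
of the objective is `F(X) + g(Z)` with `g = g₁ + g₂`, the nonsmooth part is separable, and moving
`(Z_1, Z_2)` by `d` leaves `h` unchanged and moves the constraint map `C` by `Q d`. The properties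
of the split problem on which everything rests are collected in `SplitProblem.Regular` and verified
in `Assumptions.regular`.

**Descent** (`exists_descent`). Along a block `X_i` the map `C` is affine and, because of its row
with the injective linear part `R_i`, expands distances. Hence `ρ/2 ‖C‖²` is strongly convex in
`X_i` with modulus proportional to `ρ`; for large `ρ` this beats the lack of convexity of `F` and
`f_i`, and each block minimization decreases the augmented Lagrangian by a multiple of the squared
step. In `Z` the same follows from the strong convexity of `g₁` in `(Z_0, Z_1)` and the injectivity
of `Q₂`, with a modulus that does not depend on `ρ`. The multiplier update increases the augmented
Lagrangian by `‖ΔW‖² / ρ`. Optimality of `Z` in the directions in which `h` is constant reads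
`∇g(Z)|_(Z_1, Z_2) + Qᵀ W = 0`, with the updated multiplier `W`, and `ΔW` lies in the image of `C`,
hence of `Q`; therefore `‖ΔW‖ ≤ c ‖ΔZ‖` (`exists_multiplier_bound`) and the increase is absorbed
for large `ρ`.

**Boundedness** (`exists_lower_bound`, `exists_descent_bounded`). Choose `δ` with `Q δ = -C(X, Z)`
and `‖δ‖ ≤ c ‖C(X, Z)‖`. Moving `(Z_1, Z_2)` by `δ` gives a feasible point, and the optimality
condition shows that the objective there plus `‖C(X, Z)‖²` is at most the augmented Lagrangian at
the iterate. On the feasible set the objective is coercive, hence bounded below, so the values are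
bounded below and the iterates are bounded.

**Subgradients** (`exists_subgradient_bound`). Each block optimality condition gives a regular
subgradient of one nonsmooth summand, namely minus a partial gradient of the smooth part of the
augmented Lagrangian at a partly updated point. By separability these assemble to a regular
subgradient of the nonsmooth part at the new iterate. The smooth part has a locally Lipschitz
gradient (multiaffine maps are smooth, `IsMultiaffine.contDiff`), so the norm of the sum of this
subgradient and the gradient of the smooth part at the new iterate is at most a multiple of the
step.

**Convergence** (`IsIteration.exists_tendsto`). The iterates have a cluster point, at which the
values converge as well: each `f_i` is continuous on its domain, and `h` is handled by comparing
with the cluster point in the `Z`-subproblem. Descent, the subgradient bound and the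
Kurdyka–Łojasiewicz inequality make the steps summable (`tendsto_of_KLPropertyAt`), so that the whole
sequence converges. As `ΔW → 0`, the limit is feasible, and passing to the limit in the subgradients
gives stationarity.

Existence of ADMM sequences follows from the attainment of the subproblems: started in the domain of
the objective, no subproblem is identically `∞`, so its minimizers in the sense of `argmin` exist,
and the new point is again in the domain.
-/

namespace MultiaffineADMM

open Filter Topology

/-! ### Convergence of descent sequences under the Kurdyka–Łojasiewicz property -/

section KL

variable {H : Type*} [NormedAddCommGroup H] [InnerProductSpace ℝ H]

/-- The one-dimensional facts about a desingularizing function that the convergence argument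
uses: nonnegativity and the supergradient inequality. -/
theorem desingularizer_properties {η : EReal} {θ : ℝ → ℝ}
    (hconc : ConcaveOn ℝ {s : ℝ | 0 ≤ s ∧ (s : EReal) < η} θ) (h0 : θ 0 = 0)
    (hdiff : ContDiffOn ℝ 1 θ {s : ℝ | 0 < s ∧ (s : EReal) < η})
    (hpos : ∀ s : ℝ, 0 < s → (s : EReal) < η → 0 < deriv θ s) :
    (∀ s : ℝ, 0 ≤ s → (s : EReal) < η → 0 ≤ θ s) ∧
    ∀ s t : ℝ, 0 ≤ t → t ≤ s → 0 < s → (s : EReal) < η →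
      deriv θ s * (s - t) ≤ θ s - θ t := by
  have hopen : IsOpen {s : ℝ | 0 < s ∧ (s : EReal) < η} :=
    (isOpen_lt continuous_const continuous_id).inter
      (isOpen_lt continuous_coe_real_ereal continuous_const)
  have key : ∀ s t : ℝ, 0 ≤ t → t ≤ s → 0 < s → (s : EReal) < η →
      deriv θ s * (s - t) ≤ θ s - θ t := by
    intro s t ht hts hs hsη
    rcases hts.eq_or_lt with rfl | hlt
    · simp
    have hd : DifferentiableAt ℝ θ s :=
      (hdiff.differentiableOn one_ne_zero).differentiableAt (hopen.mem_nhds ⟨hs, hsη⟩)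
    have htη : (t : EReal) < η := lt_of_le_of_lt (EReal.coe_le_coe_iff.2 hts) hsη
    have := hconc.deriv_le_slope (x := t) (y := s) ⟨ht, htη⟩ ⟨hs.le, hsη⟩ hlt hd
    rw [slope_def_field, le_div_iff₀ (by linarith)] at this
    exact this
  refine ⟨fun s hs hsη => ?_, key⟩
  rcases hs.eq_or_lt with rfl | hs'
  · exact h0.ge
  · have := key s 0 le_rfl hs hs' hsη
    have h2 := hpos s hs' hsη
    rw [h0] at this
    nlinarith [mul_pos h2 hs']

/-- A sequence with sufficient decrease `a dₖ² ≤ ℓₖ - ℓₖ₊₁`, steps of size `O(dₖ)` and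
subgradients of size `O(dₖ)`, converges to any cluster point at which the function value is
attained in the limit and the K-Ł property holds. -/
theorem tendsto_of_KLPropertyAt {L : H → EReal} {u : ℕ → H} {d ℓ : ℕ → ℝ} {x : H} {ℓx : ℝ}
    {a b c : ℝ} (ha : 0 < a) (hb : 0 < b) (hc : 0 < c)
    (hL : ∀ k, L (u k) = (ℓ k : EReal)) (hLx : L x = (ℓx : EReal)) (hd : ∀ k, 0 ≤ d k)
    (hdec : ∀ k, a * d k ^ 2 ≤ ℓ k - ℓ (k + 1))
    (hstep : ∀ k, ‖u (k + 1) - u k‖ ≤ c * d k)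
    (hsub : ∀ k, ∃ v ∈ generalSubgradient L (u (k + 1)), ‖v‖ ≤ b * d k)
    {ns : ℕ → ℕ} (hns : Tendsto ns atTop atTop) (hu : Tendsto (u ∘ ns) atTop (𝓝 x))
    (hℓ : Tendsto (ℓ ∘ ns) atTop (𝓝 ℓx)) (hKL : KLPropertyAt L x) :
    Tendsto u atTop (𝓝 x) := by
  obtain ⟨η, U, θ, hη, hU, hcont, hconc, h0, hdiff, hpos, hineq⟩ := hKL
  obtain ⟨hθ, hgrad⟩ := desingularizer_properties hconc h0 hdiff hpos
  have hanti : Antitone ℓ := antitone_nat_of_succ_le fun k => by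
    have := hdec k
    nlinarith [mul_nonneg ha.le (sq_nonneg (d k))]
  have hℓ' : Tendsto ℓ atTop (𝓝 ℓx) :=
    (tendsto_iff_tendsto_subseq_of_antitone hanti hns).2 hℓ
  have hge : ∀ k, ℓx ≤ ℓ k := fun k => hanti.le_of_tendsto hℓ' k
  have hd0 : Tendsto d atTop (𝓝 0) := by
    have h1 : Tendsto (fun k => (ℓ k - ℓ (k + 1)) / a) atTop (𝓝 0) := by
      have := (hℓ'.sub (hℓ'.comp (tendsto_add_atTop_nat 1))).div_const a
      simpa using this
    have h2 : Tendsto (fun k => d k ^ 2) atTop (𝓝 0) :=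
      squeeze_zero (fun k => sq_nonneg _)
        (fun k => by rw [le_div_iff₀ ha]; linarith [hdec k]) h1
    have h3 := (Real.continuous_sqrt.tendsto 0).comp h2
    simp only [Real.sqrt_zero] at h3
    exact h3.congr fun k => by simp [Real.sqrt_sq (hd k)]
  have hEv : ∀ᶠ k in atTop, ((ℓ k - ℓx : ℝ) : EReal) < η := by
    have h1 : Tendsto (fun k => ((ℓ k - ℓx : ℝ) : EReal)) atTop (𝓝 ((0 : ℝ) : EReal)) := by
      have : Tendsto (fun k => ℓ k - ℓx) atTop (𝓝 0) := by
        simpa using hℓ'.sub_const ℓx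
      exact (continuous_coe_real_ereal.tendsto 0).comp this
    exact h1.eventually_lt_const (by simpa using hη)
  have hθ0 : Tendsto (fun k => θ (ℓ k - ℓx)) atTop (𝓝 0) := by
    have h1 : ContinuousWithinAt θ {s : ℝ | 0 ≤ s ∧ (s : EReal) < η} 0 :=
      hcont 0 ⟨le_rfl, by simpa using hη⟩
    have h2 : Tendsto (fun k => ℓ k - ℓx) atTop (𝓝[{s : ℝ | 0 ≤ s ∧ (s : EReal) < η}] 0) := by
      refine tendsto_nhdsWithin_iff.2 ⟨by simpa using hℓ'.sub_const ℓx, ?_⟩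
      filter_upwards [hEv] with k hk using ⟨sub_nonneg.2 (hge k), hk⟩
    have := h1.tendsto.comp h2
    rwa [h0] at this
  set B : ℝ := b / a with hB
  have hBpos : 0 < B := div_pos hb ha
  -- The one-step estimate: `2 dₖ₊₁ ≤ dₖ + B (θₖ₊₁ - θₖ₊₂)`.
  have hone : ∀ k, u (k + 1) ∈ U → ((ℓ (k + 1) - ℓx : ℝ) : EReal) < η →
      2 * d (k + 1) ≤ d k + B * (θ (ℓ (k + 1) - ℓx) - θ (ℓ (k + 2) - ℓx)) := by
    intro k hkU hkη
    have hk1 := hge (k + 1)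
    have hk2 := hge (k + 2)
    have hk12 : ℓ (k + 2) ≤ ℓ (k + 1) := hanti (Nat.le_succ _)
    have hdk := hdec (k + 1)
    have hsq : 0 ≤ a * d (k + 1) ^ 2 := mul_nonneg ha.le (sq_nonneg _)
    rcases hk1.eq_or_lt with heq | hlt
    · have h2 : ℓ (k + 2) = ℓx := le_antisymm (heq ▸ hk12) hk2
      have h3 : d (k + 1) = 0 := by
        have : a * d (k + 1) ^ 2 ≤ 0 := by
          have : ℓ (k + 1 + 1) = ℓx := h2
          linarith
        have h4 : d (k + 1) ^ 2 ≤ 0 := by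
          by_contra hcon
          push Not at hcon
          nlinarith [mul_pos ha hcon]
        exact pow_eq_zero_iff two_ne_zero |>.1 (le_antisymm h4 (sq_nonneg _))
      rw [h3, h2, ← heq]
      simpa using hd k
    · obtain ⟨v, hv, hvd⟩ := hsub k
      have h1 := hineq (u (k + 1)) hkU (by rw [hL, hLx]; exact_mod_cast hlt) (by
        rw [hL, hLx]
        have : ((ℓ (k + 1) : ℝ) : EReal) = (ℓx : EReal) + ((ℓ (k + 1) - ℓx : ℝ) : EReal) := by
          rw [← EReal.coe_add]; congr 1; ring
        rw [this]
        exact EReal.add_lt_add_left_coe hkη ℓx) v hv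
      rw [hL, hLx, EReal.toReal_coe, EReal.toReal_coe] at h1
      have hs : 0 < ℓ (k + 1) - ℓx := sub_pos.2 hlt
      have hD := hpos _ hs hkη
      have h2 := hgrad (ℓ (k + 1) - ℓx) (ℓ (k + 2) - ℓx) (by linarith) (by linarith) hs hkη
      set D := deriv θ (ℓ (k + 1) - ℓx)
      set Δ := θ (ℓ (k + 1) - ℓx) - θ (ℓ (k + 2) - ℓx)
      have h3 : 1 ≤ D * (b * d k) := h1.trans (mul_le_mul_of_nonneg_left hvd hD.le)
      have h4 : D * (a * d (k + 1) ^ 2) ≤ Δ := by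
        refine le_trans (mul_le_mul_of_nonneg_left hdk hD.le) ?_
        have : ℓ (k + 1) - ℓ (k + 1 + 1) = ℓ (k + 1) - ℓx - (ℓ (k + 2) - ℓx) := by ring
        rw [this]; exact h2
      have hdk0 : 0 < d k := by
        by_contra hcon
        have : d k = 0 := le_antisymm (not_lt.1 hcon) (hd k)
        rw [this] at h3; norm_num at h3
      have h5 : d (k + 1) ^ 2 ≤ B * Δ * d k := by
        have h6 : a * d (k + 1) ^ 2 ≤ b * Δ * d k := by
          calc a * d (k + 1) ^ 2 = 1 * (a * d (k + 1) ^ 2) := by ring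
            _ ≤ D * (b * d k) * (a * d (k + 1) ^ 2) := mul_le_mul_of_nonneg_right h3 hsq
            _ = (b * d k) * (D * (a * d (k + 1) ^ 2)) := by ring
            _ ≤ (b * d k) * Δ := mul_le_mul_of_nonneg_left h4 (mul_nonneg hb.le (hd k))
            _ = b * Δ * d k := by ring
        have : B * Δ * d k = b * Δ * d k / a := by rw [hB]; ring
        rw [this, le_div_iff₀ ha]; linarith
      have hΔ : 0 ≤ B * Δ := by
        refine mul_nonneg hBpos.le (le_trans (mul_nonneg hD.le hsq) h4)
      have h7 : (2 * d (k + 1)) ^ 2 ≤ (d k + B * Δ) ^ 2 := by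
        nlinarith [sq_nonneg (d k - B * Δ)]
      exact (pow_le_pow_iff_left₀ (by linarith [hd (k + 1)]) (by linarith) two_ne_zero).1 h7
  set T : ℕ → ℝ := fun k => d k + B * θ (ℓ (k + 1) - ℓx) with hT
  have hT0 : Tendsto T atTop (𝓝 0) := by
    have := hd0.add ((hθ0.comp (tendsto_add_atTop_nat 1)).const_mul B)
    simpa using this
  rw [Metric.tendsto_atTop]
  intro ε hε
  obtain ⟨r, hr, hrU⟩ := Metric.mem_nhds_iff.1 hU
  set δ := min r ε with hδ
  have hδ0 : 0 < δ := lt_min hr hε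
  obtain ⟨N, hN⟩ := eventually_atTop.1 hEv
  -- Start the trapping argument at an index where `u` is close to `x` and `T` is small.
  have e1 : ∀ᶠ j in atTop, ‖u (ns j) - x‖ < δ / 2 := by
    have := Metric.tendsto_nhds.1 hu (δ / 2) (by linarith)
    simpa [dist_eq_norm] using this
  have e2 : ∀ᶠ j in atTop, T (ns j - 1) < δ / (2 * c) :=
    (hT0.comp ((tendsto_sub_atTop_nat 1).comp hns)).eventually_lt_const (by positivity)
  have e3 : ∀ᶠ j in atTop, N + 1 ≤ ns j := hns.eventually_ge_atTop _
  obtain ⟨j, hj1, hj2, hj3⟩ := (e1.and (e2.and e3)).exists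
  obtain ⟨K, hK⟩ : ∃ K, ns j = K + 1 := ⟨ns j - 1, by omega⟩
  rw [hK] at hj1 hj2 hj3
  simp only [Nat.add_sub_cancel] at hj2
  have hTnn : ∀ k, N ≤ k → 0 ≤ T k := fun k hk =>
    add_nonneg (hd k) (mul_nonneg hBpos.le
      (hθ _ (sub_nonneg.2 (hge _)) (hN _ (by omega))))
  have hcT : c * T K < δ / 2 := by
    rw [lt_div_iff₀ (by positivity)] at hj2
    linarith
  have hclose : ∀ m, K ≤ m → ‖u (m + 1) - u (K + 1)‖ ≤ c * (T K - T m) →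
      ‖u (m + 1) - x‖ < δ := by
    intro m hm h
    have h1 := norm_sub_le_norm_sub_add_norm_sub (u (m + 1)) (u (K + 1)) x
    have h2 := mul_nonneg hc.le (hTnn m (by omega))
    linarith [mul_sub c (T K) (T m)]
  have hind : ∀ m, K ≤ m → ‖u (m + 1) - u (K + 1)‖ ≤ c * (T K - T m) := by
    intro m hm
    induction m, hm using Nat.le_induction with
    | base => simp
    | succ m hm ih =>
      have hmU : u (m + 1) ∈ U :=
        hrU (by rw [Metric.mem_ball, dist_eq_norm]; exact (hclose m hm ih).trans_le (min_le_left _ _))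
      have h1 := hone m hmU (hN _ (by omega))
      have h2 := hstep (m + 1)
      have h3 := norm_sub_le_norm_sub_add_norm_sub (u (m + 1 + 1)) (u (m + 1)) (u (K + 1))
      have h4 : d (m + 1) ≤ T m - T (m + 1) := by
        simp only [hT]
        have : m + 1 + 1 = m + 2 := rfl
        rw [this]
        linarith
      have h5 := mul_le_mul_of_nonneg_left h4 hc.le
      linarith [mul_sub c (T m) (T (m + 1)), mul_sub c (T K) (T m), mul_sub c (T K) (T (m + 1))]
  refine ⟨K + 1, fun m hm => ?_⟩
  obtain ⟨m', rfl⟩ : ∃ m', m = m' + 1 := ⟨m - 1, by omega⟩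
  rw [dist_eq_norm]
  exact (hclose m' (by omega) (hind m' (by omega))).trans_le (min_le_right _ _)

end KL

/-! ### Weak convexity and growth at minimizers -/

section WeakConvexity

variable {H : Type*} [NormedAddCommGroup H] [InnerProductSpace ℝ H]

/-- `g` satisfies the convexity inequality up to the quadratic term of modulus `m`: strong
convexity for `m > 0`, convexity for `m = 0`, weak convexity for `m < 0`. -/
def HasConvexityModulus (m : ℝ) (g : H → ℝ) : Prop :=
  ∀ x y : H, ∀ t : ℝ, 0 ≤ t → t ≤ 1 →
    g (x + t • (y - x)) ≤ (1 - t) * g x + t * g y - m / 2 * (t * (1 - t)) * ‖y - x‖ ^ 2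

/-- The extended-real-valued version of `HasConvexityModulus`, on the domain of `f`. -/
def HasConvexityModulusOnDom (m : ℝ) (f : H → EReal) : Prop :=
  ∀ x y : H, f x ≠ ⊤ → f y ≠ ⊤ → ∀ t : ℝ, 0 ≤ t → t ≤ 1 →
    f (x + t • (y - x)) ≤ (((1 - t) * (f x).toReal + t * (f y).toReal
      - m / 2 * (t * (1 - t)) * ‖y - x‖ ^ 2 : ℝ) : EReal)

/-- A first-order quadratic lower bound gives the corresponding modulus of convexity. -/
theorem hasConvexityModulus_of_fderiv {m : ℝ} {g : H → ℝ}
    (h : ∀ x y, g x + fderiv ℝ g x (y - x) + m / 2 * ‖y - x‖ ^ 2 ≤ g y) :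
    HasConvexityModulus m g := by
  intro x y t ht ht1
  set z := x + t • (y - x) with hz
  have e1 : x - z = (-t) • (y - x) := by rw [hz]; module
  have e2 : y - z = (1 - t) • (y - x) := by rw [hz]; module
  have h1 := h z x
  have h2 := h z y
  rw [e1, map_smul, norm_smul, smul_eq_mul, mul_pow, Real.norm_eq_abs, sq_abs] at h1
  rw [e2, map_smul, norm_smul, smul_eq_mul, mul_pow, Real.norm_eq_abs, sq_abs] at h2
  have h3 := mul_le_mul_of_nonneg_left h1 (sub_nonneg.2 ht1)
  have h4 := mul_le_mul_of_nonneg_left h2 ht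
  linear_combination h3 + h4

theorem IsLipschitzDifferentiable.abs_sub_le {M : ℝ} {g : H → ℝ}
    (hg : IsLipschitzDifferentiable M g) (hM : 0 ≤ M) (x y : H) :
    |g y - g x - fderiv ℝ g x (y - x)| ≤ M * ‖y - x‖ ^ 2 := by
  have hd : ∀ z ∈ segment ℝ x y,
      HasFDerivWithinAt (fun z => g z - fderiv ℝ g x z) (fderiv ℝ g z - fderiv ℝ g x)
        (segment ℝ x y) z := fun z _ =>
    ((hg.1 z).hasFDerivAt.sub (fderiv ℝ g x).hasFDerivAt).hasFDerivWithinAt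
  have hb : ∀ z ∈ segment ℝ x y, ‖fderiv ℝ g z - fderiv ℝ g x‖ ≤ M * ‖y - x‖ := by
    intro z hz
    refine (hg.2 z x).trans (mul_le_mul_of_nonneg_left ?_ hM)
    rw [segment_eq_image'] at hz
    obtain ⟨t, ⟨ht0, ht1⟩, rfl⟩ := hz
    simp only [add_sub_cancel_left, norm_smul, Real.norm_eq_abs, abs_of_nonneg ht0]
    exact mul_le_of_le_one_left (norm_nonneg _) ht1
  have := (convex_segment x y).norm_image_sub_le_of_norm_hasFDerivWithin_le hd hb
    (left_mem_segment ℝ x y) (right_mem_segment ℝ x y)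
  have e : g y - fderiv ℝ g x y - (g x - fderiv ℝ g x x) = g y - g x - fderiv ℝ g x (y - x) := by
    rw [map_sub]; ring
  rw [e, Real.norm_eq_abs] at this
  linarith [sq ‖y - x‖, mul_assoc M ‖y - x‖ ‖y - x‖]

theorem IsLipschitzDifferentiable.mono {M M' : ℝ} {g : H → ℝ}
    (hg : IsLipschitzDifferentiable M g) (h : M ≤ M') : IsLipschitzDifferentiable M' g :=
  ⟨hg.1, fun x y => (hg.2 x y).trans (mul_le_mul_of_nonneg_right h (norm_nonneg _))⟩

theorem IsLipschitzDifferentiable.hasConvexityModulus {M : ℝ} {g : H → ℝ}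
    (hg : IsLipschitzDifferentiable M g) (hM : 0 ≤ M) : HasConvexityModulus (-2 * M) g :=
  hasConvexityModulus_of_fderiv fun x y => by
    have := (abs_le.1 (hg.abs_sub_le hM x y)).1
    linarith

theorem HasConvexityModulusOnDom.of_isConvex {f : H → EReal} (hf : IsConvex f)
    (hbot : ∀ x, f x ≠ ⊥) {m : ℝ} (hm : m ≤ 0) : HasConvexityModulusOnDom m f := by
  intro x y hx hy t ht ht1
  have h1 : ((x, (f x).toReal) : H × ℝ) ∈ {p : H × ℝ | f p.1 ≤ (p.2 : EReal)} := by
    simp [EReal.coe_toReal hx (hbot x)]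
  have h2 : ((y, (f y).toReal) : H × ℝ) ∈ {p : H × ℝ | f p.1 ≤ (p.2 : EReal)} := by
    simp [EReal.coe_toReal hy (hbot y)]
  have h3 := hf h1 h2 (sub_nonneg.2 ht1) ht (by ring)
  have e : (1 - t) • x + t • y = x + t • (y - x) := by module
  simp only [Set.mem_ofPred_eq, Prod.smul_mk, Prod.mk_add_mk, smul_eq_mul, e] at h3
  refine h3.trans (EReal.coe_le_coe_iff.2 ?_)
  have : 0 ≤ -m / 2 * (t * (1 - t)) * ‖y - x‖ ^ 2 :=
    mul_nonneg (mul_nonneg (by linarith) (mul_nonneg ht (by linarith))) (sq_nonneg _)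
  linarith

theorem HasConvexityModulusOnDom.of_real {f : H → EReal} {u : H → ℝ} {m : ℝ}
    (hu : HasConvexityModulus m u) (hf : ∀ x, f x = (u x : EReal)) :
    HasConvexityModulusOnDom m f := by
  intro x y _ _ t ht ht1
  simp only [hf, EReal.toReal_coe]
  exact EReal.coe_le_coe_iff.2 (hu x y t ht ht1)

/-- If a function decreases along the segment from a minimum `a` at `t = 0` to the value `b` at
`t = 1` with convexity defect `D`, then `a + D ≤ b`. -/
theorem add_le_of_convexity_defect {a b D : ℝ}
    (h : ∀ t : ℝ, 0 < t → t < 1 → a ≤ (1 - t) * a + t * b - t * (1 - t) * D) : a + D ≤ b := by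
  have h1 : ∀ t : ℝ, 0 < t → t < 1 → a + (1 - t) * D ≤ b := by
    intro t ht ht1
    have := h t ht ht1
    by_contra hcon
    push Not at hcon
    nlinarith [mul_lt_mul_of_pos_left hcon ht]
  have hlim : Tendsto (fun t : ℝ => a + (1 - t) * D) (𝓝[>] 0) (𝓝 (a + (1 - 0) * D)) :=
    ((continuous_const.add ((continuous_const.sub continuous_id).mul continuous_const)).tendsto
      (0 : ℝ)).mono_left nhdsWithin_le_nhds
  have := le_of_tendsto hlim (b := b) (by
    filter_upwards [Ioo_mem_nhdsGT (zero_lt_one' ℝ)] with t ht using h1 t ht.1 ht.2)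
  simpa using this

/-- The exact convexity defect of the augmented term along a segment on which the constraint is
affine. -/
theorem inner_add_norm_sq_segment {W : Type*} [NormedAddCommGroup W] [InnerProductSpace ℝ W]
    (w a b : W) (ρ t : ℝ) :
    inner ℝ w (a + t • (b - a)) + ρ / 2 * ‖a + t • (b - a)‖ ^ 2 =
      (1 - t) * (inner ℝ w a + ρ / 2 * ‖a‖ ^ 2) + t * (inner ℝ w b + ρ / 2 * ‖b‖ ^ 2)
        - t * (1 - t) * (ρ / 2) * ‖b - a‖ ^ 2 := by
  have e1 : ‖a + t • (b - a)‖ ^ 2 = ‖a‖ ^ 2 + 2 * t * inner ℝ a (b - a) + t ^ 2 * ‖b - a‖ ^ 2 := by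
    rw [norm_add_sq_real, inner_smul_right, norm_smul, mul_pow, Real.norm_eq_abs, sq_abs]; ring
  have e2 : ‖b‖ ^ 2 = ‖a‖ ^ 2 + 2 * inner ℝ a (b - a) + ‖b - a‖ ^ 2 := by
    have : b = a + (b - a) := by abel
    conv_lhs => rw [this]
    rw [norm_add_sq_real]
  rw [e1, e2, inner_add_right, inner_smul_right, inner_sub_right]
  ring

end WeakConvexity

/-! ### Regular subgradients -/

section Subgradients

variable {H : Type*} [NormedAddCommGroup H] [InnerProductSpace ℝ H]
  {H' : Type*} [NormedAddCommGroup H'] [InnerProductSpace ℝ H']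

/-- The continuous linear functional `Λ` is a regular subgradient of `f` at `x`, stated with real
values on the domain of `f`. -/
def HasRegularSubderivative (f : H → EReal) (x : H) (Λ : H →L[ℝ] ℝ) : Prop :=
  f x ≠ ⊤ ∧ ∀ ε : ℝ, 0 < ε → ∀ᶠ y in 𝓝 x, f y ≠ ⊤ →
    (f x).toReal + Λ (y - x) - ε * ‖y - x‖ ≤ (f y).toReal

theorem HasRegularSubderivative.isRegularSubgradient {f : H → EReal} {x v : H}
    (h : HasRegularSubderivative f x (innerSL ℝ v)) (hbot : ∀ y, f y ≠ ⊥) :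
    IsRegularSubgradient f x v := by
  refine ⟨h.1, fun ε hε => ?_⟩
  filter_upwards [h.2 ε hε] with y hy
  by_cases hyt : f y = ⊤
  · rw [hyt]; exact le_top
  · rw [← EReal.coe_toReal h.1 (hbot x), ← EReal.coe_toReal hyt (hbot y), ← EReal.coe_add]
    have := hy hyt
    rw [innerSL_apply_apply] at this
    exact EReal.coe_le_coe_iff.2 (by linarith)

theorem HasRegularSubderivative.of_isMin_add {f : H → EReal} {s : H → ℝ} {x : H}
    {s' : H →L[ℝ] ℝ} (hx : f x ≠ ⊤) (hs : HasFDerivAt s s' x)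
    (hmin : ∀ y, f y ≠ ⊤ → (f x).toReal + s x ≤ (f y).toReal + s y) :
    HasRegularSubderivative f x (-s') := by
  refine ⟨hx, fun ε hε => ?_⟩
  filter_upwards [hs.isLittleO.bound hε] with y hy hyt
  have h1 := hmin y hyt
  have h2 := (abs_le.1 (Real.norm_eq_abs _ ▸ hy)).2
  simp only [neg_apply]
  linarith

theorem HasRegularSubderivative.comp {f : H' → EReal} {x : H} {Λ : H' →L[ℝ] ℝ} (T : H →L[ℝ] H')
    (h : HasRegularSubderivative f (T x) Λ) :
    HasRegularSubderivative (fun y => f (T y)) x (Λ.comp T) := by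
  refine ⟨h.1, fun ε hε => ?_⟩
  have hpos : 0 < ‖T‖ + 1 := by positivity
  filter_upwards [(T.continuous.tendsto x).eventually (h.2 (ε / (‖T‖ + 1)) (by positivity))]
    with y hy hyt
  have h1 := hy hyt
  have h2 : ε / (‖T‖ + 1) * ‖T y - T x‖ ≤ ε * ‖y - x‖ := by
    rw [div_mul_eq_mul_div, div_le_iff₀ hpos, ← map_sub]
    have := T.le_opNorm (y - x)
    have h3 : ‖T (y - x)‖ ≤ (‖T‖ + 1) * ‖y - x‖ := by linarith [norm_nonneg (y - x)]
    calc ε * ‖T (y - x)‖ ≤ ε * ((‖T‖ + 1) * ‖y - x‖) := mul_le_mul_of_nonneg_left h3 hε.le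
      _ = _ := by ring
  simp only [ContinuousLinearMap.comp_apply, map_sub] at *
  linarith

theorem HasRegularSubderivative.add {f₁ f₂ : H → EReal} {x : H} {Λ₁ Λ₂ : H →L[ℝ] ℝ}
    (h₁ : HasRegularSubderivative f₁ x Λ₁) (h₂ : HasRegularSubderivative f₂ x Λ₂)
    (b₁ : ∀ y, f₁ y ≠ ⊥) (b₂ : ∀ y, f₂ y ≠ ⊥) :
    HasRegularSubderivative (fun y => f₁ y + f₂ y) x (Λ₁ + Λ₂) := by
  refine ⟨EReal.add_ne_top h₁.1 h₂.1, fun ε hε => ?_⟩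
  filter_upwards [h₁.2 (ε / 2) (by linarith), h₂.2 (ε / 2) (by linarith)] with y h1 h2 hy
  have hy1 : f₁ y ≠ ⊤ := fun h => hy (by rw [h, EReal.top_add_of_ne_bot (b₂ y)])
  have hy2 : f₂ y ≠ ⊤ := fun h => hy (by rw [h, EReal.add_top_of_ne_bot (b₁ y)])
  rw [EReal.toReal_add h₁.1 (b₁ x) h₂.1 (b₂ x), EReal.toReal_add hy1 (b₁ y) hy2 (b₂ y)]
  have := h1 hy1
  have := h2 hy2
  simp only [add_apply]
  linarith

theorem HasRegularSubderivative.of_hasFDerivAt {s : H → ℝ} {x : H} {s' : H →L[ℝ] ℝ}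
    (hs : HasFDerivAt s s' x) : HasRegularSubderivative (fun y => (s y : EReal)) x s' := by
  refine ⟨EReal.coe_ne_top _, fun ε hε => ?_⟩
  filter_upwards [hs.isLittleO.bound hε] with y hy _
  have h2 := (abs_le.1 (Real.norm_eq_abs _ ▸ hy)).1
  simp only [EReal.toReal_coe]
  linarith

theorem sum_ne_bot {κ : Type*} (s : Finset κ) {a : κ → EReal} (h : ∀ i ∈ s, a i ≠ ⊥) :
    ∑ i ∈ s, a i ≠ ⊥ := by
  classical
  induction s using Finset.induction_on with
  | empty => simp
  | insert i s hi ih =>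
    rw [Finset.sum_insert hi]
    exact EReal.add_ne_bot_iff.2 ⟨h i (Finset.mem_insert_self _ _),
      ih fun j hj => h j (Finset.mem_insert_of_mem hj)⟩

theorem sum_eq_coe {κ : Type*} (s : Finset κ) {a : κ → EReal} (hb : ∀ i ∈ s, a i ≠ ⊥)
    (ht : ∀ i ∈ s, a i ≠ ⊤) : ∑ i ∈ s, a i = ((∑ i ∈ s, (a i).toReal : ℝ) : EReal) := by
  classical
  induction s using Finset.induction_on with
  | empty => simp
  | insert i s hi ih =>
    rw [Finset.sum_insert hi, Finset.sum_insert hi, EReal.coe_add,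
      ← ih (fun j hj => hb j (Finset.mem_insert_of_mem hj))
        (fun j hj => ht j (Finset.mem_insert_of_mem hj)),
      EReal.coe_toReal (ht i (Finset.mem_insert_self _ _)) (hb i (Finset.mem_insert_self _ _))]

theorem ne_top_of_sum_ne_top {κ : Type*} (s : Finset κ) {a : κ → EReal} (hb : ∀ i ∈ s, a i ≠ ⊥)
    (h : ∑ i ∈ s, a i ≠ ⊤) : ∀ i ∈ s, a i ≠ ⊤ := by
  classical
  intro i hi hit
  apply h
  rw [← Finset.add_sum_erase s a hi, hit, EReal.top_add_of_ne_bot]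
  exact sum_ne_bot _ fun j hj => hb j (Finset.mem_of_mem_erase hj)

theorem HasRegularSubderivative.sum {κ : Type*} (s : Finset κ) {f : κ → H → EReal} {x : H}
    {Λ : κ → H →L[ℝ] ℝ} (h : ∀ i ∈ s, HasRegularSubderivative (f i) x (Λ i))
    (hb : ∀ i ∈ s, ∀ y, f i y ≠ ⊥) :
    HasRegularSubderivative (fun y => ∑ i ∈ s, f i y) x (∑ i ∈ s, Λ i) := by
  classical
  induction s using Finset.induction_on with
  | empty =>
    simp only [Finset.sum_empty]
    exact HasRegularSubderivative.of_hasFDerivAt (s := fun _ => (0 : ℝ)) (hasFDerivAt_const 0 x)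
  | insert i s hi ih =>
    simp only [Finset.sum_insert hi]
    exact (h i (Finset.mem_insert_self _ _)).add
      (ih (fun j hj => h j (Finset.mem_insert_of_mem hj))
        (fun j hj => hb j (Finset.mem_insert_of_mem hj)))
      (hb i (Finset.mem_insert_self _ _))
      (fun y => sum_ne_bot s fun j hj => hb j (Finset.mem_insert_of_mem hj) y)

end Subgradients

/-! ### Multiaffine maps are smooth -/

section Smooth

variable {κ : Type*} [Fintype κ] [DecidableEq κ] {E : κ → Type*} {V : Type*}
  [∀ i, NormedAddCommGroup (E i)] [∀ i, InnerProductSpace ℝ (E i)]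
  [∀ i, FiniteDimensional ℝ (E i)] [NormedAddCommGroup V] [InnerProductSpace ℝ V]

theorem AffineMap.eq_add_sum_coord {G V : Type*} [NormedAddCommGroup G] [NormedSpace ℝ G]
    [FiniteDimensional ℝ G] [NormedAddCommGroup V] [NormedSpace ℝ V] (g : G →ᵃ[ℝ] V) (z : G) :
    g z = g 0 + ∑ j, (Module.finBasis ℝ G).coord j z • (g (Module.finBasis ℝ G j) - g 0) := by
  set b := Module.finBasis ℝ G
  have h1 : ∀ z, g z = g.linear z + g 0 := fun z => congrFun g.decomp z
  have h2 : ∀ j, g (b j) - g 0 = g.linear (b j) := fun j => by rw [h1 (b j)]; abel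
  simp only [h2, ← map_smul, ← map_sum]
  have h3 : ∑ j, b.coord j z • b j = z := by simp [b.sum_repr]
  rw [h3, h1 z, add_comm]

/-- Expanding the blocks one at a time in a basis exhibits a multiaffine map as a polynomial. -/
theorem IsMultiaffine.contDiff {M : (∀ i, E i) → V} (hM : IsMultiaffine M) {r : WithTop ℕ∞} :
    ContDiff ℝ r M := by
  suffices h : ∀ (s : Finset κ) (M : (∀ i, E i) → V), IsMultiaffine M →
      (∀ i ∉ s, ∀ x y, M (Function.update x i y) = M x) → ContDiff ℝ r M from
    h Finset.univ M hM fun i hi => absurd (Finset.mem_univ i) hi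
  clear hM M
  intro s
  induction s using Finset.induction_on with
  | empty =>
    intro M _ hconst
    have : ∀ x, M x = M 0 := by
      intro x
      have key : ∀ t : Finset κ, M (fun i => if i ∈ t then 0 else x i) = M x := by
        intro t
        induction t using Finset.induction_on with
        | empty => simp
        | insert i t hi ih =>
          rw [← ih, ← hconst i (Finset.notMem_empty i) (fun i => if i ∈ t then 0 else x i) 0]
          congr 1
          ext j
          rcases eq_or_ne j i with rfl | hj
          · simp
          · simp [hj]
      have := key Finset.univ
      simp only [Finset.mem_univ, if_true] at this
      exact this.symm
    rw [show M = fun _ => M 0 from funext this]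
    exact contDiff_const
  | insert i s hi ih =>
    intro M hM hconst
    have hN : ∀ y : E i, ContDiff ℝ r fun x => M (Function.update x i y) := by
      intro y
      refine ih _ (fun j x => ?_) (fun j hj x z => ?_)
      · rcases eq_or_ne j i with rfl | hji
        · exact ⟨AffineMap.const ℝ _ (M (Function.update x j y)), fun z => by simp⟩
        · obtain ⟨g, hg⟩ := hM j (Function.update x i y)
          exact ⟨g, fun z => by rw [Function.update_comm hji, hg]⟩
      · rcases eq_or_ne j i with rfl | hji
        · simp
        · rw [Function.update_comm hji]
          exact hconst j (by simp [hji, hj]) _ _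
    set b := Module.finBasis ℝ (E i)
    have hexp : M = fun x => M (Function.update x i 0) + ∑ j, b.coord j (x i) •
        (M (Function.update x i (b j)) - M (Function.update x i 0)) := by
      funext x
      obtain ⟨g, hg⟩ := hM i x
      simp only [hg]
      rw [← AffineMap.eq_add_sum_coord, ← hg, Function.update_eq_self]
    rw [hexp]
    refine (hN 0).add (ContDiff.sum fun j _ => ContDiff.smul ?_ ((hN _).sub (hN 0)))
    exact (LinearMap.toContinuousLinearMap (b.coord j)).contDiff.comp 
      (ContinuousLinearMap.proj (R := ℝ) (φ := E) i).contDiff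

theorem IsMultiaffineWith.contDiff {G : Type*} [NormedAddCommGroup G] [InnerProductSpace ℝ G]
    [FiniteDimensional ℝ G] {M : (∀ i, E i) → G → V} (hM : IsMultiaffineWith M)
    {r : WithTop ℕ∞} : ContDiff ℝ r fun p : (∀ i, E i) × G => M p.1 p.2 := by
  set b := Module.finBasis ℝ G
  have hexp : (fun p : (∀ i, E i) × G => M p.1 p.2) = fun p => M p.1 0 +
      ∑ j, b.coord j p.2 • (M p.1 (b j) - M p.1 0) := by
    funext p
    obtain ⟨g, hg⟩ := hM.2 p.1
    simp only [hg]
    exact AffineMap.eq_add_sum_coord g p.2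
  have hN : ∀ z, ContDiff ℝ r fun p : (∀ i, E i) × G => M p.1 z := fun z =>
    (hM.1 z).contDiff.comp contDiff_fst
  rw [hexp]
  refine (hN 0).add (ContDiff.sum fun j _ => ContDiff.smul ?_ ((hN _).sub (hN 0)))
  exact (LinearMap.toContinuousLinearMap (b.coord j)).contDiff.comp contDiff_snd

/-- The derivative of a `C²` function on a finite-dimensional space is Lipschitz on balls. -/
theorem exists_lipschitz_fderiv_of_contDiff {H : Type*} [NormedAddCommGroup H]
    [InnerProductSpace ℝ H] [FiniteDimensional ℝ H] {s : H → ℝ} (hs : ContDiff ℝ 2 s) (R : ℝ) :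
    ∃ K : ℝ, ∀ x y, ‖x‖ ≤ R → ‖y‖ ≤ R → ‖fderiv ℝ s x - fderiv ℝ s y‖ ≤ K * ‖x - y‖ := by
  have := FiniteDimensional.proper ℝ H
  have h1 : ContDiff ℝ 1 (fderiv ℝ s) := hs.fderiv_right (by norm_num)
  obtain ⟨K, hK⟩ := h1.contDiffOn.exists_lipschitzOnWith one_ne_zero
    (convex_closedBall (0 : H) R) (isCompact_closedBall _ _)
  exact ⟨K, fun x y hx hy => hK.norm_sub_le (by simpa using hx) (by simpa using hy)⟩

/-- Preimages under a linear map of finite-dimensional spaces can be chosen linearly bounded. -/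
theorem exists_bounded_preimage {K W : Type*} [NormedAddCommGroup K] [InnerProductSpace ℝ K]
    [NormedAddCommGroup W] [InnerProductSpace ℝ W] [FiniteDimensional ℝ W] (Q : K →ₗ[ℝ] W) :
    ∃ c : ℝ, 0 < c ∧ ∀ u ∈ LinearMap.range Q, ∃ δ, Q δ = u ∧ ‖δ‖ ≤ c * ‖u‖ := by
  obtain ⟨s, hs⟩ := Q.rangeRestrict.exists_rightInverse_of_surjective Q.range_rangeRestrict
  refine ⟨‖LinearMap.toContinuousLinearMap s‖ + 1, by positivity, fun u hu => ⟨s ⟨u, hu⟩, ?_, ?_⟩⟩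
  · have := LinearMap.congr_fun hs ⟨u, hu⟩
    exact congrArg Subtype.val this
  · have := (LinearMap.toContinuousLinearMap s).le_opNorm ⟨u, hu⟩
    have e : ‖(⟨u, hu⟩ : LinearMap.range Q)‖ = ‖u‖ := rfl
    rw [LinearMap.coe_toContinuousLinearMap', e] at this
    linarith [norm_nonneg u]

end Smooth

/-! ### Problems split into smooth and separable parts -/

/-- The data of a problem `min F(X) + ∑ f_i(X_i) + h(Z) + g(Z)` subject to `C(X, Z) = 0`. The
linear maps `ι` and `Q` describe the directions of `Z` in which `h` is constant and `C` varies
linearly: moving `Z` by `ι d` moves `C` by `Q d`. -/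
structure SplitProblem {n : ℕ} (E : Fin (n + 1) → Type*) (G W K : Type*)
    [∀ i, NormedAddCommGroup (E i)] [∀ i, InnerProductSpace ℝ (E i)]
    [NormedAddCommGroup G] [InnerProductSpace ℝ G]
    [NormedAddCommGroup W] [InnerProductSpace ℝ W]
    [NormedAddCommGroup K] [InnerProductSpace ℝ K] where
  F : PiLp 2 E → ℝ
  f : ∀ i, E i → EReal
  h : G → EReal
  g : G → ℝ
  C : WithLp 2 (PiLp 2 E × G) → W
  Q : K →ₗ[ℝ] W
  ι : K →ₗ[ℝ] G

namespace SplitProblem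

variable {n : ℕ} {E : Fin (n + 1) → Type*} {G W K : Type*}
  [∀ i, NormedAddCommGroup (E i)] [∀ i, InnerProductSpace ℝ (E i)]
  [NormedAddCommGroup G] [InnerProductSpace ℝ G]
  [NormedAddCommGroup W] [InnerProductSpace ℝ W]
  [NormedAddCommGroup K] [InnerProductSpace ℝ K]

/-- The inclusion of the block `E i` into the space of primal variables. -/
noncomputable def xDir (G : Type*) [NormedAddCommGroup G] [InnerProductSpace ℝ G]
    (i : Fin (n + 1)) : E i →L[ℝ] WithLp 2 (PiLp 2 E × G) :=
  (WithLp.prodContinuousLinearEquiv 2 ℝ (PiLp 2 E) G).symm.toContinuousLinearMap.comp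
    ((ContinuousLinearMap.inl ℝ (PiLp 2 E) G).comp
      ((PiLp.continuousLinearEquiv 2 ℝ E).symm.toContinuousLinearMap.comp
        (ContinuousLinearMap.single ℝ E i)))

/-- The inclusion of the block `G` into the space of primal variables. -/
noncomputable def zDir (E : Fin (n + 1) → Type*) [∀ i, NormedAddCommGroup (E i)]
    [∀ i, InnerProductSpace ℝ (E i)] : G →L[ℝ] WithLp 2 (PiLp 2 E × G) :=
  (WithLp.prodContinuousLinearEquiv 2 ℝ (PiLp 2 E) G).symm.toContinuousLinearMap.comp
    (ContinuousLinearMap.inr ℝ (PiLp 2 E) G)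

@[simp] theorem xDir_fst (i : Fin (n + 1)) (d : E i) : (xDir G i d).fst = PiLp.single 2 i d := rfl
@[simp] theorem xDir_snd (i : Fin (n + 1)) (d : E i) : (xDir G i d).snd = 0 := rfl
@[simp] theorem zDir_fst (d : G) : (zDir E d).fst = 0 := rfl
@[simp] theorem zDir_snd (d : G) : (zDir E d).snd = d := rfl

variable (S : SplitProblem E G W K)

/-- The separable nonsmooth part `∑ f_i(X_i) + h(Z)` of the objective. -/
noncomputable def nonsmooth (p : WithLp 2 (PiLp 2 E × G)) : EReal :=
  ∑ i, S.f i (p.fst i) + S.h p.snd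

/-- The smooth part `F(X) + g(Z)` of the objective. -/
def smooth (p : WithLp 2 (PiLp 2 E × G)) : ℝ := S.F p.fst + S.g p.snd

/-- The objective `F(X) + ∑ f_i(X_i) + h(Z) + g(Z)`. -/
noncomputable def objective (p : WithLp 2 (PiLp 2 E × G)) : EReal :=
  S.nonsmooth p + (S.smooth p : EReal)

/-- The smooth part `F(X) + g(Z) + ⟪w, C⟫ + ρ/2 ‖C‖²` of the augmented Lagrangian. -/
noncomputable def coupling (ρ : ℝ) (q : WithLp 2 (WithLp 2 (PiLp 2 E × G) × W)) : ℝ :=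
  S.smooth q.fst + (inner ℝ q.snd (S.C q.fst) + ρ / 2 * ‖S.C q.fst‖ ^ 2)

/-- The augmented Lagrangian `F(X) + ∑ f_i(X_i) + h(Z) + g(Z) + ⟪w, C⟫ + ρ/2 ‖C‖²`, as a function
of the primal variables and the multiplier. -/
noncomputable def augLagrangian (ρ : ℝ) (q : WithLp 2 (WithLp 2 (PiLp 2 E × G) × W)) : EReal :=
  S.nonsmooth q.fst + (S.coupling ρ q : EReal)

/-- The domain of the objective. -/
def IsFinite (p : WithLp 2 (PiLp 2 E × G)) : Prop :=
  (∀ i, S.f i (p.fst i) ≠ ⊤) ∧ S.h p.snd ≠ ⊤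

/-- The real value of the nonsmooth part, meaningful on the domain. -/
noncomputable def nonsmoothReal (p : WithLp 2 (PiLp 2 E × G)) : ℝ :=
  ∑ i, (S.f i (p.fst i)).toReal + (S.h p.snd).toReal

/-- The real value of the augmented Lagrangian, meaningful on the domain. -/
noncomputable def lag (ρ : ℝ) (p : WithLp 2 (PiLp 2 E × G)) (w : W) : ℝ :=
  S.nonsmoothReal p + S.coupling ρ (WithLp.toLp 2 (p, w))

/-- The assumptions under which ADMM is analysed. The field `z_modulus` says that, for large `ρ`,
`g + ρ/2 ‖C(X, ·)‖²` is strongly convex with a modulus independent of `X` and `ρ`. -/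
structure Regular : Prop where
  F_lip : ∃ M, 0 ≤ M ∧ IsLipschitzDifferentiable M S.F
  g_lip : ∃ M, 0 ≤ M ∧ IsLipschitzDifferentiable M S.g
  f_ne_bot : ∀ i x, S.f i x ≠ ⊥
  h_ne_bot : ∀ z, S.h z ≠ ⊥
  f_lsc : ∀ i, LowerSemicontinuous (S.f i)
  h_lsc : LowerSemicontinuous S.h
  f_cont : ∀ i, ContinuousOn (S.f i) {x | S.f i x < ⊤}
  f_modulus : ∃ M, 0 ≤ M ∧ ∀ i, HasConvexityModulusOnDom (-M) (S.f i)
  h_modulus : HasConvexityModulusOnDom 0 S.h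
  C_contDiff : ContDiff ℝ 2 S.C
  C_line_x : ∀ p i (d : E i) (t : ℝ),
    S.C (p + xDir G i (t • d)) = S.C p + t • (S.C (p + xDir G i d) - S.C p)
  C_expand_x : ∃ σ : ℝ, 0 < σ ∧ ∀ p i (d : E i),
    σ * ‖d‖ ^ 2 ≤ ‖S.C (p + xDir G i d) - S.C p‖ ^ 2
  C_line_z : ∀ p (d : G) (t : ℝ),
    S.C (p + zDir E (t • d)) = S.C p + t • (S.C (p + zDir E d) - S.C p)
  z_modulus : ∃ m : ℝ, 0 < m ∧ ∃ ρ₁ : ℝ, ∀ ρ > ρ₁, ∀ (p : WithLp 2 (PiLp 2 E × G)) (d : G),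
    ∀ t : ℝ, 0 ≤ t → t ≤ 1 →
      S.g (p.snd + t • d) - t * (1 - t) * (ρ / 2) * ‖S.C (p + zDir E d) - S.C p‖ ^ 2 ≤
        (1 - t) * S.g p.snd + t * S.g (p.snd + d) - m / 2 * (t * (1 - t)) * ‖d‖ ^ 2
  C_shift : ∀ p d, S.C (p + zDir E (S.ι d)) = S.C p + S.Q d
  h_shift : ∀ z d, S.h (z + S.ι d) = S.h z
  C_range : ∀ p, S.C p ∈ LinearMap.range S.Q
  coercive : CoerciveOn S.objective {p | S.C p = 0}

variable {S}

theorem IsFinite.nonsmooth_eq (hS : S.Regular) {p : WithLp 2 (PiLp 2 E × G)} (h : S.IsFinite p) :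
    S.nonsmooth p = (S.nonsmoothReal p : EReal) := by
  unfold nonsmooth nonsmoothReal
  rw [sum_eq_coe _ (fun i _ => hS.f_ne_bot i _) (fun i _ => h.1 i), EReal.coe_add,
    EReal.coe_toReal h.2 (hS.h_ne_bot _)]

theorem nonsmooth_ne_bot (hS : S.Regular) (p : WithLp 2 (PiLp 2 E × G)) : S.nonsmooth p ≠ ⊥ :=
  EReal.add_ne_bot_iff.2 ⟨sum_ne_bot _ fun i _ => hS.f_ne_bot i _, hS.h_ne_bot _⟩

theorem nonsmooth_ne_top_iff (hS : S.Regular) {p : WithLp 2 (PiLp 2 E × G)} :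
    S.nonsmooth p ≠ ⊤ ↔ S.IsFinite p := by
  refine ⟨fun h => ?_, fun h => h.nonsmooth_eq hS ▸ EReal.coe_ne_top _⟩
  have h1 : ∑ i, S.f i (p.fst i) ≠ ⊥ := sum_ne_bot _ fun i _ => hS.f_ne_bot i _
  refine ⟨fun i => ne_top_of_sum_ne_top _ (fun i _ => hS.f_ne_bot i _) (fun h2 => h ?_) i
    (Finset.mem_univ i), fun h2 => h ?_⟩
  · rw [nonsmooth, h2, EReal.top_add_of_ne_bot (hS.h_ne_bot _)]
  · rw [nonsmooth, h2, EReal.add_top_of_ne_bot h1]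

theorem add_coe_ne_top_iff {a : EReal} (r : ℝ) : a + (r : EReal) ≠ ⊤ ↔ a ≠ ⊤ := by
  induction a <;> simp [← EReal.coe_add]

theorem objective_ne_top_iff (hS : S.Regular) {p : WithLp 2 (PiLp 2 E × G)} :
    S.objective p ≠ ⊤ ↔ S.IsFinite p :=
  (add_coe_ne_top_iff _).trans (nonsmooth_ne_top_iff hS)

theorem augLagrangian_ne_top_iff (hS : S.Regular) {ρ : ℝ}
    {q : WithLp 2 (WithLp 2 (PiLp 2 E × G) × W)} :
    S.augLagrangian ρ q ≠ ⊤ ↔ S.IsFinite q.fst :=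
  (add_coe_ne_top_iff _).trans (nonsmooth_ne_top_iff hS)

theorem IsFinite.objective_eq (hS : S.Regular) {p : WithLp 2 (PiLp 2 E × G)} (h : S.IsFinite p) :
    S.objective p = ((S.nonsmoothReal p + S.smooth p : ℝ) : EReal) := by
  rw [objective, h.nonsmooth_eq hS, EReal.coe_add]

theorem IsFinite.augLagrangian_eq (hS : S.Regular) {p : WithLp 2 (PiLp 2 E × G)}
    (h : S.IsFinite p) (ρ : ℝ) (w : W) :
    S.augLagrangian ρ (WithLp.toLp 2 (p, w)) = (S.lag ρ p w : EReal) := by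
  rw [augLagrangian, lag, EReal.coe_add, ← h.nonsmooth_eq hS]
  rfl

theorem lag_eq (ρ : ℝ) (p : WithLp 2 (PiLp 2 E × G)) (w : W) :
    S.lag ρ p w = S.nonsmoothReal p + (S.F p.fst + S.g p.snd +
      (inner ℝ w (S.C p) + ρ / 2 * ‖S.C p‖ ^ 2)) := rfl

theorem nonsmoothReal_add_xDir (p : WithLp 2 (PiLp 2 E × G)) (i : Fin (n + 1)) (d : E i) :
    S.nonsmoothReal (p + xDir G i d) =
      S.nonsmoothReal p + ((S.f i (p.fst i + d)).toReal - (S.f i (p.fst i)).toReal) := by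
  have h : ∑ j, (S.f j ((p + xDir G i d).fst j)).toReal - ∑ j, (S.f j (p.fst j)).toReal =
      (S.f i (p.fst i + d)).toReal - (S.f i (p.fst i)).toReal := by
    rw [← Finset.sum_sub_distrib, Finset.sum_eq_single i]
    · simp
    · intro j _ hj
      simp [PiLp.single_eq_of_ne 2 hj]
    · simp
  simp only [nonsmoothReal, WithLp.add_snd, xDir_snd, add_zero]
  linarith

theorem nonsmoothReal_add_zDir (p : WithLp 2 (PiLp 2 E × G)) (d : G) :
    S.nonsmoothReal (p + zDir E d) =
      S.nonsmoothReal p + ((S.h (p.snd + d)).toReal - (S.h p.snd).toReal) := by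
  simp [nonsmoothReal]

theorem IsFinite.add_xDir {p : WithLp 2 (PiLp 2 E × G)} (hp : S.IsFinite p) {i : Fin (n + 1)}
    {d : E i} (hd : S.f i (p.fst i + d) ≠ ⊤) : S.IsFinite (p + xDir G i d) := by
  refine ⟨fun j => ?_, by simpa using hp.2⟩
  rcases eq_or_ne j i with rfl | hj
  · simpa using hd
  · simpa [PiLp.single_eq_of_ne 2 hj] using hp.1 j

theorem IsFinite.add_zDir {p : WithLp 2 (PiLp 2 E × G)} (hp : S.IsFinite p)
    {d : G} (hd : S.h (p.snd + d) ≠ ⊤) : S.IsFinite (p + zDir E d) :=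
  ⟨by simpa using hp.1, by simpa using hd⟩

/-! ### Growth of the augmented Lagrangian at block minimizers -/

/-- Quadratic growth at a minimizer in the block `X_i`. -/
theorem lag_growth_x (hS : S.Regular) {M₁ M₂ σ ρ : ℝ} (hF : HasConvexityModulus (-M₁) S.F)
    (hf : ∀ i, HasConvexityModulusOnDom (-M₂) (S.f i))
    (hσ : ∀ p i (d : E i), σ * ‖d‖ ^ 2 ≤ ‖S.C (p + xDir G i d) - S.C p‖ ^ 2) (hρ : 0 ≤ ρ)
    {p : WithLp 2 (PiLp 2 E × G)} {w : W} (hp : S.IsFinite p) {i : Fin (n + 1)}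
    (hmin : ∀ d, S.f i (p.fst i + d) ≠ ⊤ → S.lag ρ p w ≤ S.lag ρ (p + xDir G i d) w)
    {d : E i} (hd : S.f i (p.fst i + d) ≠ ⊤) :
    S.lag ρ p w + (ρ * σ - M₁ - M₂) / 2 * ‖d‖ ^ 2 ≤ S.lag ρ (p + xDir G i d) w := by
  refine add_le_of_convexity_defect fun t ht ht1 => ?_
  have h1 := hf i (p.fst i) (p.fst i + d) (hp.1 i) hd t ht.le ht1.le
  rw [add_sub_cancel_left] at h1
  have h1t : S.f i (p.fst i + t • d) ≠ ⊤ := (h1.trans_lt (EReal.coe_lt_top _)).ne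
  have h1r : (S.f i (p.fst i + t • d)).toReal ≤ _ :=
    EReal.coe_le_coe_iff.1 ((EReal.coe_toReal h1t (hS.f_ne_bot _ _)).le.trans h1)
  have h2 := hF p.fst (p.fst + PiLp.single 2 i d) t ht.le ht1.le
  rw [add_sub_cancel_left, PiLp.norm_single] at h2
  have h3 := inner_add_norm_sq_segment w (S.C p) (S.C (p + xDir G i d)) ρ t
  rw [← hS.C_line_x] at h3
  have h4 := mul_le_mul_of_nonneg_left (hσ p i d)
    (mul_nonneg (mul_nonneg ht.le (sub_nonneg.2 ht1.le)) (div_nonneg hρ zero_le_two))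
  have h5 := hmin (t • d) h1t
  have e1 : (p + xDir G i (t • d)).fst = p.fst + t • PiLp.single 2 i d := by
    rw [map_smul]; rfl
  have e2 : (p + xDir G i d).fst = p.fst + PiLp.single 2 i d := rfl
  have e3 : ∀ d, (p + xDir G i d).snd = p.snd := fun d => by simp
  rw [lag_eq ρ (p + xDir G i (t • d)), nonsmoothReal_add_xDir, e1, e3] at h5
  refine h5.trans ?_
  rw [lag_eq, lag_eq, nonsmoothReal_add_xDir, e2, e3]
  linear_combination h1r + h2 + h3 + h4

/-- Quadratic growth at a minimizer in the block `Z`. -/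
theorem lag_growth_z (hS : S.Regular) {m ρ : ℝ}
    {p : WithLp 2 (PiLp 2 E × G)} {w : W} (hp : S.IsFinite p)
    {d : G} (hd : S.h (p.snd + d) ≠ ⊤)
    (hm : ∀ t : ℝ, 0 ≤ t → t ≤ 1 →
      S.g (p.snd + t • d) - t * (1 - t) * (ρ / 2) * ‖S.C (p + zDir E d) - S.C p‖ ^ 2 ≤
        (1 - t) * S.g p.snd + t * S.g (p.snd + d) - m / 2 * (t * (1 - t)) * ‖d‖ ^ 2)
    (hmin : ∀ d, S.h (p.snd + d) ≠ ⊤ → S.lag ρ p w ≤ S.lag ρ (p + zDir E d) w) :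
    S.lag ρ p w + m / 2 * ‖d‖ ^ 2 ≤ S.lag ρ (p + zDir E d) w := by
  refine add_le_of_convexity_defect fun t ht ht1 => ?_
  have h1 := hS.h_modulus p.snd (p.snd + d) hp.2 hd t ht.le ht1.le
  rw [add_sub_cancel_left] at h1
  have h1t : S.h (p.snd + t • d) ≠ ⊤ := (h1.trans_lt (EReal.coe_lt_top _)).ne
  have h1r : (S.h (p.snd + t • d)).toReal ≤ _ :=
    EReal.coe_le_coe_iff.1 ((EReal.coe_toReal h1t (hS.h_ne_bot _)).le.trans h1)
  have h2 := hm t ht.le ht1.le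
  have h3 := inner_add_norm_sq_segment w (S.C p) (S.C (p + zDir E d)) ρ t
  rw [← hS.C_line_z] at h3
  have h5 := hmin (t • d) h1t
  have e1 : ∀ d, (p + zDir E d).fst = p.fst := fun d => by simp
  have e3 : ∀ d, (p + zDir E d).snd = p.snd + d := fun d => rfl
  rw [lag_eq ρ (p + zDir E (t • d)), nonsmoothReal_add_zDir, e1, e3] at h5
  refine h5.trans ?_
  rw [lag_eq, lag_eq, nonsmoothReal_add_zDir, e1, e3]
  linear_combination h1r + h2 + h3

/-! ### ADMM iterations -/

/-- The blocks with index below `m` are taken from `Xnew`, the others from `Xold`. -/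
def blend (Xnew Xold : PiLp 2 E) (m : ℕ) : PiLp 2 E :=
  WithLp.toLp 2 fun j => if (j : ℕ) < m then Xnew j else Xold j

variable (S) in
/-- An ADMM sequence that starts in the domain of the objective and whose starting point satisfies
the first-order condition of the `Z`-update; both hold for ADMM sequences from the first iterate
on. The minimality conditions compare real values over the domains of the `f_i` and of `h`. -/
structure IsIteration (ρ : ℝ) (X : ℕ → PiLp 2 E) (Z : ℕ → G) (w : ℕ → W) : Prop where
  finite : ∀ k, S.IsFinite (WithLp.toLp 2 (X k, Z k))
  x_min : ∀ k i (d : E i), S.f i (X (k + 1) i + d) ≠ ⊤ →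
    S.lag ρ (WithLp.toLp 2 (blend (X (k + 1)) (X k) (i + 1), Z k)) (w k) ≤
      S.lag ρ (WithLp.toLp 2 (blend (X (k + 1)) (X k) (i + 1), Z k) + xDir G i d) (w k)
  z_min : ∀ k (d : G), S.h (Z (k + 1) + d) ≠ ⊤ →
    S.lag ρ (WithLp.toLp 2 (X (k + 1), Z (k + 1))) (w k) ≤
      S.lag ρ (WithLp.toLp 2 (X (k + 1), Z (k + 1)) + zDir E d) (w k)
  w_update : ∀ k, w (k + 1) = w k + ρ • S.C (WithLp.toLp 2 (X (k + 1), Z (k + 1)))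
  first_order : ∀ k d, fderiv ℝ S.g (Z k) (S.ι d) + inner ℝ (w k) (S.Q d) = 0

/-- The first-order condition of the `Z`-update in the directions `ι d`, expressed with the
updated multiplier. -/
theorem first_order_of_z_min (hS : S.Regular) {ρ : ℝ} {p : WithLp 2 (PiLp 2 E × G)} {w : W}
    (hp : S.IsFinite p)
    (hmin : ∀ d, S.h (p.snd + d) ≠ ⊤ → S.lag ρ p w ≤ S.lag ρ (p + zDir E d) w) (d : K) :
    fderiv ℝ S.g p.snd (S.ι d) + inner ℝ (w + ρ • S.C p) (S.Q d) = 0 := by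
  obtain ⟨M, -, hg⟩ := hS.g_lip
  set ψ : ℝ → ℝ := fun t => S.g (p.snd + t • S.ι d) + (inner ℝ w (S.C p + t • S.Q d) +
    ρ / 2 * (‖S.C p‖ ^ 2 + 2 * t * inner ℝ (S.C p) (S.Q d) + t ^ 2 * ‖S.Q d‖ ^ 2)) with hψ
  have hmin' : ∀ t, ψ 0 ≤ ψ t := by
    intro t
    have hh : S.h (p.snd + t • S.ι d) = S.h p.snd := by rw [← map_smul, hS.h_shift]
    have h1 := hmin (t • S.ι d) (hh ▸ hp.2)
    have hC : S.C (p + zDir E (t • S.ι d)) = S.C p + t • S.Q d := by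
      rw [← map_smul S.ι, hS.C_shift, map_smul]
    have e1 : (p + zDir E (t • S.ι d)).fst = p.fst := by simp
    have e2 : (p + zDir E (t • S.ι d)).snd = p.snd + t • S.ι d := rfl
    rw [lag_eq, lag_eq, nonsmoothReal_add_zDir, hh, hC, e1, e2,
      norm_add_sq_real, inner_smul_right, norm_smul, mul_pow, Real.norm_eq_abs, sq_abs] at h1
    simp only [hψ, zero_smul, add_zero]
    linarith
  have hderiv : HasDerivAt ψ (fderiv ℝ S.g p.snd (S.ι d) + (inner ℝ w (S.Q d) +
      ρ / 2 * (2 * inner ℝ (S.C p) (S.Q d)))) 0 := by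
    have h1 : HasDerivAt (fun t : ℝ => p.snd + t • S.ι d) (S.ι d) 0 := by
      simpa using ((hasDerivAt_id (0 : ℝ)).smul_const (S.ι d)).const_add p.snd
    have h2 : HasDerivAt (fun t : ℝ => S.g (p.snd + t • S.ι d))
        (fderiv ℝ S.g p.snd (S.ι d)) 0 := by
      have : HasFDerivAt S.g (fderiv ℝ S.g p.snd) (p.snd + (0 : ℝ) • S.ι d) := by
        simpa using (hg.1 p.snd).hasFDerivAt
      exact this.comp_hasDerivAt 0 h1
    have h3 : HasDerivAt (fun t : ℝ => inner ℝ w (S.C p + t • S.Q d)) (inner ℝ w (S.Q d)) 0 := by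
      have : (fun t : ℝ => inner ℝ w (S.C p + t • S.Q d)) =
          fun t => inner ℝ w (S.C p) + t * inner ℝ w (S.Q d) := by
        funext t; rw [inner_add_right, inner_smul_right]
      rw [this]
      simpa using ((hasDerivAt_id (0 : ℝ)).mul_const (inner ℝ w (S.Q d))).const_add
        (inner ℝ w (S.C p))
    have h4 : HasDerivAt (fun t : ℝ => ‖S.C p‖ ^ 2 + 2 * t * inner ℝ (S.C p) (S.Q d) +
        t ^ 2 * ‖S.Q d‖ ^ 2) (2 * inner ℝ (S.C p) (S.Q d)) 0 := by
      have h5 := (((hasDerivAt_id (0 : ℝ)).const_mul 2).mul_const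
        (inner ℝ (S.C p) (S.Q d))).const_add (‖S.C p‖ ^ 2)
      have h6 := ((hasDerivAt_id (0 : ℝ)).pow 2).mul_const (‖S.Q d‖ ^ 2)
      have h7 := h5.add h6
      simp at h7
      exact h7
    exact h2.add (h3.add (h4.const_mul (ρ / 2)))
  have h0 : IsLocalMin ψ 0 := Eventually.of_forall hmin'
  have := h0.hasDerivAt_eq_zero hderiv
  rw [inner_add_left, inner_smul_left]
  simp only [conj_trivial]
  linarith

namespace IsIteration

variable {ρ : ℝ} {X : ℕ → PiLp 2 E} {Z : ℕ → G} {w : ℕ → W}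

theorem multiplier_sub_mem (hS : S.Regular) (hI : S.IsIteration ρ X Z w) (k l : ℕ) :
    w k - w l ∈ LinearMap.range S.Q := by
  have h0 : ∀ k, w k - w 0 ∈ LinearMap.range S.Q := by
    intro k
    induction k with
    | zero => simp
    | succ k ih =>
      rw [hI.w_update, add_sub_right_comm]
      exact Submodule.add_mem _ ih (Submodule.smul_mem _ _ (hS.C_range _))
  simpa using Submodule.sub_mem _ (h0 k) (h0 l)

end IsIteration

variable [FiniteDimensional ℝ W] [FiniteDimensional ℝ K]

/-- Multiplier differences are controlled by differences of `Z`, since they lie in the image of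
`Q` and their image under the adjoint of `Q` is a difference of gradients of `g`. -/
theorem exists_multiplier_bound (hS : S.Regular) :
    ∃ c : ℝ, 0 < c ∧ ∀ ρ X Z w, S.IsIteration ρ X Z w → ∀ k l, ‖w k - w l‖ ≤ c * ‖Z k - Z l‖ := by
  obtain ⟨M, hM0, hM⟩ := hS.g_lip
  obtain ⟨c, hc, hQ⟩ := exists_bounded_preimage S.Q
  set I := LinearMap.toContinuousLinearMap S.ι
  refine ⟨M * ‖I‖ * c + 1, by positivity, fun ρ X Z w hI k l => ?_⟩
  obtain ⟨δ, hδ, hδn⟩ := hQ _ (hI.multiplier_sub_mem hS k l)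
  have h1 : ‖w k - w l‖ ^ 2 = -(fderiv ℝ S.g (Z k) - fderiv ℝ S.g (Z l)) (I δ) := by
    have a := hI.first_order k δ
    have b := hI.first_order l δ
    rw [← real_inner_self_eq_norm_sq]
    nth_rewrite 2 [← hδ]
    rw [inner_sub_left, sub_apply]
    have e : I δ = S.ι δ := rfl
    rw [e]
    linarith
  have h2 : ‖w k - w l‖ ^ 2 ≤ (M * ‖Z k - Z l‖) * (‖I‖ * (c * ‖w k - w l‖)) := by
    rw [h1]
    refine (neg_le_abs _).trans ((Real.norm_eq_abs _).symm.le.trans ?_)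
    refine (ContinuousLinearMap.le_opNorm _ _).trans ?_
    gcongr
    · exact hM.2 _ _
    · exact (I.le_opNorm δ).trans (by gcongr)
  rcases (norm_nonneg (w k - w l)).eq_or_lt with h0 | hpos
  · rw [← h0]; positivity
  · have h3 : ‖w k - w l‖ * ‖w k - w l‖ ≤ (M * ‖I‖ * c * ‖Z k - Z l‖) * ‖w k - w l‖ := by
      linarith [sq ‖w k - w l‖]
    have h4 := le_of_mul_le_mul_right h3 hpos
    linarith [norm_nonneg (Z k - Z l)]

end SplitProblem

namespace SplitProblem

variable {n : ℕ} {E : Fin (n + 1) → Type*} {G W K : Type*}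
  [∀ i, NormedAddCommGroup (E i)] [∀ i, InnerProductSpace ℝ (E i)]
  [NormedAddCommGroup G] [InnerProductSpace ℝ G]
  [NormedAddCommGroup W] [InnerProductSpace ℝ W]
  [NormedAddCommGroup K] [InnerProductSpace ℝ K]
  {S : SplitProblem E G W K}

/-! ### Sufficient decrease -/

omit [∀ i, NormedAddCommGroup (E i)] [∀ i, InnerProductSpace ℝ (E i)] in
theorem blend_zero (X' X : PiLp 2 E) : blend X' X 0 = X := by
  ext j; simp [blend]

omit [∀ i, NormedAddCommGroup (E i)] [∀ i, InnerProductSpace ℝ (E i)] in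
theorem blend_last (X' X : PiLp 2 E) : blend X' X (n + 1) = X' := by
  ext j
  exact if_pos j.isLt

omit [∀ i, NormedAddCommGroup (E i)] [∀ i, InnerProductSpace ℝ (E i)] in
theorem blend_succ_apply (X' X : PiLp 2 E) (i : Fin (n + 1)) :
    blend X' X (i + 1) i = X' i := by
  simp [blend]

theorem blend_succ_add (X' X : PiLp 2 E) (i : Fin (n + 1)) (z : G) :
    (WithLp.toLp 2 (blend X' X (i + 1), z) : WithLp 2 (PiLp 2 E × G)) + xDir G i (X i - X' i) =
      WithLp.toLp 2 (blend X' X i, z) := by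
  have h1 : blend X' X (i + 1) + PiLp.single 2 i (X i - X' i) = blend X' X i := by
    ext j
    rcases eq_or_ne j i with rfl | hj
    · simp [blend]
    · have hji : (j : ℕ) ≠ i := fun h => hj (Fin.ext h)
      have : (j : ℕ) < i + 1 ↔ (j : ℕ) < i := by omega
      simp only [blend, PiLp.add_apply, PiLp.single_eq_of_ne 2 hj, add_zero, this]
  have h2 : ∀ p q : WithLp 2 (PiLp 2 E × G), p.fst = q.fst → p.snd = q.snd → p = q :=
    fun p q h h' => WithLp.ofLp_injective 2 (Prod.ext h h')
  exact h2 _ _ h1 (by simp)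

theorem isFinite_blend {X' X : PiLp 2 E} {z' z : G} (h' : S.IsFinite (WithLp.toLp 2 (X', z')))
    (h : S.IsFinite (WithLp.toLp 2 (X, z))) (m : ℕ) :
    S.IsFinite (WithLp.toLp 2 (blend X' X m, z)) := by
  refine ⟨fun i => ?_, h.2⟩
  by_cases hi : (i : ℕ) < m
  · simpa [blend, hi] using h'.1 i
  · simpa [blend, hi] using h.1 i

omit [∀ i, InnerProductSpace ℝ (E i)] in
theorem norm_sub_blend_sq_le (X' X : PiLp 2 E) (m : ℕ) :
    ‖X' - blend X' X m‖ ^ 2 ≤ ‖X' - X‖ ^ 2 := by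
  rw [PiLp.norm_sq_eq_of_L2, PiLp.norm_sq_eq_of_L2]
  refine Finset.sum_le_sum fun i _ => ?_
  by_cases hi : (i : ℕ) < m
  · simp [blend, hi]
  · simp [blend, hi]

omit [∀ i, InnerProductSpace ℝ (E i)] [InnerProductSpace ℝ G] in
theorem norm_toLp_sub_sq (X X' : PiLp 2 E) (z z' : G) :
    ‖(WithLp.toLp 2 (X, z) : WithLp 2 (PiLp 2 E × G)) - WithLp.toLp 2 (X', z')‖ ^ 2 =
      ‖X - X'‖ ^ 2 + ‖z - z'‖ ^ 2 := by
  rw [WithLp.prod_norm_sq_eq_of_L2]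
  rfl

theorem norm_toLp_le {A B : Type*} [NormedAddCommGroup A] [NormedAddCommGroup B] (a : A) (b : B) :
    ‖(WithLp.toLp 2 (a, b) : WithLp 2 (A × B))‖ ≤ ‖a‖ + ‖b‖ := by
  refine (abs_le_of_sq_le_sq' ?_ (by positivity)).2
  rw [WithLp.prod_norm_sq_eq_of_L2]
  change ‖a‖ ^ 2 + ‖b‖ ^ 2 ≤ _
  linarith [mul_nonneg (norm_nonneg a) (norm_nonneg b), add_sq ‖a‖ ‖b‖]

namespace IsIteration

variable {ρ : ℝ} {X : ℕ → PiLp 2 E} {Z : ℕ → G} {w : ℕ → W}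

/-- The total decrease of the augmented Lagrangian over a Gauss–Seidel sweep. -/
theorem lag_sweep (hS : S.Regular) (hI : S.IsIteration ρ X Z w) {M₁ M₂ σ : ℝ}
    (hF : HasConvexityModulus (-M₁) S.F) (hf : ∀ i, HasConvexityModulusOnDom (-M₂) (S.f i))
    (hσ : ∀ p i (d : E i), σ * ‖d‖ ^ 2 ≤ ‖S.C (p + xDir G i d) - S.C p‖ ^ 2) (hρ : 0 ≤ ρ)
    (k : ℕ) :
    S.lag ρ (WithLp.toLp 2 (X (k + 1), Z k)) (w k) +
      (ρ * σ - M₁ - M₂) / 2 * ‖X (k + 1) - X k‖ ^ 2 ≤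
      S.lag ρ (WithLp.toLp 2 (X k, Z k)) (w k) := by
  have hfin := isFinite_blend (hI.finite (k + 1)) (hI.finite k)
  have hone : ∀ i : Fin (n + 1),
      S.lag ρ (WithLp.toLp 2 (blend (X (k + 1)) (X k) (i + 1), Z k)) (w k) +
        (ρ * σ - M₁ - M₂) / 2 * ‖X (k + 1) i - X k i‖ ^ 2 ≤
      S.lag ρ (WithLp.toLp 2 (blend (X (k + 1)) (X k) i, Z k)) (w k) := by
    intro i
    have h := lag_growth_x hS hF hf hσ hρ (hfin (i + 1)) (w := w k) (i := i)
      (fun d hd => hI.x_min k i d (by simpa [blend_succ_apply] using hd))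
      (d := X k i - X (k + 1) i) (by
        simpa [blend_succ_apply] using (hI.finite k).1 i)
    rwa [blend_succ_add, norm_sub_rev (X k i)] at h
  have hsum : ∀ m ≤ n + 1, S.lag ρ (WithLp.toLp 2 (blend (X (k + 1)) (X k) m, Z k)) (w k) +
      (ρ * σ - M₁ - M₂) / 2 *
        ∑ i : Fin (n + 1), (if (i : ℕ) < m then ‖X (k + 1) i - X k i‖ ^ 2 else 0) ≤
      S.lag ρ (WithLp.toLp 2 (X k, Z k)) (w k) := by
    intro m hm
    induction m with
    | zero => simp [blend_zero]
    | succ m ih =>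
      have h1 := ih (by omega)
      have h2 := hone ⟨m, hm⟩
      have h3 : ∑ i : Fin (n + 1), (if (i : ℕ) < m + 1 then ‖X (k + 1) i - X k i‖ ^ 2 else 0) =
          ∑ i : Fin (n + 1), (if (i : ℕ) < m then ‖X (k + 1) i - X k i‖ ^ 2 else 0) +
            ‖X (k + 1) ⟨m, hm⟩ - X k ⟨m, hm⟩‖ ^ 2 := by
        have : ‖X (k + 1) ⟨m, hm⟩ - X k ⟨m, hm⟩‖ ^ 2 = ∑ i : Fin (n + 1),
            (if i = ⟨m, hm⟩ then ‖X (k + 1) i - X k i‖ ^ 2 else 0) := by simp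
        rw [this, ← Finset.sum_add_distrib]
        refine Finset.sum_congr rfl fun i _ => ?_
        by_cases hi : i = ⟨m, hm⟩
        · simp [hi]
        · have : (i : ℕ) ≠ m := fun h => hi (Fin.ext h)
          have : (i : ℕ) < m + 1 ↔ (i : ℕ) < m := by omega
          simp [hi, this]
      rw [h3, mul_add]
      simp only at h2
      linarith
  have := hsum (n + 1) le_rfl
  rw [blend_last, Finset.sum_congr rfl fun i _ => if_pos i.isLt] at this
  rwa [PiLp.norm_sq_eq_of_L2]

end IsIteration

section Descent

variable [FiniteDimensional ℝ W] [FiniteDimensional ℝ K]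

/-- For large `ρ` the augmented Lagrangian decreases by a multiple of the squared primal step: the
increase `ρ⁻¹ ‖w (k + 1) - w k‖²` due to the multiplier update is absorbed by the decrease in
`Z`. -/
theorem exists_descent (hS : S.Regular) :
    ∃ a : ℝ, 0 < a ∧ ∃ ρ₀ : ℝ, 0 < ρ₀ ∧ ∀ ρ > ρ₀, ∀ X Z w, S.IsIteration ρ X Z w → ∀ k,
      S.lag ρ (WithLp.toLp 2 (X (k + 1), Z (k + 1))) (w (k + 1)) +
        a * ‖(WithLp.toLp 2 (X (k + 1), Z (k + 1)) : WithLp 2 (PiLp 2 E × G)) -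
          WithLp.toLp 2 (X k, Z k)‖ ^ 2 ≤
        S.lag ρ (WithLp.toLp 2 (X k, Z k)) (w k) := by
  obtain ⟨M₁, hM₁, hF⟩ := hS.F_lip
  obtain ⟨M₂, hM₂, hf⟩ := hS.f_modulus
  obtain ⟨σ, hσ, hσC⟩ := hS.C_expand_x
  obtain ⟨m, hm, ρ₁, hρ₁⟩ := hS.z_modulus
  obtain ⟨c, hc, hw⟩ := exists_multiplier_bound hS
  refine ⟨m / 4, by linarith, max (max 1 ρ₁) (max ((m + 2 * M₁ + M₂) / σ) (4 * c ^ 2 / m)),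
    lt_max_of_lt_left (lt_max_of_lt_left one_pos), fun ρ hρ X Z w hI k => ?_⟩
  simp only [gt_iff_lt, max_lt_iff] at hρ
  obtain ⟨⟨hρ0, hρ1⟩, hρ2, hρ3⟩ := hρ
  have hρpos : 0 < ρ := by linarith
  rw [div_lt_iff₀ hσ] at hρ2
  rw [div_lt_iff₀ hm] at hρ3
  have h1 := hI.lag_sweep hS (M₁ := 2 * M₁)
    (by simpa only [neg_mul] using hF.hasConvexityModulus hM₁) hf hσC hρpos.le k
  have h2 := lag_growth_z hS (hI.finite (k + 1)) (w := w k) (d := Z k - Z (k + 1))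
    (by simpa using (hI.finite k).2) (hρ₁ ρ hρ1 _ _) (hI.z_min k)
  have e : (WithLp.toLp 2 (X (k + 1), Z (k + 1)) : WithLp 2 (PiLp 2 E × G)) +
      zDir E (Z k - Z (k + 1)) = WithLp.toLp 2 (X (k + 1), Z k) := by
    apply WithLp.ofLp_injective 2
    exact Prod.ext (by simp) (by simp)
  rw [e, norm_sub_rev] at h2
  have h3 : S.lag ρ (WithLp.toLp 2 (X (k + 1), Z (k + 1))) (w (k + 1)) =
      S.lag ρ (WithLp.toLp 2 (X (k + 1), Z (k + 1))) (w k) + ‖w (k + 1) - w k‖ ^ 2 / ρ := by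
    set C := S.C (WithLp.toLp 2 (X (k + 1), Z (k + 1))) with hC
    have : w (k + 1) - w k = ρ • C := by rw [hI.w_update, add_sub_cancel_left]
    rw [lag_eq, lag_eq, ← hC, this, norm_smul, mul_pow, Real.norm_eq_abs, sq_abs]
    rw [hI.w_update, ← hC, inner_add_left, inner_smul_left, real_inner_self_eq_norm_sq]
    simp only [conj_trivial]
    field_simp
    ring
  have h4 : ‖w (k + 1) - w k‖ ^ 2 / ρ ≤ m / 4 * ‖Z (k + 1) - Z k‖ ^ 2 := by
    rw [div_le_iff₀ hρpos]
    calc ‖w (k + 1) - w k‖ ^ 2 ≤ (c * ‖Z (k + 1) - Z k‖) ^ 2 := by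
          gcongr; exact hw ρ X Z w hI _ _
      _ = c ^ 2 * ‖Z (k + 1) - Z k‖ ^ 2 := by ring
      _ ≤ (m / 4 * ρ) * ‖Z (k + 1) - Z k‖ ^ 2 := by
          gcongr; linarith
      _ = _ := by ring
  have h5 : m / 4 * ‖X (k + 1) - X k‖ ^ 2 ≤ (ρ * σ - 2 * M₁ - M₂) / 2 * ‖X (k + 1) - X k‖ ^ 2 := by
    exact mul_le_mul_of_nonneg_right (by linarith) (sq_nonneg _)
  rw [norm_toLp_sub_sq, h3]
  linarith

/-! ### Lower bound and boundedness -/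

/-- The augmented Lagrangian at an iterate dominates the objective at a nearby feasible point,
because the multiplier is determined on the image of `Q` by the gradient of `g`. -/
theorem exists_lower_bound (hS : S.Regular) :
    ∃ c : ℝ, 0 < c ∧ ∃ ρ₀ : ℝ, ∀ ρ > ρ₀, ∀ X Z w, S.IsIteration ρ X Z w → ∀ k, ∃ δ : G,
      ‖δ‖ ≤ c * ‖S.C (WithLp.toLp 2 (X k, Z k))‖ ∧
      S.C (WithLp.toLp 2 (X k, Z k + δ)) = 0 ∧
      S.IsFinite (WithLp.toLp 2 (X k, Z k + δ)) ∧
      S.nonsmoothReal (WithLp.toLp 2 (X k, Z k + δ)) + S.smooth (WithLp.toLp 2 (X k, Z k + δ)) +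
        ‖S.C (WithLp.toLp 2 (X k, Z k))‖ ^ 2 ≤
        S.lag ρ (WithLp.toLp 2 (X k, Z k)) (w k) := by
  obtain ⟨M, hM0, hM⟩ := hS.g_lip
  obtain ⟨c, hc, hQ⟩ := exists_bounded_preimage S.Q
  set I := LinearMap.toContinuousLinearMap S.ι
  refine ⟨‖I‖ * c + 1, by positivity, 2 * (M * (‖I‖ * c) ^ 2 + 1), fun ρ hρ X Z w hI k => ?_⟩
  set p : WithLp 2 (PiLp 2 E × G) := WithLp.toLp 2 (X k, Z k) with hp
  obtain ⟨δ, hδ, hδn⟩ := hQ _ (Submodule.neg_mem _ (hS.C_range p))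
  rw [norm_neg] at hδn
  have hIδ : ‖S.ι δ‖ ≤ ‖I‖ * c * ‖S.C p‖ :=
    (I.le_opNorm δ).trans (by rw [mul_assoc]; gcongr)
  have e : (WithLp.toLp 2 (X k, Z k + S.ι δ) : WithLp 2 (PiLp 2 E × G)) = p + zDir E (S.ι δ) := by
    apply WithLp.ofLp_injective 2
    exact Prod.ext (by simp [hp]) (by simp [hp])
  have hh : S.h (p.snd + S.ι δ) = S.h p.snd := hS.h_shift _ _
  refine ⟨S.ι δ, by linarith [norm_nonneg (S.C p)], ?_, ?_, ?_⟩
  · rw [e, hS.C_shift, hδ]; simp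
  · rw [e]; exact (hI.finite k).add_zDir (hh ▸ (hI.finite k).2)
  · rw [e, nonsmoothReal_add_zDir, hh, sub_self, add_zero, lag_eq]
    have h1 := (abs_le.1 (hM.abs_sub_le hM0 (Z k) (Z k + S.ι δ))).2
    rw [add_sub_cancel_left] at h1
    have h2 := hI.first_order k δ
    rw [hδ, inner_neg_right] at h2
    have h3 : M * ‖S.ι δ‖ ^ 2 ≤ M * (‖I‖ * c * ‖S.C p‖) ^ 2 := by gcongr
    have h4 : (2 * (M * (‖I‖ * c) ^ 2 + 1)) * ‖S.C p‖ ^ 2 ≤ ρ * ‖S.C p‖ ^ 2 := by gcongr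
    have e1 : (p + zDir E (S.ι δ)).fst = p.fst := by simp
    have e2 : (p + zDir E (S.ι δ)).snd = Z k + S.ι δ := rfl
    have e3 : p.snd = Z k := rfl
    rw [smooth, e1, e2, e3]
    linarith

end Descent

/-- Sublevel sets of the objective in the feasible set are bounded. -/
theorem exists_bound_of_objective_le (hS : S.Regular) (B : ℝ) :
    ∃ R : ℝ, ∀ p, S.C p = 0 → S.IsFinite p → S.nonsmoothReal p + S.smooth p ≤ B → ‖p‖ ≤ R := by
  by_contra! hcon
  choose p hC hfin hle hR using fun k : ℕ => hcon k
  have h1 := hS.coercive p hC (tendsto_atTop_mono (fun k => (hR k).le) tendsto_natCast_atTop_atTop)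
  have h2 := h1.eventually_const_lt (EReal.coe_lt_top B)
  obtain ⟨k, hk⟩ := h2.exists
  rw [(hfin k).objective_eq hS, EReal.coe_lt_coe_iff] at hk
  exact absurd (hle k) (not_le.2 hk)

theorem exists_real_lower_bound {H : Type*} [NormedAddCommGroup H] [InnerProductSpace ℝ H]
    [FiniteDimensional ℝ H] {f : H → EReal} (hf : LowerSemicontinuous f) (hbot : ∀ x, f x ≠ ⊥)
    (R : ℝ) : ∃ b : ℝ, ∀ x, ‖x‖ ≤ R → f x ≠ ⊤ → b ≤ (f x).toReal := by
  have := FiniteDimensional.proper ℝ H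
  rcases lt_or_ge R 0 with hR | hR
  · exact ⟨0, fun x hx => absurd ((norm_nonneg x).trans hx) (not_le.2 hR)⟩
  obtain ⟨y, -, hy⟩ := (hf.lowerSemicontinuousOn (Metric.closedBall 0 R)).exists_isMinOn
    ⟨0, by simpa using hR⟩ (isCompact_closedBall _ _)
  refine ⟨(f y).toReal, fun x hx hxt => ?_⟩
  exact EReal.toReal_le_toReal (hy (by simpa using hx)) (hbot y) hxt

variable [∀ i, FiniteDimensional ℝ (E i)] [FiniteDimensional ℝ G]

/-- The objective is bounded below on the feasible set. -/
theorem exists_objective_lower_bound (hS : S.Regular) :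
    ∃ B : ℝ, ∀ p, S.C p = 0 → S.IsFinite p → B ≤ S.nonsmoothReal p + S.smooth p := by
  obtain ⟨R, hR⟩ := exists_bound_of_objective_le hS 0
  choose b hb using fun i => exists_real_lower_bound (hS.f_lsc i) (hS.f_ne_bot i) R
  obtain ⟨b', hb'⟩ := exists_real_lower_bound hS.h_lsc hS.h_ne_bot R
  obtain ⟨_, _, hF⟩ := hS.F_lip
  obtain ⟨_, _, hg⟩ := hS.g_lip
  have hcont : Continuous S.smooth :=
    (hF.1.continuous.comp (WithLp.fstL 2 ℝ (PiLp 2 E) G).continuous).add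
      (hg.1.continuous.comp (WithLp.sndL 2 ℝ (PiLp 2 E) G).continuous)
  have := FiniteDimensional.proper ℝ (WithLp 2 (PiLp 2 E × G))
  obtain ⟨b'', hb''⟩ := (isCompact_closedBall (0 : WithLp 2 (PiLp 2 E × G)) R).bddBelow_image
    hcont.continuousOn
  refine ⟨min 0 (∑ i, b i + b' + b''), fun p hC hfin => ?_⟩
  rcases le_total 0 (S.nonsmoothReal p + S.smooth p) with h | h
  · exact (min_le_left _ _).trans h
  · refine (min_le_right _ _).trans ?_
    have hp := hR p hC hfin h
    have h1 : ∑ i, b i ≤ ∑ i, (S.f i (p.fst i)).toReal := Finset.sum_le_sum fun i _ =>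
      hb i _ ((PiLp.norm_apply_le _ i).trans ((WithLp.norm_fst_le _ p).trans hp)) (hfin.1 i)
    have h2 := hb' _ ((WithLp.norm_snd_le _ p).trans hp) hfin.2
    have h3 : b'' ≤ S.smooth p := hb'' ⟨p, by simpa using hp, rfl⟩
    simp only [nonsmoothReal]
    linarith

variable [FiniteDimensional ℝ W] [FiniteDimensional ℝ K]

/-- What the descent argument yields for large `ρ`: sufficient decrease, a lower bound for the
augmented Lagrangian along the iterates, and boundedness of the iterates. -/
theorem exists_descent_bounded (hS : S.Regular) :
    ∃ a : ℝ, 0 < a ∧ ∃ ρ₀ : ℝ, 0 < ρ₀ ∧ ∀ ρ > ρ₀, ∀ X Z w, S.IsIteration ρ X Z w →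
      (∀ k, S.lag ρ (WithLp.toLp 2 (X (k + 1), Z (k + 1))) (w (k + 1)) +
        a * ‖(WithLp.toLp 2 (X (k + 1), Z (k + 1)) : WithLp 2 (PiLp 2 E × G)) -
          WithLp.toLp 2 (X k, Z k)‖ ^ 2 ≤ S.lag ρ (WithLp.toLp 2 (X k, Z k)) (w k)) ∧
      (∃ B, ∀ k, B ≤ S.lag ρ (WithLp.toLp 2 (X k, Z k)) (w k)) ∧
      ∃ R, ∀ k, ‖(WithLp.toLp 2 (WithLp.toLp 2 (X k, Z k), w k) :
        WithLp 2 (WithLp 2 (PiLp 2 E × G) × W))‖ ≤ R := by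
  obtain ⟨a, ha, ρ₀, hρ₀, hdesc⟩ := exists_descent hS
  obtain ⟨c, hc, ρ₁, hlow⟩ := exists_lower_bound hS
  obtain ⟨B, hB⟩ := exists_objective_lower_bound hS
  obtain ⟨cw, hcw, hw⟩ := exists_multiplier_bound hS
  refine ⟨a, ha, max ρ₀ ρ₁, lt_max_of_lt_left hρ₀, fun ρ hρ X Z w hI => ?_⟩
  obtain ⟨hρ0, hρ1⟩ := max_lt_iff.1 hρ
  have hd := hdesc ρ hρ0 X Z w hI
  choose δ hδ hδC hδf hδl using hlow ρ hρ1 X Z w hI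
  set p : ℕ → WithLp 2 (PiLp 2 E × G) := fun k => WithLp.toLp 2 (X k, Z k) with hp
  have hanti : Antitone fun k => S.lag ρ (p k) (w k) := antitone_nat_of_succ_le fun k => by
    have := hd k
    have h2 : 0 ≤ a * ‖p (k + 1) - p k‖ ^ 2 := by positivity
    linarith
  refine ⟨hd, ⟨B, fun k => ?_⟩, ?_⟩
  · have := hB _ (hδC k) (hδf k)
    have := hδl k
    linarith [sq_nonneg ‖S.C (WithLp.toLp 2 (X k, Z k))‖]
  · set ℓ₀ := S.lag ρ (p 0) (w 0)
    obtain ⟨R, hR⟩ := exists_bound_of_objective_le hS ℓ₀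
    have hk : ∀ k, S.lag ρ (WithLp.toLp 2 (X k, Z k)) (w k) ≤ ℓ₀ := fun k => hanti (Nat.zero_le k)
    have hC : ∀ k, ‖S.C (WithLp.toLp 2 (X k, Z k))‖ ≤ 1 + (ℓ₀ - B) := fun k => by
      have h1 := hB _ (hδC k) (hδf k)
      have h2 := hδl k
      have h3 := hk k
      nlinarith [sq_nonneg (‖S.C (WithLp.toLp 2 (X k, Z k))‖ - 1)]
    have hpR : ∀ k, ‖(WithLp.toLp 2 (X k, Z k + δ k) : WithLp 2 (PiLp 2 E × G))‖ ≤ R := fun k =>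
      hR _ (hδC k) (hδf k) (by
        linarith [hδl k, hk k, sq_nonneg ‖S.C (WithLp.toLp 2 (X k, Z k))‖])
    have hX : ∀ k, ‖X k‖ ≤ R := fun k => (WithLp.norm_fst_le _ _).trans (hpR k)
    have hZ : ∀ k, ‖Z k‖ ≤ R + c * (1 + (ℓ₀ - B)) := fun k => by
      have h1 : ‖Z k + δ k‖ ≤ R := (WithLp.norm_snd_le _ _).trans (hpR k)
      have h2 : ‖δ k‖ ≤ c * (1 + (ℓ₀ - B)) :=
        (hδ k).trans (mul_le_mul_of_nonneg_left (hC k) hc.le)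
      have h3 := norm_sub_le (Z k + δ k) (δ k)
      rw [add_sub_cancel_right] at h3
      linarith
    set RZ := R + c * (1 + (ℓ₀ - B))
    have hW : ∀ k, ‖w k‖ ≤ ‖w 0‖ + cw * (RZ + RZ) := fun k => by
      have h1 := hw ρ X Z w hI k 0
      have h2 := (norm_sub_le (Z k) (Z 0)).trans (add_le_add (hZ k) (hZ 0))
      have h3 := norm_sub_norm_le (w k) (w 0)
      have h4 := mul_le_mul_of_nonneg_left h2 hcw.le
      linarith
    have htri : ∀ k, ‖(WithLp.toLp 2 (WithLp.toLp 2 (X k, Z k), w k) :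
        WithLp 2 (WithLp 2 (PiLp 2 E × G) × W))‖ ≤ ‖X k‖ + ‖Z k‖ + ‖w k‖ := fun k =>
      (norm_toLp_le _ _).trans (add_le_add_left (norm_toLp_le _ _) _)
    exact ⟨R + RZ + (‖w 0‖ + cw * (RZ + RZ)), fun k => (htri k).trans
      (add_le_add (add_le_add (hX k) (hZ k)) (hW k))⟩

end SplitProblem

/-! ### Smooth parts and their gradients -/

section

variable {H H' : Type*} [NormedAddCommGroup H] [InnerProductSpace ℝ H]
  [NormedAddCommGroup H'] [InnerProductSpace ℝ H']

theorem IsLipschitzDifferentiable.comp_continuousLinearMap {M : ℝ} {g : H' → ℝ}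
    (hg : IsLipschitzDifferentiable M g) (hM : 0 ≤ M) (T : H →L[ℝ] H') :
    IsLipschitzDifferentiable (M * ‖T‖ * ‖T‖) fun x => g (T x) := by
  have hd : ∀ x, HasFDerivAt (fun x => g (T x)) ((fderiv ℝ g (T x)).comp T) x := fun x =>
    (hg.1 (T x)).hasFDerivAt.comp x T.hasFDerivAt
  refine ⟨fun x => (hd x).differentiableAt, fun x y => ?_⟩
  rw [(hd x).fderiv, (hd y).fderiv, ← ContinuousLinearMap.sub_comp]
  refine (ContinuousLinearMap.opNorm_comp_le _ _).trans ?_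
  have h1 := hg.2 (T x) (T y)
  rw [← map_sub] at h1
  have h2 := h1.trans (mul_le_mul_of_nonneg_left (T.le_opNorm (x - y)) hM)
  calc _ ≤ (M * (‖T‖ * ‖x - y‖)) * ‖T‖ := by gcongr
    _ = _ := by ring

theorem IsLipschitzDifferentiable.add {M M' : ℝ} {g g' : H → ℝ}
    (hg : IsLipschitzDifferentiable M g) (hg' : IsLipschitzDifferentiable M' g') :
    IsLipschitzDifferentiable (M + M') fun x => g x + g' x := by
  refine ⟨hg.1.add hg'.1, fun x y => ?_⟩
  have hd : ∀ x, fderiv ℝ (fun x => g x + g' x) x = fderiv ℝ g x + fderiv ℝ g' x := fun x =>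
    ((hg.1 x).hasFDerivAt.add (hg'.1 x).hasFDerivAt).fderiv
  rw [hd, hd, add_sub_add_comm, add_mul]
  exact (norm_add_le _ _).trans (add_le_add (hg.2 x y) (hg'.2 x y))

variable [FiniteDimensional ℝ H]

/-- Limits of regular subgradients, given as functionals, are general subgradients. -/
theorem mem_generalSubgradient_of_tendsto {f : H → EReal} (hbot : ∀ x, f x ≠ ⊥) {x : H}
    (hx : f x ≠ ⊤) {xs : ℕ → H} (hxs : Tendsto xs atTop (𝓝 x))
    (hf : Tendsto (fun k => (f (xs k)).toReal) atTop (𝓝 (f x).toReal))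
    {Λs : ℕ → H →L[ℝ] ℝ} {Λ : H →L[ℝ] ℝ}
    (hreg : ∀ k, HasRegularSubderivative f (xs k) (Λs k)) (hΛ : Tendsto Λs atTop (𝓝 Λ)) :
    ∃ v ∈ generalSubgradient f x, ‖v‖ = ‖Λ‖ ∧ ∀ d, inner ℝ v d = Λ d := by
  have := FiniteDimensional.complete ℝ H
  set D := InnerProductSpace.toDual ℝ H
  have hD : ∀ (Λ : H →L[ℝ] ℝ), innerSL ℝ (D.symm Λ) = Λ := fun Λ => by
    ext d
    rw [innerSL_apply_apply, InnerProductSpace.toDual_symm_apply]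
  refine ⟨D.symm Λ, ⟨hx, xs, fun k => D.symm (Λs k), hxs, ?_, fun k => ?_, ?_⟩, ?_, fun d => ?_⟩
  · have h1 := (continuous_coe_real_ereal.tendsto _).comp hf
    rw [EReal.coe_toReal hx (hbot x)] at h1
    exact h1.congr fun k => EReal.coe_toReal (hreg k).1 (hbot _)
  · exact HasRegularSubderivative.isRegularSubgradient ((hD (Λs k)).symm ▸ hreg k) hbot
  · exact (D.symm.continuous.tendsto _).comp hΛ
  · exact D.symm.norm_map Λ
  · exact InnerProductSpace.toDual_symm_apply

end

theorem tendsto_toLp {A B : Type*} [NormedAddCommGroup A] [NormedAddCommGroup B] {u : ℕ → A}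
    {v : ℕ → B} {a : A} {b : B} (hu : Tendsto u atTop (𝓝 a)) (hv : Tendsto v atTop (𝓝 b)) :
    Tendsto (fun k => (WithLp.toLp 2 (u k, v k) : WithLp 2 (A × B))) atTop
      (𝓝 (WithLp.toLp 2 (a, b))) :=
  ((WithLp.prod_continuous_toLp 2 A B).tendsto (a, b)).comp (hu.prodMk_nhds hv)

namespace SplitProblem

variable {n : ℕ} {E : Fin (n + 1) → Type*} {G W K : Type*}
  [∀ i, NormedAddCommGroup (E i)] [∀ i, InnerProductSpace ℝ (E i)]
  [NormedAddCommGroup G] [InnerProductSpace ℝ G]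
  [NormedAddCommGroup W] [InnerProductSpace ℝ W]
  [NormedAddCommGroup K] [InnerProductSpace ℝ K]
  {S : SplitProblem E G W K}

/-- The inclusion of the primal variables into the primal-dual variables. -/
noncomputable def primal (E : Fin (n + 1) → Type*) [∀ i, NormedAddCommGroup (E i)]
    [∀ i, InnerProductSpace ℝ (E i)] (G W : Type*) [NormedAddCommGroup G]
    [InnerProductSpace ℝ G] [NormedAddCommGroup W] [InnerProductSpace ℝ W] :
    WithLp 2 (PiLp 2 E × G) →L[ℝ] WithLp 2 (WithLp 2 (PiLp 2 E × G) × W) :=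
  (WithLp.prodContinuousLinearEquiv 2 ℝ _ W).symm.toContinuousLinearMap.comp
    (ContinuousLinearMap.inl ℝ _ W)

/-- The inclusion of the multipliers into the primal-dual variables. -/
noncomputable def dual (E : Fin (n + 1) → Type*) [∀ i, NormedAddCommGroup (E i)]
    [∀ i, InnerProductSpace ℝ (E i)] (G W : Type*) [NormedAddCommGroup G]
    [InnerProductSpace ℝ G] [NormedAddCommGroup W] [InnerProductSpace ℝ W] :
    W →L[ℝ] WithLp 2 (WithLp 2 (PiLp 2 E × G) × W) :=
  (WithLp.prodContinuousLinearEquiv 2 ℝ (WithLp 2 (PiLp 2 E × G)) W).symm.toContinuousLinearMap.comp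
    (ContinuousLinearMap.inr ℝ _ W)

/-- The coordinate projection onto the block `E i`. -/
noncomputable def xProj (E : Fin (n + 1) → Type*) [∀ i, NormedAddCommGroup (E i)]
    [∀ i, InnerProductSpace ℝ (E i)] (G : Type*) [NormedAddCommGroup G] [InnerProductSpace ℝ G]
    (i : Fin (n + 1)) : WithLp 2 (PiLp 2 E × G) →L[ℝ] E i :=
  (PiLp.proj 2 E i).comp (WithLp.fstL 2 ℝ (PiLp 2 E) G)

@[simp] theorem xProj_apply (i : Fin (n + 1)) (p : WithLp 2 (PiLp 2 E × G)) :
    xProj E G i p = p.fst i := rfl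

theorem sum_xDir_add_zDir (p : WithLp 2 (PiLp 2 E × G)) :
    ∑ i, xDir G i (p.fst i) + zDir E p.snd = p := by
  apply (WithLp.prodContinuousLinearEquiv 2 ℝ (PiLp 2 E) G).injective
  rw [map_add, map_sum]
  refine Prod.ext ?_ ?_
  · rw [Prod.fst_add, Prod.fst_sum]
    change ∑ i, PiLp.single 2 i (p.fst i) + 0 = p.fst
    ext j
    rw [add_zero, WithLp.ofLp_sum, Finset.sum_apply, Finset.sum_eq_single j]
    · simp
    · intro i _ hi
      exact PiLp.single_eq_of_ne 2 hi.symm _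
    · simp
  · rw [Prod.snd_add, Prod.snd_sum]
    change ∑ i : Fin (n + 1), (0 : G) + p.snd = p.snd
    simp

/-- The functional on the primal space that acts as `Λ i` on the block `X_i` and as `Λz` on the
block `Z`. -/
noncomputable def assemble (Λ : Fin (n + 1) → WithLp 2 (PiLp 2 E × G) →L[ℝ] ℝ)
    (Λz : WithLp 2 (PiLp 2 E × G) →L[ℝ] ℝ) : WithLp 2 (PiLp 2 E × G) →L[ℝ] ℝ :=
  ∑ i, ((Λ i).comp (xDir G i)).comp (xProj E G i) +
    (Λz.comp (zDir E)).comp (WithLp.sndL 2 ℝ (PiLp 2 E) G)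

theorem assemble_sub_apply (Λ : Fin (n + 1) → WithLp 2 (PiLp 2 E × G) →L[ℝ] ℝ)
    (Λz Λ₀ : WithLp 2 (PiLp 2 E × G) →L[ℝ] ℝ) (p : WithLp 2 (PiLp 2 E × G)) :
    (assemble Λ Λz - Λ₀) p =
      ∑ i, (Λ i - Λ₀) (xDir G i (p.fst i)) + (Λz - Λ₀) (zDir E p.snd) := by
  have h : Λ₀ p = ∑ i, Λ₀ (xDir G i (p.fst i)) + Λ₀ (zDir E p.snd) := by
    rw [← map_sum, ← map_add, sum_xDir_add_zDir]
  simp only [assemble, sub_apply, add_apply, sum_apply, ContinuousLinearMap.comp_apply,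
    xProj_apply, Finset.sum_sub_distrib]
  rw [h]
  change _ + Λz (zDir E p.snd) - _ = _
  ring

theorem norm_xDir_le (i : Fin (n + 1)) (d : E i) : ‖xDir G i d‖ ≤ ‖d‖ := by
  have := norm_toLp_le (PiLp.single 2 i d) (0 : G)
  rwa [PiLp.norm_single, norm_zero, add_zero] at this

theorem norm_zDir_le (d : G) : ‖zDir E d‖ ≤ ‖d‖ := by
  have := norm_toLp_le (0 : PiLp 2 E) d
  rwa [norm_zero, zero_add] at this

theorem norm_primal_le (p : WithLp 2 (PiLp 2 E × G)) : ‖primal E G W p‖ ≤ ‖p‖ := by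
  have := norm_toLp_le p (0 : W)
  rwa [norm_zero, add_zero] at this

theorem norm_assemble_sub_le {Λ : Fin (n + 1) → WithLp 2 (PiLp 2 E × G) →L[ℝ] ℝ}
    {Λz Λ₀ : WithLp 2 (PiLp 2 E × G) →L[ℝ] ℝ} {ε : ℝ} (hε : 0 ≤ ε) (hΛ : ∀ i, ‖Λ i - Λ₀‖ ≤ ε)
    (hΛz : ‖Λz - Λ₀‖ ≤ ε) : ‖assemble Λ Λz - Λ₀‖ ≤ (n + 2) * ε := by
  refine ContinuousLinearMap.opNorm_le_bound _ (by positivity) fun p => ?_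
  rw [assemble_sub_apply]
  have h1 : ∀ i, ‖(Λ i - Λ₀) (xDir G i (p.fst i))‖ ≤ ε * ‖p‖ := fun i =>
    (ContinuousLinearMap.le_opNorm _ _).trans (mul_le_mul (hΛ i)
      ((norm_xDir_le i _).trans ((PiLp.norm_apply_le _ i).trans (WithLp.norm_fst_le _ p)))
      (norm_nonneg _) hε)
  have h2 : ‖(Λz - Λ₀) (zDir E p.snd)‖ ≤ ε * ‖p‖ :=
    (ContinuousLinearMap.le_opNorm _ _).trans (mul_le_mul hΛz
      ((norm_zDir_le _).trans (WithLp.norm_snd_le _ p)) (norm_nonneg _) hε)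
  refine (norm_add_le _ _).trans ((add_le_add ((norm_sum_le _ _).trans
    (Finset.sum_le_sum fun i _ => h1 i)) h2).trans ?_)
  simp only [Finset.sum_const, Finset.card_univ, Fintype.card_fin, nsmul_eq_mul]
  push_cast
  linarith

variable (S) in
/-- The augmented part `⟪w, C⟫ + ρ/2 ‖C‖²` of the augmented Lagrangian. -/
noncomputable def aug (ρ : ℝ) (q : WithLp 2 (WithLp 2 (PiLp 2 E × G) × W)) : ℝ :=
  inner ℝ q.snd (S.C q.fst) + ρ / 2 * ‖S.C q.fst‖ ^ 2

theorem contDiff_aug (hS : S.Regular) (ρ : ℝ) : ContDiff ℝ 2 (S.aug ρ) := by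
  have h1 : ContDiff ℝ 2 fun q : WithLp 2 (WithLp 2 (PiLp 2 E × G) × W) => S.C q.fst :=
    hS.C_contDiff.comp (WithLp.fstL 2 ℝ (WithLp 2 (PiLp 2 E × G)) W).contDiff
  have h2 : ContDiff ℝ 2 fun q : WithLp 2 (WithLp 2 (PiLp 2 E × G) × W) => q.snd :=
    (WithLp.sndL 2 ℝ (WithLp 2 (PiLp 2 E × G)) W).contDiff
  exact (h2.inner ℝ h1).add (contDiff_const.mul (h1.norm_sq ℝ))

theorem smooth_lip (hS : S.Regular) : ∃ M, 0 ≤ M ∧ IsLipschitzDifferentiable M S.smooth := by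
  obtain ⟨M, hM, hF⟩ := hS.F_lip
  obtain ⟨M', hM', hg⟩ := hS.g_lip
  exact ⟨_, by positivity, (hF.comp_continuousLinearMap hM (WithLp.fstL 2 ℝ (PiLp 2 E) G)).add
    (hg.comp_continuousLinearMap hM' (WithLp.sndL 2 ℝ (PiLp 2 E) G))⟩

theorem hasFDerivAt_coupling (hS : S.Regular) (ρ : ℝ)
    (q : WithLp 2 (WithLp 2 (PiLp 2 E × G) × W)) :
    HasFDerivAt (S.coupling ρ) ((fderiv ℝ S.smooth q.fst).comp
      (WithLp.fstL 2 ℝ (WithLp 2 (PiLp 2 E × G)) W) + fderiv ℝ (S.aug ρ) q) q := by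
  obtain ⟨_, _, hs⟩ := smooth_lip hS
  have h1 : HasFDerivAt (fun q : WithLp 2 (WithLp 2 (PiLp 2 E × G) × W) => S.smooth q.fst)
      ((fderiv ℝ S.smooth q.fst).comp (WithLp.fstL 2 ℝ (WithLp 2 (PiLp 2 E × G)) W)) q :=
    HasFDerivAt.comp q (hs.1 q.fst).hasFDerivAt
      (WithLp.fstL 2 ℝ (WithLp 2 (PiLp 2 E × G)) W).hasFDerivAt
  exact h1.add ((contDiff_aug hS ρ).differentiable two_ne_zero q).hasFDerivAt

theorem fderiv_coupling_primal (hS : S.Regular) (ρ : ℝ)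
    (q : WithLp 2 (WithLp 2 (PiLp 2 E × G) × W)) :
    (fderiv ℝ (S.coupling ρ) q).comp (primal E G W) =
      fderiv ℝ S.smooth q.fst + (fderiv ℝ (S.aug ρ) q).comp (primal E G W) := by
  rw [(hasFDerivAt_coupling hS ρ q).fderiv]
  ext d
  rfl

theorem hasFDerivAt_aug (hS : S.Regular) (ρ : ℝ) (q d : WithLp 2 (WithLp 2 (PiLp 2 E × G) × W)) :
    fderiv ℝ (S.aug ρ) q d = inner ℝ q.snd (fderiv ℝ S.C q.fst d.fst) + inner ℝ d.snd (S.C q.fst) +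
      ρ * inner ℝ (S.C q.fst) (fderiv ℝ S.C q.fst d.fst) := by
  have h1 : HasFDerivAt (fun q : WithLp 2 (WithLp 2 (PiLp 2 E × G) × W) => S.C q.fst)
      ((fderiv ℝ S.C q.fst).comp (WithLp.fstL 2 ℝ (WithLp 2 (PiLp 2 E × G)) W)) q :=
    HasFDerivAt.comp q (hS.C_contDiff.differentiable two_ne_zero q.fst).hasFDerivAt
      (WithLp.fstL 2 ℝ (WithLp 2 (PiLp 2 E × G)) W).hasFDerivAt
  have h2 : HasFDerivAt (fun q : WithLp 2 (WithLp 2 (PiLp 2 E × G) × W) => q.snd)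
      (WithLp.sndL 2 ℝ (WithLp 2 (PiLp 2 E × G)) W) q :=
    (WithLp.sndL 2 ℝ (WithLp 2 (PiLp 2 E × G)) W).hasFDerivAt
  have h3 := (h2.inner ℝ h1).add (h1.norm_sq.const_mul (ρ / 2))
  have h4 : HasFDerivAt (S.aug ρ) _ q := h3
  rw [h4.fderiv]
  simp [fderivInnerCLM_apply]
  ring

theorem fderiv_coupling_dual (hS : S.Regular) (ρ : ℝ)
    (q : WithLp 2 (WithLp 2 (PiLp 2 E × G) × W)) (d : W) :
    fderiv ℝ (S.coupling ρ) q (dual E G W d) = inner ℝ d (S.C q.fst) := by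
  rw [(hasFDerivAt_coupling hS ρ q).fderiv, add_apply, hasFDerivAt_aug hS]
  have e1 : (dual E G W d).fst = 0 := rfl
  have e2 : (dual E G W d).snd = d := rfl
  have e3 : (WithLp.fstL 2 ℝ (WithLp 2 (PiLp 2 E × G)) W) (dual E G W d) = 0 := rfl
  simp [e1, e2, e3]

theorem exists_lipschitz_fderiv_coupling [∀ i, FiniteDimensional ℝ (E i)] [FiniteDimensional ℝ G]
    [FiniteDimensional ℝ W] (hS : S.Regular) (ρ R : ℝ) :
    ∃ L : ℝ, 0 ≤ L ∧ ∀ q q' : WithLp 2 (WithLp 2 (PiLp 2 E × G) × W), ‖q‖ ≤ R → ‖q'‖ ≤ R →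
      ‖fderiv ℝ (S.coupling ρ) q - fderiv ℝ (S.coupling ρ) q'‖ ≤ L * ‖q - q'‖ := by
  obtain ⟨L, hL⟩ := exists_lipschitz_fderiv_of_contDiff (contDiff_aug hS ρ) R
  obtain ⟨M, hM, hs⟩ := smooth_lip hS
  have hs' := hs.comp_continuousLinearMap hM (WithLp.fstL 2 ℝ (WithLp 2 (PiLp 2 E × G)) W)
  set M' := M * ‖WithLp.fstL 2 ℝ (WithLp 2 (PiLp 2 E × G)) W‖ *
    ‖WithLp.fstL 2 ℝ (WithLp 2 (PiLp 2 E × G)) W‖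
  have hd : ∀ q, fderiv ℝ (S.coupling ρ) q = fderiv ℝ (fun q => S.smooth
      (WithLp.fstL 2 ℝ (WithLp 2 (PiLp 2 E × G)) W q)) q + fderiv ℝ (S.aug ρ) q := fun q =>
    ((hs'.1 q).hasFDerivAt.add
      ((contDiff_aug hS ρ).differentiable two_ne_zero q).hasFDerivAt).fderiv
  refine ⟨M' + |L|, by positivity, fun q q' hq hq' => ?_⟩
  rw [hd, hd, add_sub_add_comm, add_mul]
  refine (norm_add_le _ _).trans (add_le_add (hs'.2 q q') ((hL q q' hq hq').trans ?_))
  gcongr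
  exact le_abs_self L

theorem hasFDerivAt_coupling_line {A : Type*} [NormedAddCommGroup A] [NormedSpace ℝ A]
    (hS : S.Regular) (ρ : ℝ) (w : W) (T : A →L[ℝ] WithLp 2 (PiLp 2 E × G))
    (r : WithLp 2 (PiLp 2 E × G)) (x : A) :
    HasFDerivAt (fun y => S.coupling ρ (WithLp.toLp 2 (r + T (y - x), w)))
      (((fderiv ℝ (S.coupling ρ) (WithLp.toLp 2 (r, w))).comp (primal E G W)).comp T) x := by
  set q : WithLp 2 (WithLp 2 (PiLp 2 E × G) × W) := WithLp.toLp 2 (r, w) with hq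
  have h1 : HasFDerivAt (fun y => q + ((primal E G W).comp T) (y - x))
      ((primal E G W).comp T) x := by
    have := ((primal E G W).comp T).hasFDerivAt.comp x ((hasFDerivAt_id x).sub_const x)
    simpa using this.const_add q
  have h2 : HasFDerivAt (S.coupling ρ) (fderiv ℝ (S.coupling ρ) q)
      (q + ((primal E G W).comp T) (x - x)) := by
    rw [sub_self, map_zero, add_zero]
    exact (hasFDerivAt_coupling hS ρ q).differentiableAt.hasFDerivAt
  have e : (fun y => S.coupling ρ (WithLp.toLp 2 (r + T (y - x), w))) =
      S.coupling ρ ∘ fun y => q + ((primal E G W).comp T) (y - x) := by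
    funext y
    refine congrArg (S.coupling ρ) (WithLp.ofLp_injective 2 (Prod.ext rfl ?_))
    change w = w + 0
    rw [add_zero]
  rw [e]
  exact h2.comp x h1

theorem neg_assemble (Λ : Fin (n + 1) → WithLp 2 (PiLp 2 E × G) →L[ℝ] ℝ)
    (Λz : WithLp 2 (PiLp 2 E × G) →L[ℝ] ℝ) :
    -assemble Λ Λz = ∑ i, (-((Λ i).comp (xDir G i))).comp (xProj E G i) +
      (-(Λz.comp (zDir E))).comp (WithLp.sndL 2 ℝ (PiLp 2 E) G) := by
  simp only [assemble, neg_add, ContinuousLinearMap.neg_comp, Finset.sum_neg_distrib]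

/-! ### Subgradients at the iterates -/

namespace IsIteration

variable {ρ : ℝ} {X : ℕ → PiLp 2 E} {Z : ℕ → G} {w : ℕ → W}

/-- The optimality conditions of the block updates, assembled into a regular subgradient of the
nonsmooth part: block `X_i` contributes the gradient of the smooth part at the point where `X_i`
was updated. -/
theorem hasRegularSubderivative_nonsmooth (hS : S.Regular) (hI : S.IsIteration ρ X Z w) (k : ℕ) :
    HasRegularSubderivative S.nonsmooth (WithLp.toLp 2 (X (k + 1), Z (k + 1)))
      (-assemble
        (fun i : Fin (n + 1) => (fderiv ℝ (S.coupling ρ)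
          (WithLp.toLp 2 (WithLp.toLp 2 (blend (X (k + 1)) (X k) (i + 1), Z k), w k))).comp
            (primal E G W))
        ((fderiv ℝ (S.coupling ρ)
          (WithLp.toLp 2 (WithLp.toLp 2 (X (k + 1), Z (k + 1)), w k))).comp (primal E G W))) := by
  set p : WithLp 2 (PiLp 2 E × G) := WithLp.toLp 2 (X (k + 1), Z (k + 1)) with hp
  set r : Fin (n + 1) → WithLp 2 (PiLp 2 E × G) := fun i =>
    WithLp.toLp 2 (blend (X (k + 1)) (X k) (i + 1), Z k) with hr
  have hx : ∀ i, HasRegularSubderivative (S.f i) (xProj E G i p)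
      (-(((fderiv ℝ (S.coupling ρ) (WithLp.toLp 2 (r i, w k))).comp (primal E G W)).comp
        (xDir G i))) := by
    intro i
    refine HasRegularSubderivative.of_isMin_add ((hI.finite (k + 1)).1 i)
      (hasFDerivAt_coupling_line hS ρ (w k) (xDir G i) (r i) (X (k + 1) i)) fun y hy => ?_
    have h1 := hI.x_min k i (y - X (k + 1) i) (by simpa using hy)
    have e : (r i).fst i = X (k + 1) i := blend_succ_apply _ _ i
    rw [lag, lag, nonsmoothReal_add_xDir, e, add_sub_cancel] at h1
    have e2 : xProj E G i p = X (k + 1) i := rfl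
    rw [e2, sub_self, map_zero, add_zero]
    linarith
  have hz : HasRegularSubderivative S.h (WithLp.sndL 2 ℝ (PiLp 2 E) G p)
      (-(((fderiv ℝ (S.coupling ρ) (WithLp.toLp 2 (p, w k))).comp (primal E G W)).comp
        (zDir E))) := by
    refine HasRegularSubderivative.of_isMin_add (hI.finite (k + 1)).2
      (hasFDerivAt_coupling_line hS ρ (w k) (zDir E) p (Z (k + 1))) fun y hy => ?_
    have h1 := hI.z_min k (y - Z (k + 1)) (by simpa using hy)
    have e : p.snd = Z (k + 1) := rfl
    rw [← hp, lag, lag, nonsmoothReal_add_zDir, e, add_sub_cancel] at h1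
    have e2 : WithLp.sndL 2 ℝ (PiLp 2 E) G p = Z (k + 1) := rfl
    rw [e2, sub_self, map_zero, add_zero]
    linarith
  have hsum := HasRegularSubderivative.sum Finset.univ
    (fun i _ => (hx i).comp (xProj E G i)) (fun i _ y => hS.f_ne_bot i _)
  have := hsum.add (hz.comp (WithLp.sndL 2 ℝ (PiLp 2 E) G))
    (fun y => sum_ne_bot _ fun i _ => hS.f_ne_bot i _) (fun y => hS.h_ne_bot _)
  rw [neg_assemble]
  exact this

end IsIteration

end SplitProblem

/-! ### Convergence of the iterations -/

namespace SplitProblem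

variable {n : ℕ} {E : Fin (n + 1) → Type*} {G W K : Type*}
  [∀ i, NormedAddCommGroup (E i)] [∀ i, InnerProductSpace ℝ (E i)]
  [NormedAddCommGroup G] [InnerProductSpace ℝ G]
  [NormedAddCommGroup W] [InnerProductSpace ℝ W]
  [NormedAddCommGroup K] [InnerProductSpace ℝ K]
  {S : SplitProblem E G W K}

theorem augLagrangian_ne_bot (hS : S.Regular) (ρ : ℝ)
    (q : WithLp 2 (WithLp 2 (PiLp 2 E × G) × W)) : S.augLagrangian ρ q ≠ ⊥ :=
  EReal.add_ne_bot_iff.2 ⟨nonsmooth_ne_bot hS _, EReal.coe_ne_bot _⟩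

theorem objective_ne_bot (hS : S.Regular) (p : WithLp 2 (PiLp 2 E × G)) : S.objective p ≠ ⊥ :=
  EReal.add_ne_bot_iff.2 ⟨nonsmooth_ne_bot hS _, EReal.coe_ne_bot _⟩

theorem continuous_coupling (hS : S.Regular) (ρ : ℝ) : Continuous (S.coupling ρ) :=
  continuous_iff_continuousAt.2 fun q => (hasFDerivAt_coupling hS ρ q).continuousAt

namespace IsIteration

variable {ρ : ℝ} {X : ℕ → PiLp 2 E} {Z : ℕ → G} {w : ℕ → W}

/-- Along a convergent subsequence the values of the nonsmooth part converge to its value at the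
limit: the `f_i` are continuous on their domains, and for `h` the minimality of the `Z`-update,
compared with the limit point, complements lower semicontinuity. -/
theorem tendsto_nonsmoothReal (hS : S.Regular) (hI : S.IsIteration ρ X Z w) {ns : ℕ → ℕ}
    {X' : PiLp 2 E} {Z' : G} {w' : W} (hfin : S.IsFinite (WithLp.toLp 2 (X', Z')))
    (hX : Tendsto (fun j => X (ns j + 1)) atTop (𝓝 X'))
    (hZ : Tendsto (fun j => Z (ns j + 1)) atTop (𝓝 Z'))
    (hw : Tendsto (fun j => w (ns j)) atTop (𝓝 w')) :
    Tendsto (fun j => S.nonsmoothReal (WithLp.toLp 2 (X (ns j + 1), Z (ns j + 1)))) atTop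
      (𝓝 (S.nonsmoothReal (WithLp.toLp 2 (X', Z')))) := by
  refine Tendsto.add (tendsto_finsetSum _ fun i _ => ?_) ?_
  · have h1 : Tendsto (fun j => X (ns j + 1) i) atTop (𝓝[{x | S.f i x < ⊤}] X' i) := by
      refine tendsto_nhdsWithin_iff.2 ⟨?_, Eventually.of_forall fun j =>
        lt_top_iff_ne_top.2 ((hI.finite _).1 i)⟩
      exact ((PiLp.proj (𝕜 := ℝ) 2 E i).continuous.tendsto X').comp hX
    have h2 := ((hS.f_cont i (X' i) (lt_top_iff_ne_top.2 (hfin.1 i))).tendsto).comp h1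
    exact (EReal.tendsto_toReal (hfin.1 i) (hS.f_ne_bot i _)).comp h2
  · have hup : Tendsto (fun j => (S.h Z').toReal +
        (S.coupling ρ (WithLp.toLp 2 (WithLp.toLp 2 (X (ns j + 1), Z'), w (ns j))) -
          S.coupling ρ (WithLp.toLp 2 (WithLp.toLp 2 (X (ns j + 1), Z (ns j + 1)), w (ns j)))))
        atTop (𝓝 (S.h Z').toReal) := by
      have h1 := ((continuous_coupling hS ρ).tendsto _).comp
        (tendsto_toLp (tendsto_toLp hX (tendsto_const_nhds (x := Z'))) hw)
      have h2 := ((continuous_coupling hS ρ).tendsto _).comp (tendsto_toLp (tendsto_toLp hX hZ) hw)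
      simpa using (h1.sub h2).const_add (S.h Z').toReal
    refine tendsto_order.2 ⟨fun b hb => ?_, fun b hb => ?_⟩
    · have h1 : (b : EReal) < S.h Z' := by
        rw [← EReal.coe_toReal (x := S.h Z') hfin.2 (hS.h_ne_bot _)]
        exact EReal.coe_lt_coe_iff.2 hb
      filter_upwards [hZ.eventually (hS.h_lsc Z' b h1)] with j hj
      rw [← EReal.coe_toReal (x := S.h (Z (ns j + 1))) (hI.finite (ns j + 1)).2
        (hS.h_ne_bot _)] at hj
      exact EReal.coe_lt_coe_iff.1 hj
    · filter_upwards [hup.eventually_lt_const hb] with j hj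
      refine lt_of_le_of_lt ?_ hj
      have h1 := hI.z_min (ns j) (Z' - Z (ns j + 1)) (by simpa using hfin.2)
      have e : (WithLp.toLp 2 (X (ns j + 1), Z (ns j + 1)) : WithLp 2 (PiLp 2 E × G)) +
          zDir E (Z' - Z (ns j + 1)) = WithLp.toLp 2 (X (ns j + 1), Z') := by
        apply WithLp.ofLp_injective 2
        exact Prod.ext (by simp) (by simp)
      rw [e, lag, lag] at h1
      have h2 : ∑ i, (S.f i (X (ns j + 1) i)).toReal + (S.h (Z (ns j + 1))).toReal + _ ≤
        ∑ i, (S.f i (X (ns j + 1) i)).toReal + (S.h Z').toReal + _ := h1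
      change (S.h (Z (ns j + 1))).toReal ≤ _
      linarith

end IsIteration

omit [∀ i, InnerProductSpace ℝ (E i)] [InnerProductSpace ℝ G] [InnerProductSpace ℝ W] in
theorem norm_primalDual_sub_le (p p' : WithLp 2 (PiLp 2 E × G)) (w w' : W) :
    ‖(WithLp.toLp 2 (p, w) : WithLp 2 (WithLp 2 (PiLp 2 E × G) × W)) - WithLp.toLp 2 (p', w')‖ ≤
      ‖p - p'‖ + ‖w - w'‖ :=
  norm_toLp_le (p - p') (w - w')

theorem norm_comp_primal_sub_le
    (Λ Λ' : WithLp 2 (WithLp 2 (PiLp 2 E × G) × W) →L[ℝ] ℝ) :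
    ‖Λ.comp (primal E G W) - Λ'.comp (primal E G W)‖ ≤ ‖Λ - Λ'‖ := by
  refine ContinuousLinearMap.opNorm_le_bound _ (ContinuousLinearMap.opNorm_nonneg _) fun d => ?_
  exact ((Λ - Λ').le_opNorm (primal E G W d)).trans
    (mul_le_mul_of_nonneg_left (norm_primal_le d) (ContinuousLinearMap.opNorm_nonneg _))

theorem norm_neg_assemble_add_le {Λ : Fin (n + 1) → WithLp 2 (PiLp 2 E × G) →L[ℝ] ℝ}
    {Λz Λ₀ : WithLp 2 (PiLp 2 E × G) →L[ℝ] ℝ} {ε : ℝ} (hε : 0 ≤ ε) (hΛ : ∀ i, ‖Λ i - Λ₀‖ ≤ ε)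
    (hΛz : ‖Λz - Λ₀‖ ≤ ε) : ‖-assemble Λ Λz + Λ₀‖ ≤ (n + 2) * ε := by
  have h := norm_assemble_sub_le hε hΛ hΛz
  have e : -assemble Λ Λz + Λ₀ = -(assemble Λ Λz - Λ₀) := by abel
  rw [e]
  exact (ContinuousLinearMap.opNorm_neg _).le.trans h

theorem tendsto_zero_of_norm_le {H : Type*} [NormedAddCommGroup H] [NormedSpace ℝ H]
    {Λ : ℕ → H →L[ℝ] ℝ} {a : ℕ → ℝ} (h : ∀ k, ‖Λ k‖ ≤ a k) (ha : Tendsto a atTop (𝓝 0)) :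
    Tendsto Λ atTop (𝓝 0) :=
  squeeze_zero_norm h ha

variable [∀ i, FiniteDimensional ℝ (E i)] [FiniteDimensional ℝ G] [FiniteDimensional ℝ W]
  [FiniteDimensional ℝ K]

omit [FiniteDimensional ℝ K] in
/-- The subgradient of the nonsmooth part provided by the block updates nearly cancels the
gradient of the smooth part at the new iterate. -/
theorem exists_subgradient_bound (hS : S.Regular) {ρ : ℝ} {X : ℕ → PiLp 2 E} {Z : ℕ → G}
    {w : ℕ → W} (hI : S.IsIteration ρ X Z w) {R c : ℝ} (hc : 0 ≤ c)
    (hw : ∀ k, ‖w (k + 1) - w k‖ ≤ c * ‖Z (k + 1) - Z k‖)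
    (hR : ∀ k, ‖(WithLp.toLp 2 (WithLp.toLp 2 (X k, Z k), w k) :
        WithLp 2 (WithLp 2 (PiLp 2 E × G) × W))‖ ≤ R) :
    ∃ b : ℝ, 0 ≤ b ∧ ∀ k, ∃ Γ : WithLp 2 (PiLp 2 E × G) →L[ℝ] ℝ,
      HasRegularSubderivative S.nonsmooth (WithLp.toLp 2 (X (k + 1), Z (k + 1))) Γ ∧
      ‖Γ + (fderiv ℝ (S.coupling ρ) (WithLp.toLp 2
          (WithLp.toLp 2 (X (k + 1), Z (k + 1)), w (k + 1)))).comp (primal E G W)‖ ≤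
        b * ‖(WithLp.toLp 2 (X (k + 1), Z (k + 1)) : WithLp 2 (PiLp 2 E × G)) -
          WithLp.toLp 2 (X k, Z k)‖ := by
  have hR0 : 0 ≤ R := (norm_nonneg _).trans (hR 0)
  obtain ⟨L, hL0, hL⟩ := exists_lipschitz_fderiv_coupling hS ρ (R + (1 + c) * (R + R))
  refine ⟨(n + 2) * (L * (1 + c)), by positivity, fun k =>
    ⟨_, hI.hasRegularSubderivative_nonsmooth hS k, ?_⟩⟩
  set p : WithLp 2 (PiLp 2 E × G) := WithLp.toLp 2 (X k, Z k) with hp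
  set p' : WithLp 2 (PiLp 2 E × G) := WithLp.toLp 2 (X (k + 1), Z (k + 1)) with hp'
  set q : WithLp 2 (WithLp 2 (PiLp 2 E × G) × W) := WithLp.toLp 2 (p', w (k + 1)) with hq
  have hwk : ‖w (k + 1) - w k‖ ≤ c * ‖p' - p‖ :=
    (hw k).trans (mul_le_mul_of_nonneg_left (WithLp.norm_snd_le _ (p' - p)) hc)
  have hpR : ∀ k, ‖(WithLp.toLp 2 (X k, Z k) : WithLp 2 (PiLp 2 E × G))‖ ≤ R := fun k =>
    (WithLp.norm_fst_le _ (WithLp.toLp 2 (WithLp.toLp 2 (X k, Z k), w k) :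
        WithLp 2 (WithLp 2 (PiLp 2 E × G) × W))).trans (hR k)
  have hstep : ‖p' - p‖ ≤ R + R := (norm_sub_le _ _).trans (add_le_add (hpR _) (hpR _))
  -- All points at which a block gradient is taken lie within `(1 + c) ‖p' - p‖` of `q`.
  have key : ∀ r : WithLp 2 (PiLp 2 E × G), ‖r - p'‖ ≤ ‖p' - p‖ →
      ‖(fderiv ℝ (S.coupling ρ) (WithLp.toLp 2 (r, w k))).comp (primal E G W) -
        (fderiv ℝ (S.coupling ρ) q).comp (primal E G W)‖ ≤ L * (1 + c) * ‖p' - p‖ := by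
    intro r hr
    have h1 : ‖(WithLp.toLp 2 (r, w k) : WithLp 2 (WithLp 2 (PiLp 2 E × G) × W)) - q‖ ≤
        (1 + c) * ‖p' - p‖ := by
      refine (norm_primalDual_sub_le _ _ _ _).trans ?_
      rw [norm_sub_rev (w k)]
      linarith
    have h2 : ‖(WithLp.toLp 2 (r, w k) : WithLp 2 (WithLp 2 (PiLp 2 E × G) × W))‖ ≤
        R + (1 + c) * (R + R) := by
      have h3 := norm_sub_norm_le (WithLp.toLp 2 (r, w k) :
        WithLp 2 (WithLp 2 (PiLp 2 E × G) × W)) q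
      have h4 := mul_le_mul_of_nonneg_left hstep (by linarith : (0 : ℝ) ≤ 1 + c)
      have h5 : ‖q‖ ≤ R := hR (k + 1)
      linarith
    have h6 : ‖q‖ ≤ R + (1 + c) * (R + R) := by
      have h5 : ‖q‖ ≤ R := hR (k + 1)
      have : 0 ≤ (1 + c) * (R + R) := by positivity
      linarith
    refine (norm_comp_primal_sub_le _ _).trans ((hL _ _ h2 h6).trans ?_)
    rw [mul_assoc]
    exact mul_le_mul_of_nonneg_left h1 hL0
  refine (norm_neg_assemble_add_le (by positivity) (fun i => key _ ?_) (key _ ?_)).trans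
    (le_of_eq (by ring))
  · refine (abs_le_of_sq_le_sq' ?_ (norm_nonneg _)).2
    rw [norm_sub_rev, hp', hp, norm_toLp_sub_sq, norm_toLp_sub_sq]
    exact add_le_add_left (norm_sub_blend_sq_le _ _ _) _
  · rw [sub_self, norm_zero]; exact norm_nonneg _

/-- Convergence to a constrained stationary point, given sufficient decrease and boundedness. -/
theorem IsIteration.exists_tendsto (hS : S.Regular) {ρ : ℝ} (hρ : 0 < ρ) {X : ℕ → PiLp 2 E}
    {Z : ℕ → G} {w : ℕ → W} (hI : S.IsIteration ρ X Z w) {a : ℝ} (ha : 0 < a)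
    (hdec : ∀ k, S.lag ρ (WithLp.toLp 2 (X (k + 1), Z (k + 1))) (w (k + 1)) +
        a * ‖(WithLp.toLp 2 (X (k + 1), Z (k + 1)) : WithLp 2 (PiLp 2 E × G)) -
          WithLp.toLp 2 (X k, Z k)‖ ^ 2 ≤ S.lag ρ (WithLp.toLp 2 (X k, Z k)) (w k))
    (hlow : ∃ B, ∀ k, B ≤ S.lag ρ (WithLp.toLp 2 (X k, Z k)) (w k))
    (hbdd : ∃ R, ∀ k, ‖(WithLp.toLp 2 (WithLp.toLp 2 (X k, Z k), w k) :
        WithLp 2 (WithLp 2 (PiLp 2 E × G) × W))‖ ≤ R)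
    (hKL : IsKLFunction (S.augLagrangian ρ)) :
    ∃ X' Z' w', Tendsto X atTop (𝓝 X') ∧ Tendsto Z atTop (𝓝 Z') ∧ Tendsto w atTop (𝓝 w') ∧
      S.C (WithLp.toLp 2 (X', Z')) = 0 ∧
      ∃ v ∈ generalSubgradient S.objective (WithLp.toLp 2 (X', Z')),
        ∀ d, inner ℝ v d + inner ℝ w' (fderiv ℝ S.C (WithLp.toLp 2 (X', Z')) d) = 0 := by
  obtain ⟨B, hB⟩ := hlow
  obtain ⟨R, hR⟩ := hbdd
  obtain ⟨c, hc, hwc⟩ := exists_multiplier_bound hS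
  have hw : ∀ k, ‖w (k + 1) - w k‖ ≤ c * ‖Z (k + 1) - Z k‖ := fun k => hwc ρ X Z w hI _ _
  obtain ⟨b, hb, hΓ⟩ := exists_subgradient_bound hS hI hc.le hw hR
  choose Γ hΓreg hΓle using hΓ
  set p : ℕ → WithLp 2 (PiLp 2 E × G) := fun k => WithLp.toLp 2 (X k, Z k) with hp
  set q : ℕ → WithLp 2 (WithLp 2 (PiLp 2 E × G) × W) := fun k => WithLp.toLp 2 (p k, w k) with hq
  set ℓ : ℕ → ℝ := fun k => S.lag ρ (p k) (w k) with hℓ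
  set d : ℕ → ℝ := fun k => ‖p (k + 1) - p k‖ with hd
  have hdec' : ∀ k, a * d k ^ 2 ≤ ℓ k - ℓ (k + 1) := fun k => by
    have := hdec k
    simp only [hd, hℓ, hp]
    linarith
  have hanti : Antitone ℓ := antitone_nat_of_succ_le fun k => by
    have := hdec' k
    nlinarith [mul_nonneg ha.le (sq_nonneg (d k))]
  have hL : ∀ k, S.augLagrangian ρ (q k) = (ℓ k : EReal) := fun k =>
    (hI.finite k).augLagrangian_eq hS ρ (w k)
  have hwd : ∀ k, ‖w (k + 1) - w k‖ ≤ c * d k := fun k =>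
    (hw k).trans (mul_le_mul_of_nonneg_left (WithLp.norm_snd_le _ (p (k + 1) - p k)) hc.le)
  have hstep : ∀ k, ‖q (k + 1) - q k‖ ≤ (1 + c) * d k := fun k => by
    refine (norm_primalDual_sub_le _ _ _ _).trans ?_
    have := hwd k
    simp only [hd] at this ⊢
    linarith
  -- The steps tend to zero, as the values converge.
  obtain ⟨ℓ', hℓ'⟩ : ∃ ℓ', Tendsto ℓ atTop (𝓝 ℓ') :=
    ⟨_, tendsto_atTop_ciInf hanti ⟨B, by rintro _ ⟨k, rfl⟩; exact hB k⟩⟩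
  have hd0 : Tendsto d atTop (𝓝 0) := by
    have h1 : Tendsto (fun k => (ℓ k - ℓ (k + 1)) / a) atTop (𝓝 0) := by
      simpa using (hℓ'.sub (hℓ'.comp (tendsto_add_atTop_nat 1))).div_const a
    have h2 : Tendsto (fun k => d k ^ 2) atTop (𝓝 0) :=
      squeeze_zero (fun k => sq_nonneg _)
        (fun k => by rw [le_div_iff₀ ha]; linarith [hdec' k]) h1
    have h3 := (Real.continuous_sqrt.tendsto 0).comp h2
    simp only [Real.sqrt_zero] at h3
    exact h3.congr fun k => by simp [Real.sqrt_sq (norm_nonneg _), hd]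
  have := FiniteDimensional.proper ℝ (WithLp 2 (WithLp 2 (PiLp 2 E × G) × W))
  obtain ⟨q', -, ns, hns, hqns⟩ := tendsto_subseq_of_bounded
    (Metric.isBounded_closedBall (x := (0 : WithLp 2 (WithLp 2 (PiLp 2 E × G) × W))) (r := R))
    (x := q) (fun k => by simpa using hR k)
  set p' : WithLp 2 (PiLp 2 E × G) := q'.fst with hp'
  set w' : W := q'.snd with hw'
  have hdns : Tendsto (fun j => d (ns j)) atTop (𝓝 0) := hd0.comp hns.tendsto_atTop
  have hqns1 : Tendsto (fun j => q (ns j + 1)) atTop (𝓝 q') := by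
    have h1 : Tendsto (fun j => q (ns j + 1) - q (ns j)) atTop (𝓝 0) :=
      squeeze_zero_norm (fun j => hstep (ns j)) (by simpa using hdns.const_mul (1 + c))
    simpa using h1.add hqns
  have hcont_fst := (WithLp.fstL 2 ℝ (WithLp 2 (PiLp 2 E × G)) W).continuous
  have hcont_snd := (WithLp.sndL 2 ℝ (WithLp 2 (PiLp 2 E × G)) W).continuous
  have hpns1 : Tendsto (fun j => p (ns j + 1)) atTop (𝓝 p') := (hcont_fst.tendsto q').comp hqns1
  have hwns : Tendsto (fun j => w (ns j)) atTop (𝓝 w') := (hcont_snd.tendsto q').comp hqns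
  have hfin : S.IsFinite p' := by
    refine (augLagrangian_ne_top_iff hS (ρ := ρ) (q := q')).1 fun htop => ?_
    obtain ⟨j, hj⟩ := (hqns.eventually (hKL.2.1 q' (ℓ 0 : EReal)
      (show (ℓ 0 : EReal) < _ by rw [htop]; exact EReal.coe_lt_top _))).exists
    have hj' : (ℓ 0 : EReal) < (ℓ (ns j) : EReal) := (hL (ns j)) ▸ hj
    exact absurd (hanti (Nat.zero_le (ns j))) (not_le.2 (EReal.coe_lt_coe_iff.1 hj'))
  have hN : Tendsto (fun j => S.nonsmoothReal (p (ns j + 1))) atTop (𝓝 (S.nonsmoothReal p')) :=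
    hI.tendsto_nonsmoothReal hS hfin
      (((WithLp.fstL 2 ℝ (PiLp 2 E) G).continuous.tendsto p').comp hpns1)
      (((WithLp.sndL 2 ℝ (PiLp 2 E) G).continuous.tendsto p').comp hpns1) hwns
  have hℓns : Tendsto (fun j => ℓ (ns j + 1)) atTop (𝓝 (S.lag ρ p' w')) :=
    hN.add (((continuous_coupling hS ρ).tendsto q').comp hqns1)
  have hLq' : S.augLagrangian ρ q' = (S.lag ρ p' w' : EReal) := hfin.augLagrangian_eq hS ρ w'
  have hC : ∀ k, S.C (p (k + 1)) = ρ⁻¹ • (w (k + 1) - w k) := fun k => by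
    rw [hI.w_update, add_sub_cancel_left, smul_smul, inv_mul_cancel₀ hρ.ne', one_smul]
  -- Regular subgradients of the augmented Lagrangian at the iterates.
  set Λ : ℕ → WithLp 2 (WithLp 2 (PiLp 2 E × G) × W) →L[ℝ] ℝ := fun k =>
    (Γ k).comp (WithLp.fstL 2 ℝ (WithLp 2 (PiLp 2 E × G)) W) +
      fderiv ℝ (S.coupling ρ) (q (k + 1)) with hΛ
  have hΛreg : ∀ k, HasRegularSubderivative (S.augLagrangian ρ) (q (k + 1)) (Λ k) := fun k => by
    have h1 : HasRegularSubderivative (fun q : WithLp 2 (WithLp 2 (PiLp 2 E × G) × W) =>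
        S.nonsmooth q.fst) (q (k + 1))
        ((Γ k).comp (WithLp.fstL 2 ℝ (WithLp 2 (PiLp 2 E × G)) W)) :=
      HasRegularSubderivative.comp (WithLp.fstL 2 ℝ (WithLp 2 (PiLp 2 E × G)) W)
        (x := q (k + 1)) (hΓreg k)
    exact h1.add (.of_hasFDerivAt
      (hasFDerivAt_coupling hS ρ (q (k + 1))).differentiableAt.hasFDerivAt)
      (fun y => nonsmooth_ne_bot hS _) (fun y => EReal.coe_ne_bot _)
  set b' : ℝ := b + ρ⁻¹ * c with hb'
  have hb'pos : 0 < b' := by positivity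
  have hΛle : ∀ k, ‖Λ k‖ ≤ b' * d k := fun k => by
    refine ContinuousLinearMap.opNorm_le_bound _ (by positivity) fun y => ?_
    have hy : y = primal E G W y.fst + dual E G W y.snd := by
      apply WithLp.ofLp_injective 2
      refine Prod.ext ?_ ?_
      · change y.fst = y.fst + 0; rw [add_zero]
      · change y.snd = 0 + y.snd; rw [zero_add]
    have e : Λ k y = (Γ k + (fderiv ℝ (S.coupling ρ) (q (k + 1))).comp (primal E G W)) y.fst +
        inner ℝ y.snd (S.C (p (k + 1))) := by
      have h1 : fderiv ℝ (S.coupling ρ) (q (k + 1)) y =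
          fderiv ℝ (S.coupling ρ) (q (k + 1)) (primal E G W y.fst) +
            inner ℝ y.snd (S.C (p (k + 1))) := by
        conv_lhs => rw [hy]
        rw [map_add, fderiv_coupling_dual hS]
        rfl
      change Γ k y.fst + fderiv ℝ (S.coupling ρ) (q (k + 1)) y = _
      rw [h1]
      change _ = Γ k y.fst + fderiv ℝ (S.coupling ρ) (q (k + 1)) (primal E G W y.fst) + _
      ring
    rw [e]
    have h2 := ((Γ k + (fderiv ℝ (S.coupling ρ) (q (k + 1))).comp (primal E G W)).le_opNorm
      y.fst).trans (mul_le_mul (hΓle k) (WithLp.norm_fst_le _ y) (norm_nonneg _) (by positivity))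
    have h3 : ‖S.C (p (k + 1))‖ ≤ ρ⁻¹ * (c * d k) := by
      rw [hC, norm_smul, norm_inv, Real.norm_eq_abs, abs_of_pos hρ]
      exact mul_le_mul_of_nonneg_left (hwd k) (by positivity)
    have h4 := (norm_inner_le_norm (𝕜 := ℝ) y.snd (S.C (p (k + 1)))).trans
      (mul_le_mul (WithLp.norm_snd_le _ y) h3 (norm_nonneg _) (norm_nonneg _))
    refine (norm_add_le _ _).trans ((add_le_add h2 h4).trans (le_of_eq ?_))
    rw [hb', hd]
    ring
  have hLbot := augLagrangian_ne_bot hS ρ (W := W)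
  have hsub : ∀ k, ∃ v ∈ generalSubgradient (S.augLagrangian ρ) (q (k + 1)), ‖v‖ ≤ b' * d k :=
    fun k => by
      obtain ⟨v, hv, hvn, -⟩ := mem_generalSubgradient_of_tendsto hLbot (hΛreg k).1
        (xs := fun _ => q (k + 1)) tendsto_const_nhds tendsto_const_nhds
        (fun _ => hΛreg k) tendsto_const_nhds
      exact ⟨v, hv, hvn.trans_le (hΛle k)⟩
  have hKLq : KLPropertyAt (S.augLagrangian ρ) q' := by
    refine hKL.2.2 q' ?_
    have h0 : Tendsto (fun j => Λ (ns j)) atTop (𝓝 0) :=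
      tendsto_zero_of_norm_le (fun j => hΛle (ns j)) (by simpa using hdns.const_mul b')
    obtain ⟨v, hv, -⟩ := mem_generalSubgradient_of_tendsto hLbot
      (by rw [hLq']; exact EReal.coe_ne_top _) hqns1 (by
        simp only [hL, hLq', EReal.toReal_coe]; exact hℓns) (fun j => hΛreg (ns j)) h0
    exact ⟨v, hv⟩
  have hconv : Tendsto q atTop (𝓝 q') :=
    tendsto_of_KLPropertyAt ha hb'pos (by linarith : 0 < 1 + c) hL hLq' (fun k => norm_nonneg _)
      hdec' hstep hsub (ns := fun j => ns j + 1)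
      ((tendsto_add_atTop_nat 1).comp hns.tendsto_atTop) hqns1 hℓns hKLq
  have hpconv : Tendsto p atTop (𝓝 p') := (hcont_fst.tendsto q').comp hconv
  have hCp' : S.C p' = 0 := by
    have h1 : Tendsto (fun k => S.C (p (k + 1))) atTop (𝓝 (S.C p')) :=
      (hS.C_contDiff.continuous.tendsto p').comp (hpconv.comp (tendsto_add_atTop_nat 1))
    have h2 : Tendsto (fun k => S.C (p (k + 1))) atTop (𝓝 0) := by
      have h3 : Tendsto (fun k => w (k + 1) - w k) atTop (𝓝 0) :=
        squeeze_zero_norm hwd (by simpa using hd0.const_mul c)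
      simpa [hC] using h3.const_smul ρ⁻¹
    exact tendsto_nhds_unique h1 h2
  refine ⟨p'.fst, p'.snd, w', ((WithLp.fstL 2 ℝ (PiLp 2 E) G).continuous.tendsto p').comp hpconv,
    ((WithLp.sndL 2 ℝ (PiLp 2 E) G).continuous.tendsto p').comp hpconv,
    (hcont_snd.tendsto q').comp hconv, hCp', ?_⟩
  change ∃ v ∈ generalSubgradient S.objective p', _
  obtain ⟨_, _, hs⟩ := smooth_lip hS
  -- Regular subgradients of the objective converge to minus the gradient of the augmented part.
  have hobjreg : ∀ k, HasRegularSubderivative S.objective (p (k + 1))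
      (Γ k + fderiv ℝ S.smooth (p (k + 1))) := fun k =>
    (hΓreg k).add (.of_hasFDerivAt (hs.1 _).hasFDerivAt)
      (fun y => nonsmooth_ne_bot hS _) (fun y => EReal.coe_ne_bot _)
  have haug : Continuous fun q : WithLp 2 (WithLp 2 (PiLp 2 E × G) × W) =>
      (fderiv ℝ (S.aug ρ) q).comp (primal E G W) :=
    ((contDiff_aug hS ρ).continuous_fderiv two_ne_zero).clm_comp continuous_const
  have hlim : Tendsto (fun j => Γ (ns j) + fderiv ℝ S.smooth (p (ns j + 1))) atTop
      (𝓝 (-(fderiv ℝ (S.aug ρ) q').comp (primal E G W))) := by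
    have h1 : Tendsto (fun j => Γ (ns j) +
        (fderiv ℝ (S.coupling ρ) (q (ns j + 1))).comp (primal E G W)) atTop (𝓝 0) :=
      tendsto_zero_of_norm_le (fun j => hΓle (ns j)) (by simpa using hdns.const_mul b)
    have h2 := h1.sub ((haug.tendsto q').comp hqns1)
    rw [zero_sub] at h2
    refine h2.congr fun j => ?_
    rw [Function.comp_apply, fderiv_coupling_primal hS, ← add_assoc, add_sub_cancel_right]
    rfl
  obtain ⟨v, hv, -, hvd⟩ := mem_generalSubgradient_of_tendsto (objective_ne_bot hS)
    ((objective_ne_top_iff hS).2 hfin) hpns1 (by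
      have h1 : ∀ j, (S.objective (p (ns j + 1))).toReal =
          S.nonsmoothReal (p (ns j + 1)) + S.smooth (p (ns j + 1)) := fun j => by
        rw [(hI.finite (ns j + 1)).objective_eq hS, EReal.toReal_coe]
      rw [hfin.objective_eq hS, EReal.toReal_coe]
      simp only [h1]
      exact hN.add ((hs.1.continuous.tendsto p').comp hpns1)) (fun j => hobjreg (ns j)) hlim
  refine ⟨v, hv, fun y => ?_⟩
  have hfst : (primal E G W y).fst = y := rfl
  have hsnd : (primal E G W y).snd = 0 := rfl
  rw [hvd, neg_apply, ContinuousLinearMap.comp_apply, hasFDerivAt_aug hS, hfst, hsnd, ← hp', ← hw',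
    hCp', inner_zero_left, inner_zero_left]
  change _ + inner ℝ w' (fderiv ℝ S.C p' y) = 0
  ring

end SplitProblem

/-! ### The multiaffine problem as a split problem -/

theorem HasConvexityModulusOnDom.mono {H : Type*} [NormedAddCommGroup H] [InnerProductSpace ℝ H]
    {m m' : ℝ} {f : H → EReal} (hf : HasConvexityModulusOnDom m f) (h : m' ≤ m) :
    HasConvexityModulusOnDom m' f := by
  intro x y hx hy t ht ht1
  refine (hf x y hx hy t ht ht1).trans (EReal.coe_le_coe_iff.2 ?_)
  have : m' / 2 * (t * (1 - t)) * ‖y - x‖ ^ 2 ≤ m / 2 * (t * (1 - t)) * ‖y - x‖ ^ 2 := by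
    have := mul_nonneg ht (sub_nonneg.2 ht1)
    gcongr
  linarith

theorem AffineMap.apply_add_smul {A B : Type*} [AddCommGroup A] [Module ℝ A] [AddCommGroup B]
    [Module ℝ B] (g : A →ᵃ[ℝ] B) (x d : A) (t : ℝ) :
    g (x + t • d) = g x + t • (g (x + d) - g x) := by
  have h : ∀ v, g (x + v) = g.linear v + g x := fun v => by
    rw [add_comm, ← vadd_eq_add, g.map_vadd, vadd_eq_add]
  rw [h, h, map_smul]
  module

/-- An injective linear map on a finite-dimensional space is bounded below. -/
theorem exists_sq_le_of_injective {A B : Type*} [NormedAddCommGroup A] [NormedSpace ℝ A]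
    [FiniteDimensional ℝ A] [NormedAddCommGroup B] [NormedSpace ℝ B] (R : A →ₗ[ℝ] B)
    (hR : Function.Injective R) : ∃ σ : ℝ, 0 < σ ∧ ∀ d, σ * ‖d‖ ^ 2 ≤ ‖R d‖ ^ 2 := by
  obtain ⟨c, hc, h⟩ := LinearMap.injective_iff_antilipschitz R |>.1 hR
  have hc' : (0 : ℝ) < c := hc
  refine ⟨((c : ℝ) ^ 2)⁻¹, by positivity, fun d => ?_⟩
  have h1 : ‖d‖ ≤ c * ‖R d‖ := by simpa using h.le_mul_dist d 0
  rw [inv_mul_le_iff₀ (by positivity), ← mul_pow]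
  gcongr

namespace Problem

variable {n : ℕ} {E : Fin (n + 1) → Type*} {G₀ G₁ G₂ : Type*}
  {ι₁ ι₂ : Type*} [Fintype ι₁] [Fintype ι₂] {V₁ : ι₁ → Type*} {V₂ : ι₂ → Type*}
  [∀ i, NormedAddCommGroup (E i)] [∀ i, InnerProductSpace ℝ (E i)]
  [NormedAddCommGroup G₀] [InnerProductSpace ℝ G₀]
  [NormedAddCommGroup G₁] [InnerProductSpace ℝ G₁]
  [NormedAddCommGroup G₂] [InnerProductSpace ℝ G₂]
  [∀ r, NormedAddCommGroup (V₁ r)] [∀ r, InnerProductSpace ℝ (V₁ r)]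
  [∀ r, NormedAddCommGroup (V₂ r)] [∀ r, InnerProductSpace ℝ (V₂ r)]

/-- The multiaffine problem as a split problem: `h` depends on `Z_0` only, so the directions in
which it is constant are those of `(Z_1, Z_2)`. -/
noncomputable def toSplit (P : Problem E G₀ G₁ G₂ V₁ V₂) :
    SplitProblem E (ZSpace G₀ G₁ G₂) (WSpace V₁ V₂) (WithLp 2 (G₁ × G₂)) where
  F := P.F
  f := P.f
  h := fun z => P.h z.fst.fst
  g := fun z => P.g₁ z.fst + P.g₂ z.snd
  C := P.constraint
  Q :=
    { toFun := fun d => WithLp.toLp 2 (P.Q₁ d.fst, P.Q₂ d.snd)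
      map_add' := fun d d' => WithLp.ofLp_injective 2
        (Prod.ext (map_add P.Q₁ d.fst d'.fst) (map_add P.Q₂ d.snd d'.snd))
      map_smul' := fun c d => WithLp.ofLp_injective 2
        (Prod.ext (map_smul P.Q₁ c d.fst) (map_smul P.Q₂ c d.snd)) }
  ι :=
    { toFun := fun d => WithLp.toLp 2 (WithLp.toLp 2 (0, d.fst), d.snd)
      map_add' := fun _ _ => WithLp.ofLp_injective 2
        (Prod.ext (WithLp.ofLp_injective 2 (Prod.ext (add_zero (0 : G₀)).symm rfl)) rfl)
      map_smul' := fun c _ => WithLp.ofLp_injective 2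
        (Prod.ext (WithLp.ofLp_injective 2 (Prod.ext (smul_zero c).symm rfl)) rfl) }

variable (P : Problem E G₀ G₁ G₂ V₁ V₂)

theorem toSplit_objective : P.toSplit.objective = P.objective := by
  funext p
  simp only [SplitProblem.objective, SplitProblem.nonsmooth, SplitProblem.smooth, objective,
    toSplit, EReal.coe_add]
  ac_rfl

theorem toSplit_augLagrangian (ρ : ℝ) : P.toSplit.augLagrangian ρ = P.augLagrangian ρ := by
  funext q
  rw [augLagrangian, ← toSplit_objective, SplitProblem.objective, SplitProblem.augLagrangian,
    SplitProblem.coupling, EReal.coe_add, ← add_assoc]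
  rfl

omit [∀ i, InnerProductSpace ℝ (E i)] in
theorem add_single_eq_update (X : XSpace E) (i : Fin (n + 1)) (d : E i) :
    (X + PiLp.single 2 i d).ofLp = Function.update X.ofLp i (X i + d) := by
  funext j
  rcases eq_or_ne j i with rfl | hj
  · simp
  · simp [hj]

theorem _root_.MultiaffineADMM.IsMultiaffine.apply_add_single {V : Type*} [AddCommGroup V]
    [Module ℝ V] {M : (∀ i, E i) → V} (hM : IsMultiaffine M) (X : XSpace E) (i : Fin (n + 1))
    (d : E i) (t : ℝ) :
    M (X + PiLp.single 2 i (t • d)).ofLp =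
      M X.ofLp + t • (M (X + PiLp.single 2 i d).ofLp - M X.ofLp) := by
  obtain ⟨g, hg⟩ := hM i X.ofLp
  have h0 : M X.ofLp = g (X i) := by rw [← hg, Function.update_eq_self]
  rw [add_single_eq_update, add_single_eq_update, hg, hg, h0, AffineMap.apply_add_smul]

omit [Fintype ι₁] [Fintype ι₂] [∀ r, NormedAddCommGroup (V₁ r)]
  [∀ r, InnerProductSpace ℝ (V₁ r)] [∀ r, NormedAddCommGroup (V₂ r)]
  [∀ r, InnerProductSpace ℝ (V₂ r)] in
theorem wSpace_ext {a b : WSpace V₁ V₂} (h₁ : a.fst = b.fst) (h₂ : a.snd = b.snd) : a = b :=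
  WithLp.ofLp_injective 2 (Prod.ext h₁ h₂)

section Regularity

variable {P} [∀ i, FiniteDimensional ℝ (E i)] [FiniteDimensional ℝ G₀] [FiniteDimensional ℝ G₁]
  [FiniteDimensional ℝ G₂]

theorem Assumptions.contDiff_constraint (hP : P.Assumptions) : ContDiff ℝ 2 P.constraint := by
  have hX : ContDiff ℝ 2 fun p : WithLp 2 (XSpace E × ZSpace G₀ G₁ G₂) => p.fst.ofLp :=
    ((PiLp.continuousLinearEquiv 2 ℝ E).toContinuousLinearMap.comp
      (WithLp.fstL 2 ℝ (XSpace E) (ZSpace G₀ G₁ G₂))).contDiff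
  have hS := (WithLp.fstL 2 ℝ (WithLp 2 (G₀ × G₁)) G₂).comp
    (WithLp.sndL 2 ℝ (XSpace E) (ZSpace G₀ G₁ G₂))
  have h0 : ContDiff ℝ 2 fun p : WithLp 2 (XSpace E × ZSpace G₀ G₁ G₂) => p.snd.fst.fst :=
    ((WithLp.fstL 2 ℝ G₀ G₁).comp ((WithLp.fstL 2 ℝ (WithLp 2 (G₀ × G₁)) G₂).comp
      (WithLp.sndL 2 ℝ (XSpace E) (ZSpace G₀ G₁ G₂)))).contDiff
  have h1 : ContDiff ℝ 2 fun p : WithLp 2 (XSpace E × ZSpace G₀ G₁ G₂) => P.Q₁ p.snd.fst.snd :=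
    ((LinearMap.toContinuousLinearMap P.Q₁).comp ((WithLp.sndL 2 ℝ G₀ G₁).comp
      ((WithLp.fstL 2 ℝ (WithLp 2 (G₀ × G₁)) G₂).comp
        (WithLp.sndL 2 ℝ (XSpace E) (ZSpace G₀ G₁ G₂))))).contDiff
  have h2 : ContDiff ℝ 2 fun p : WithLp 2 (XSpace E × ZSpace G₀ G₁ G₂) => P.Q₂ p.snd.snd :=
    ((LinearMap.toContinuousLinearMap P.Q₂).comp
      ((WithLp.sndL 2 ℝ (WithLp 2 (G₀ × G₁)) G₂).comp
        (WithLp.sndL 2 ℝ (XSpace E) (ZSpace G₀ G₁ G₂)))).contDiff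
  exact (WithLp.prodContinuousLinearEquiv 2 ℝ (PiLp 2 V₁) (PiLp 2 V₂)).symm.contDiff.comp
    (((hP.multiaffine₁.contDiff.comp (hX.prodMk h0)).add h1).prodMk
      ((hP.multiaffine₂.contDiff.comp hX).add h2))

omit [FiniteDimensional ℝ G₀] [FiniteDimensional ℝ G₁] [FiniteDimensional ℝ G₂] in
/-- The constraint map expands along every block `X_i`, because one of its rows depends on `X_i`
through an injective linear map. -/
theorem Assumptions.exists_expand (hP : P.Assumptions) (i : Fin (n + 1)) :
    ∃ σ : ℝ, 0 < σ ∧ ∀ (p : WithLp 2 (XSpace E × ZSpace G₀ G₁ G₂)) (d : E i),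
      σ * ‖d‖ ^ 2 ≤ ‖P.constraint (p + SplitProblem.xDir (ZSpace G₀ G₁ G₂) i d) -
        P.constraint p‖ ^ 2 := by
  have hrest : ∀ (X : XSpace E) (d : E i), (fun j : {j // j ≠ i} => (X + PiLp.single 2 i d) j) =
      fun j : {j // j ≠ i} => X j := fun X d => by
    funext j
    simp [PiLp.single_eq_of_ne 2 j.2]
  rcases hP.x_injective i with ⟨r, R, A', hR, -, hA⟩ | ⟨r, R, A', hR, -, hA⟩
  · have hA : ∀ X z, P.A₁ X z r = R (X i) + A' (fun j => X j) z := hA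
    obtain ⟨σ, hσ, hσR⟩ := exists_sq_le_of_injective R hR
    refine ⟨σ, hσ, fun p d => (hσR d).trans ?_⟩
    have h1 : (P.constraint (p + SplitProblem.xDir (ZSpace G₀ G₁ G₂) i d) -
        P.constraint p).fst r = R d := by
      have e : (p + SplitProblem.xDir (ZSpace G₀ G₁ G₂) i d).snd = p.snd := by simp
      change P.A₁ (p.fst + PiLp.single 2 i d).ofLp _ r + P.Q₁ _ r - (P.A₁ p.fst.ofLp _ r +
        P.Q₁ _ r) = _
      rw [e, hA, hA, hrest]
      simp
    rw [← h1]
    gcongr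
    exact (PiLp.norm_apply_le _ r).trans (WithLp.norm_fst_le _ _)
  · have hA : ∀ X, P.A₂ X r = R (X i) + A' (fun j => X j) 0 := fun X => hA X 0
    obtain ⟨σ, hσ, hσR⟩ := exists_sq_le_of_injective R hR
    refine ⟨σ, hσ, fun p d => (hσR d).trans ?_⟩
    have h1 : (P.constraint (p + SplitProblem.xDir (ZSpace G₀ G₁ G₂) i d) -
        P.constraint p).snd r = R d := by
      have e : (p + SplitProblem.xDir (ZSpace G₀ G₁ G₂) i d).snd = p.snd := by simp
      change P.A₂ (p.fst + PiLp.single 2 i d).ofLp r + P.Q₂ _ r - (P.A₂ p.fst.ofLp r +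
        P.Q₂ _ r) = _
      rw [e, hA, hA, hrest]
      simp
    rw [← h1]
    gcongr
    exact (PiLp.norm_apply_le _ r).trans (WithLp.norm_snd_le _ _)

omit [∀ i, FiniteDimensional ℝ (E i)] [FiniteDimensional ℝ G₀] [FiniteDimensional ℝ G₁] in
/-- The strong convexity of `g₁` in `(Z_0, Z_1)`, together with the penalty on the injective image
of `Z_2`, makes the `Z`-subproblem strongly convex. -/
theorem Assumptions.exists_z_modulus (hP : P.Assumptions) :
    ∃ m : ℝ, 0 < m ∧ ∃ ρ₁ : ℝ, ∀ ρ > ρ₁,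
      ∀ (p : WithLp 2 (XSpace E × ZSpace G₀ G₁ G₂)) (d : ZSpace G₀ G₁ G₂),
      ∀ t : ℝ, 0 ≤ t → t ≤ 1 → P.toSplit.g (p.snd + t • d) - t * (1 - t) * (ρ / 2) *
          ‖P.constraint (p + SplitProblem.zDir E d) - P.constraint p‖ ^ 2 ≤
        (1 - t) * P.toSplit.g p.snd + t * P.toSplit.g (p.snd + d) -
          m / 2 * (t * (1 - t)) * ‖d‖ ^ 2 := by
  obtain ⟨m, M₁, hm, hg₁⟩ := hP.g₁_strong
  obtain ⟨M₂, hg₂⟩ := hP.g₂_lip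
  obtain ⟨σ, hσ, hσQ⟩ := exists_sq_le_of_injective P.Q₂ hP.Q₂_inj
  have hc₁ := hasConvexityModulus_of_fderiv hg₁.2.2
  have hc₂ := (hg₂.mono (le_abs_self M₂)).hasConvexityModulus (abs_nonneg M₂)
  refine ⟨m, hm, max 0 ((m + 2 * |M₂|) / σ), fun ρ hρ p d t ht ht1 => ?_⟩
  obtain ⟨hρ0, hρ1⟩ := max_lt_iff.1 hρ
  rw [div_lt_iff₀ hσ] at hρ1
  have h1 := hc₁ p.snd.fst (p.snd.fst + d.fst) t ht ht1
  have h2 := hc₂ p.snd.snd (p.snd.snd + d.snd) t ht ht1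
  rw [add_sub_cancel_left] at h1 h2
  have h3 : ‖P.Q₂ d.snd‖ ^ 2 ≤
      ‖P.constraint (p + SplitProblem.zDir E d) - P.constraint p‖ ^ 2 := by
    have e : (P.constraint (p + SplitProblem.zDir E d) - P.constraint p).snd = P.Q₂ d.snd := by
      have e1 : (p + SplitProblem.zDir E d).fst = p.fst := by simp
      change P.A₂ (p + SplitProblem.zDir E d).fst.ofLp + P.Q₂ (p.snd.snd + d.snd) -
        (P.A₂ p.fst.ofLp + P.Q₂ p.snd.snd) = _
      rw [e1, map_add]
      abel
    rw [← e]
    gcongr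
    exact WithLp.norm_snd_le _ _
  have htt : 0 ≤ t * (1 - t) := mul_nonneg ht (sub_nonneg.2 ht1)
  have h4 : (m + 2 * |M₂|) * ‖d.snd‖ ^ 2 ≤
      ρ * ‖P.constraint (p + SplitProblem.zDir E d) - P.constraint p‖ ^ 2 := by
    calc (m + 2 * |M₂|) * ‖d.snd‖ ^ 2 ≤ (ρ * σ) * ‖d.snd‖ ^ 2 := by gcongr
      _ = ρ * (σ * ‖d.snd‖ ^ 2) := by ring
      _ ≤ _ := mul_le_mul_of_nonneg_left ((hσQ _).trans h3) hρ0.le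
  have h5 := mul_le_mul_of_nonneg_left h4 htt
  have h6 : P.toSplit.g (p.snd + t • d) =
    P.g₁ (p.snd.fst + t • d.fst) + P.g₂ (p.snd.snd + t • d.snd) := rfl
  have h7 : P.toSplit.g (p.snd + d) =
    P.g₁ (p.snd.fst + d.fst) + P.g₂ (p.snd.snd + d.snd) := rfl
  have h8 : P.toSplit.g p.snd = P.g₁ p.snd.fst + P.g₂ p.snd.snd := rfl
  rw [h6, h7, h8, WithLp.prod_norm_sq_eq_of_L2 d]
  linear_combination h1 + h2 + h5 / 2

theorem Assumptions.regular (hP : P.Assumptions) : P.toSplit.Regular where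
  F_lip := by
    obtain ⟨M, hM⟩ := hP.F_lip
    exact ⟨|M|, abs_nonneg M, hM.mono (le_abs_self M)⟩
  g_lip := by
    obtain ⟨m, M, -, hM⟩ := hP.g₁_strong
    obtain ⟨M', hM'⟩ := hP.g₂_lip
    exact ⟨_, by positivity, ((hM.2.1.mono (le_abs_self M)).comp_continuousLinearMap
      (abs_nonneg M) (WithLp.fstL 2 ℝ (WithLp 2 (G₀ × G₁)) G₂)).add
        ((hM'.mono (le_abs_self M')).comp_continuousLinearMap (abs_nonneg M')
          (WithLp.sndL 2 ℝ (WithLp 2 (G₀ × G₁)) G₂))⟩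
  f_ne_bot i := (hP.f_proper i).1
  h_ne_bot z := hP.h_proper.1 _
  f_lsc := hP.f_lsc
  h_lsc := hP.h_lsc.comp ((WithLp.fstL 2 ℝ G₀ G₁).comp
    (WithLp.fstL 2 ℝ (WithLp 2 (G₀ × G₁)) G₂)).continuous
  f_cont := hP.f_cont
  f_modulus := by
    have h : ∀ i, ∃ M, 0 ≤ M ∧ HasConvexityModulusOnDom (-M) (P.f i) := by
      intro i
      rcases hP.f_convex_or_lip i with hc | ⟨M, u, hu, hM⟩
      · exact ⟨0, le_rfl, .of_isConvex hc (hP.f_proper i).1 (by simp)⟩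
      · refine ⟨2 * |M|, by positivity, .of_real ?_ hu⟩
        simpa only [neg_mul] using
          (hM.mono (le_abs_self M)).hasConvexityModulus (abs_nonneg M)
    choose M hM hf using h
    refine ⟨∑ i, M i, Finset.sum_nonneg fun i _ => hM i, fun i => (hf i).mono ?_⟩
    exact neg_le_neg (Finset.single_le_sum (fun i _ => hM i) (Finset.mem_univ i))
  h_modulus := by
    intro x y hx hy t ht ht1
    have := HasConvexityModulusOnDom.of_isConvex hP.h_convex hP.h_proper.1 le_rfl
      x.fst.fst y.fst.fst hx hy t ht ht1
    simp only [zero_div, zero_mul] at this ⊢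
    exact this
  C_contDiff := hP.contDiff_constraint
  C_line_x p i d t := by
    have e : ∀ d : E i, (p + SplitProblem.xDir (ZSpace G₀ G₁ G₂) i d).snd = p.snd := by simp
    refine wSpace_ext ?_ ?_
    · change P.A₁ (p.fst + PiLp.single 2 i (t • d)).ofLp _ + P.Q₁ _ = P.A₁ p.fst.ofLp _ + P.Q₁ _ +
        t • (P.A₁ (p.fst + PiLp.single 2 i d).ofLp _ + P.Q₁ _ - (P.A₁ p.fst.ofLp _ + P.Q₁ _))
      rw [e, e, (hP.multiaffine₁.1 p.snd.fst.fst).apply_add_single]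
      module
    · change P.A₂ (p.fst + PiLp.single 2 i (t • d)).ofLp + P.Q₂ _ = P.A₂ p.fst.ofLp + P.Q₂ _ +
        t • (P.A₂ (p.fst + PiLp.single 2 i d).ofLp + P.Q₂ _ - (P.A₂ p.fst.ofLp + P.Q₂ _))
      rw [e, e, hP.multiaffine₂.apply_add_single]
      module
  C_expand_x := by
    choose σ hσ hσC using hP.exists_expand
    obtain ⟨i₀, hi₀⟩ := Finite.exists_min σ
    exact ⟨σ i₀, hσ i₀, fun p i d =>
      (mul_le_mul_of_nonneg_right (hi₀ i) (sq_nonneg _)).trans (hσC i p d)⟩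
  C_line_z p d t := by
    have e : ∀ d : ZSpace G₀ G₁ G₂, (p + SplitProblem.zDir E d).fst = p.fst := by simp
    refine wSpace_ext ?_ ?_
    · change P.A₁ (p + SplitProblem.zDir E (t • d)).fst.ofLp (p.snd.fst.fst + t • d.fst.fst) +
        P.Q₁ (p.snd.fst.snd + t • d.fst.snd) = P.A₁ p.fst.ofLp p.snd.fst.fst +
        P.Q₁ p.snd.fst.snd + t • (P.A₁ (p + SplitProblem.zDir E d).fst.ofLp
          (p.snd.fst.fst + d.fst.fst) + P.Q₁ (p.snd.fst.snd + d.fst.snd) -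
          (P.A₁ p.fst.ofLp p.snd.fst.fst + P.Q₁ p.snd.fst.snd))
      obtain ⟨g, hg⟩ := hP.multiaffine₁.2 p.fst.ofLp
      rw [e, e, hg, hg, hg, AffineMap.apply_add_smul, map_add P.Q₁, map_add P.Q₁, map_smul P.Q₁]
      module
    · change P.A₂ (p + SplitProblem.zDir E (t • d)).fst.ofLp + P.Q₂ (p.snd.snd + t • d.snd) =
        P.A₂ p.fst.ofLp + P.Q₂ p.snd.snd + t • (P.A₂ (p + SplitProblem.zDir E d).fst.ofLp +
          P.Q₂ (p.snd.snd + d.snd) - (P.A₂ p.fst.ofLp + P.Q₂ p.snd.snd))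
      rw [e, e, map_add, map_add, map_smul]
      module
  z_modulus := hP.exists_z_modulus
  C_shift p d := by
    refine wSpace_ext ?_ ?_
    · change P.A₁ (p.fst + 0).ofLp (p.snd.fst.fst + 0) + P.Q₁ (p.snd.fst.snd + d.fst) =
        P.A₁ p.fst.ofLp p.snd.fst.fst + P.Q₁ p.snd.fst.snd + P.Q₁ d.fst
      rw [add_zero, add_zero, map_add, add_assoc]
    · change P.A₂ (p.fst + 0).ofLp + P.Q₂ (p.snd.snd + d.snd) =
        P.A₂ p.fst.ofLp + P.Q₂ p.snd.snd + P.Q₂ d.snd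
      rw [add_zero, map_add, add_assoc]
  h_shift z d := by
    change P.h (z.fst.fst + 0) = P.h z.fst.fst
    rw [add_zero]
  C_range p := by
    obtain ⟨⟨z₁, z₂⟩, hz⟩ := hP.image_subset ⟨(p.fst.ofLp, p.snd.fst.fst), rfl⟩
    refine ⟨WithLp.toLp 2 (z₁ + p.snd.fst.snd, z₂ + p.snd.snd), wSpace_ext ?_ ?_⟩
    · change P.Q₁ (z₁ + p.snd.fst.snd) = P.A₁ p.fst.ofLp p.snd.fst.fst + P.Q₁ p.snd.fst.snd
      rw [map_add]
      exact congrArg (· + _) (congrArg Prod.fst hz)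
    · change P.Q₂ (z₂ + p.snd.snd) = P.A₂ p.fst.ofLp + P.Q₂ p.snd.snd
      rw [map_add]
      exact congrArg (· + _) (congrArg Prod.snd hz)
  coercive := by
    rw [toSplit_objective]
    exact hP.coercive

end Regularity

end Problem

namespace Problem

variable {n : ℕ} {E : Fin (n + 1) → Type*} {G₀ G₁ G₂ : Type*}
  {ι₁ ι₂ : Type*} [Fintype ι₁] [Fintype ι₂] {V₁ : ι₁ → Type*} {V₂ : ι₂ → Type*}
  [∀ i, NormedAddCommGroup (E i)] [∀ i, InnerProductSpace ℝ (E i)]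
  [NormedAddCommGroup G₀] [InnerProductSpace ℝ G₀]
  [NormedAddCommGroup G₁] [InnerProductSpace ℝ G₁]
  [NormedAddCommGroup G₂] [InnerProductSpace ℝ G₂]
  [∀ r, NormedAddCommGroup (V₁ r)] [∀ r, InnerProductSpace ℝ (V₁ r)]
  [∀ r, NormedAddCommGroup (V₂ r)] [∀ r, InnerProductSpace ℝ (V₂ r)]
  {P : Problem E G₀ G₁ G₂ V₁ V₂}
  [∀ i, FiniteDimensional ℝ (E i)] [FiniteDimensional ℝ G₀] [FiniteDimensional ℝ G₁]
  [FiniteDimensional ℝ G₂]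

/-! ### Existence of ADMM sequences -/

theorem xSubproblem_ne_top_iff (hP : P.Assumptions) {ρ : ℝ} {X : XSpace E} {Z : ZSpace G₀ G₁ G₂}
    {W : WSpace V₁ V₂} {i : Fin (n + 1)} {x : E i} :
    P.xSubproblem ρ X Z W i x ≠ ⊤ ↔
      P.toSplit.IsFinite (WithLp.toLp 2 (WithLp.toLp 2 (Function.update X.ofLp i x), Z)) := by
  rw [xSubproblem, ← toSplit_augLagrangian, SplitProblem.augLagrangian_ne_top_iff hP.regular]
  exact Iff.rfl

theorem zSubproblem_ne_top_iff (hP : P.Assumptions) {ρ : ℝ} {X : XSpace E} {W : WSpace V₁ V₂}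
    {z : ZSpace G₀ G₁ G₂} :
    P.zSubproblem ρ X W z ≠ ⊤ ↔ P.toSplit.IsFinite (WithLp.toLp 2 (X, z)) := by
  rw [zSubproblem, ← toSplit_augLagrangian, SplitProblem.augLagrangian_ne_top_iff hP.regular]
  exact Iff.rfl

theorem mem_argmin_of_attained {α : Type*} {f : α → EReal} {x y : α} (hx : ∀ y, f x ≤ f y)
    (hy : f y ≠ ⊤) : x ∈ argmin f :=
  ⟨((hx y).trans_lt (lt_top_iff_ne_top.2 hy)).ne, hx⟩

/-- One ADMM step can be performed from any point of the domain. -/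
theorem exists_admm_step (hP : P.Assumptions) {ρ : ℝ}
    (hatt : ∀ (X : XSpace E) (Z : ZSpace G₀ G₁ G₂) (W : WSpace V₁ V₂),
      (∀ i, Attains (P.xSubproblem ρ X Z W i)) ∧ Attains (P.zSubproblem ρ X W))
    {X : XSpace E} {Z : ZSpace G₀ G₁ G₂} (W : WSpace V₁ V₂)
    (hfin : P.toSplit.IsFinite (WithLp.toLp 2 (X, Z))) :
    ∃ (X' : XSpace E) (Z' : ZSpace G₀ G₁ G₂),
      (∀ i, X' i ∈ argmin (P.xSubproblem ρ (sweep X' X i) Z W i)) ∧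
      Z' ∈ argmin (P.zSubproblem ρ X' W) := by
  have hX : ∀ m ≤ n + 1, ∃ Y : XSpace E, (∀ i, P.f i (Y i) ≠ ⊤) ∧
      ∀ i : Fin (n + 1), (i : ℕ) < m → Y i ∈ argmin (P.xSubproblem ρ (sweep Y X i) Z W i) := by
    intro m hm
    induction m with
    | zero => exact ⟨X, hfin.1, fun i hi => absurd hi (Nat.not_lt_zero _)⟩
    | succ m ih =>
      obtain ⟨Y, hYf, hY⟩ := ih (by omega)
      set i₀ : Fin (n + 1) := ⟨m, hm⟩ with hi₀
      obtain ⟨x, hx⟩ := (hatt (sweep Y X i₀) Z W).1 i₀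
      have hcur : P.xSubproblem ρ (sweep Y X i₀) Z W i₀ (X i₀) ≠ ⊤ := by
        refine (xSubproblem_ne_top_iff hP).2 ⟨fun j => ?_, hfin.2⟩
        change P.f j (Function.update (sweep Y X i₀).ofLp i₀ (X i₀) j) ≠ ⊤
        rcases eq_or_ne j i₀ with rfl | hj
        · rw [Function.update_self]; exact hfin.1 _
        · rw [Function.update_of_ne hj]
          change P.f j (if j < i₀ then Y j else X j) ≠ ⊤
          split_ifs
          · exact hYf j
          · exact hfin.1 j
      have hxmem := mem_argmin_of_attained hx hcur
      set Y' : XSpace E := WithLp.toLp 2 (Function.update Y.ofLp i₀ x) with hY'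
      have hself : Y' i₀ = x := Function.update_self ..
      have hother : ∀ j ≠ i₀, Y' j = Y j := fun j hj => Function.update_of_ne hj ..
      have hsweep : ∀ i ≤ i₀, sweep Y' X i = sweep Y X i := fun i hi => by
        ext j
        change (if j < i then Y' j else X j) = if j < i then Y j else X j
        split_ifs with hj
        · exact hother j (hj.trans_le hi).ne
        · rfl
      refine ⟨Y', fun i => ?_, fun i hi => ?_⟩
      · rcases eq_or_ne i i₀ with h | hne
        · rw [h, hself]
          have := ((xSubproblem_ne_top_iff hP).1 hxmem.1).1 i₀
          change P.f i₀ (Function.update (sweep Y X i₀).ofLp i₀ x i₀) ≠ ⊤ at this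
          rwa [Function.update_self] at this
        · rw [hother i hne]; exact hYf i
      · rcases eq_or_ne i i₀ with h | hne
        · rw [h, hself, hsweep i₀ le_rfl]; exact hxmem
        · have hlt : (i : ℕ) < m := by
            have : (i : ℕ) ≠ m := fun h => hne (Fin.ext h)
            omega
          rw [hother i hne, hsweep i (Fin.le_def.2 hlt.le)]
          exact hY i hlt
  obtain ⟨X', hX'f, hX'⟩ := hX (n + 1) le_rfl
  obtain ⟨Z', hZ'⟩ := (hatt X' Z W).2
  exact ⟨X', Z', fun i => hX' i i.isLt, mem_argmin_of_attained hZ'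
    ((zSubproblem_ne_top_iff hP (z := Z)).2 ⟨hX'f, hfin.2⟩)⟩

theorem exists_isADMMSequence (hP : P.Assumptions) {ρ : ℝ}
    (hatt : ∀ (X : XSpace E) (Z : ZSpace G₀ G₁ G₂) (W : WSpace V₁ V₂),
      (∀ i, Attains (P.xSubproblem ρ X Z W i)) ∧ Attains (P.zSubproblem ρ X W))
    {X₀ : XSpace E} {Z₀ : ZSpace G₀ G₁ G₂} (W₀ : WSpace V₁ V₂)
    (hfin : P.toSplit.IsFinite (WithLp.toLp 2 (X₀, Z₀))) :
    ∃ (X : ℕ → XSpace E) (Z : ℕ → ZSpace G₀ G₁ G₂) (W : ℕ → WSpace V₁ V₂),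
      X 0 = X₀ ∧ Z 0 = Z₀ ∧ W 0 = W₀ ∧ P.IsADMMSequence ρ X Z W := by
  have hstep : ∀ s : {s : XSpace E × ZSpace G₀ G₁ G₂ × WSpace V₁ V₂ //
      P.toSplit.IsFinite (WithLp.toLp 2 (s.1, s.2.1))},
      ∃ s' : {s : XSpace E × ZSpace G₀ G₁ G₂ × WSpace V₁ V₂ //
        P.toSplit.IsFinite (WithLp.toLp 2 (s.1, s.2.1))},
      (∀ i, s'.1.1 i ∈ argmin (P.xSubproblem ρ (sweep s'.1.1 s.1.1 i) s.1.2.1 s.1.2.2 i)) ∧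
      s'.1.2.1 ∈ argmin (P.zSubproblem ρ s'.1.1 s.1.2.2) ∧
      s'.1.2.2 = s.1.2.2 + ρ • P.constraint (WithLp.toLp 2 (s'.1.1, s'.1.2.1)) := by
    rintro ⟨⟨X, Z, W⟩, hs⟩
    obtain ⟨X', Z', hX', hZ'⟩ := exists_admm_step hP hatt W hs
    exact ⟨⟨(X', Z', W + ρ • P.constraint (WithLp.toLp 2 (X', Z'))),
      (zSubproblem_ne_top_iff hP).1 hZ'.1⟩, hX', hZ', rfl⟩
  choose next hnext using hstep
  let s : ℕ → {s : XSpace E × ZSpace G₀ G₁ G₂ × WSpace V₁ V₂ //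
      P.toSplit.IsFinite (WithLp.toLp 2 (s.1, s.2.1))} :=
    fun k => Nat.rec ⟨(X₀, Z₀, W₀), hfin⟩ (fun _ t => next t) k
  exact ⟨fun k => (s k).1.1, fun k => (s k).1.2.1, fun k => (s k).1.2.2, rfl, rfl, rfl,
    fun k => hnext (s k)⟩

/-! ### ADMM sequences as iterations of the split problem -/

omit [∀ i, FiniteDimensional ℝ (E i)] [∀ i, InnerProductSpace ℝ (E i)] in
theorem update_sweep (X' X : XSpace E) (i : Fin (n + 1)) (d : E i) :
    (WithLp.toLp 2 (Function.update (sweep X' X i).ofLp i (X' i + d)) : XSpace E) =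
      SplitProblem.blend X' X (i + 1) + PiLp.single 2 i d := by
  ext j
  rcases eq_or_ne j i with rfl | hj
  · simp [SplitProblem.blend]
  · have hji : (j : ℕ) ≠ i := fun h => hj (Fin.ext h)
    have h1 : (j : ℕ) < i + 1 ↔ j < i := by rw [Fin.lt_def]; omega
    change Function.update (sweep X' X i).ofLp i (X' i + d) j =
      (if (j : ℕ) < i + 1 then X' j else X j) + PiLp.single 2 i d j
    rw [Function.update_of_ne hj, PiLp.single_eq_of_ne 2 hj, add_zero]
    simp only [h1, sweep]

theorem IsADMMSequence.isFinite (hP : P.Assumptions) {ρ : ℝ} {X : ℕ → XSpace E}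
    {Z : ℕ → ZSpace G₀ G₁ G₂} {W : ℕ → WSpace V₁ V₂} (h : P.IsADMMSequence ρ X Z W) (k : ℕ) :
    P.toSplit.IsFinite (WithLp.toLp 2 (X (k + 1), Z (k + 1))) :=
  (zSubproblem_ne_top_iff hP).1 (h k).2.1.1

theorem IsADMMSequence.z_min (hP : P.Assumptions) {ρ : ℝ} {X : ℕ → XSpace E}
    {Z : ℕ → ZSpace G₀ G₁ G₂} {W : ℕ → WSpace V₁ V₂} (h : P.IsADMMSequence ρ X Z W) (k : ℕ)
    (d : ZSpace G₀ G₁ G₂) (hd : P.toSplit.h (Z (k + 1) + d) ≠ ⊤) :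
    P.toSplit.lag ρ (WithLp.toLp 2 (X (k + 1), Z (k + 1))) (W k) ≤
      P.toSplit.lag ρ (WithLp.toLp 2 (X (k + 1), Z (k + 1)) + SplitProblem.zDir E d) (W k) := by
  have hS := hP.regular
  have hfin := h.isFinite hP k
  have h1 := (h k).2.1.2 (Z (k + 1) + d)
  have e : (WithLp.toLp 2 (X (k + 1), Z (k + 1) + d) :
      WithLp 2 (XSpace E × ZSpace G₀ G₁ G₂)) =
      WithLp.toLp 2 (X (k + 1), Z (k + 1)) + SplitProblem.zDir E d :=
    WithLp.ofLp_injective 2 (Prod.ext (add_zero _).symm rfl)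
  rw [zSubproblem, zSubproblem, ← toSplit_augLagrangian, e, hfin.augLagrangian_eq hS,
    (hfin.add_zDir hd).augLagrangian_eq hS] at h1
  exact EReal.coe_le_coe_iff.1 h1

/-- From the first iterate on, an ADMM sequence is an iteration of the split problem. -/
theorem IsADMMSequence.isIteration (hP : P.Assumptions) {ρ : ℝ} {X : ℕ → XSpace E}
    {Z : ℕ → ZSpace G₀ G₁ G₂} {W : ℕ → WSpace V₁ V₂} (h : P.IsADMMSequence ρ X Z W) :
    P.toSplit.IsIteration ρ (fun k => X (k + 1)) (fun k => Z (k + 1)) (fun k => W (k + 1)) where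
  finite := h.isFinite hP
  x_min k i d hd := by
    have hS := hP.regular
    have hfin := SplitProblem.isFinite_blend (h.isFinite hP (k + 1)) (h.isFinite hP k) (i + 1)
    have h1 := ((h (k + 1)).1 i).2 (X (k + 1 + 1) i + d)
    have h0 := update_sweep (X (k + 1 + 1)) (X (k + 1)) i 0
    have e : (WithLp.toLp 2 (SplitProblem.blend (X (k + 1 + 1)) (X (k + 1)) (i + 1) +
        PiLp.single 2 i d, Z (k + 1)) : WithLp 2 (XSpace E × ZSpace G₀ G₁ G₂)) =
        WithLp.toLp 2 (SplitProblem.blend (X (k + 1 + 1)) (X (k + 1)) (i + 1), Z (k + 1)) +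
          SplitProblem.xDir (ZSpace G₀ G₁ G₂) i d :=
      WithLp.ofLp_injective 2 (Prod.ext rfl (add_zero _).symm)
    have e0 : (PiLp.single 2 i (0 : E i) : XSpace E) = 0 := by ext j; simp
    rw [add_zero, e0, add_zero] at h0
    have hd' : P.toSplit.f i (SplitProblem.blend (X (k + 1 + 1)) (X (k + 1)) (i + 1) i + d) ≠ ⊤ := by
      rw [SplitProblem.blend_succ_apply]; exact hd
    rw [xSubproblem, xSubproblem, ← toSplit_augLagrangian, h0, update_sweep, e,
      hfin.augLagrangian_eq hS, (hfin.add_xDir hd').augLagrangian_eq hS] at h1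
    exact EReal.coe_le_coe_iff.1 h1
  z_min k := h.z_min hP (k + 1)
  w_update k := (h (k + 1)).2.2
  first_order k d := by
    have := SplitProblem.first_order_of_z_min hP.regular (h.isFinite hP k) (h.z_min hP k) d
    rwa [(h k).2.2]

end Problem

end MultiaffineADMM


open MultiaffineADMM Filter Topology in
theorem theorem4p3 {n : ℕ} {E : Fin (n + 1) → Type*} {G₀ G₁ G₂ : Type*}
    {ι₁ ι₂ : Type*} [Fintype ι₁] [Fintype ι₂] {V₁ : ι₁ → Type*} {V₂ : ι₂ → Type*}
    [∀ i, NormedAddCommGroup (E i)] [∀ i, InnerProductSpace ℝ (E i)]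
    [∀ i, FiniteDimensional ℝ (E i)]
    [NormedAddCommGroup G₀] [InnerProductSpace ℝ G₀] [FiniteDimensional ℝ G₀]
    [NormedAddCommGroup G₁] [InnerProductSpace ℝ G₁] [FiniteDimensional ℝ G₁]
    [NormedAddCommGroup G₂] [InnerProductSpace ℝ G₂] [FiniteDimensional ℝ G₂]
    [∀ r, NormedAddCommGroup (V₁ r)] [∀ r, InnerProductSpace ℝ (V₁ r)]
    [∀ r, FiniteDimensional ℝ (V₁ r)]
    [∀ r, NormedAddCommGroup (V₂ r)] [∀ r, InnerProductSpace ℝ (V₂ r)]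
    [∀ r, FiniteDimensional ℝ (V₂ r)]
    (P : Problem E G₀ G₁ G₂ V₁ V₂) (hP : P.Assumptions) :
    ∃ ρ₀ : ℝ, 0 < ρ₀ ∧ ∀ ρ > ρ₀, IsKLFunction (P.augLagrangian ρ) →
      (∀ (X₀ : XSpace E) (Z₀ : ZSpace G₀ G₁ G₂) (W₀ : WSpace V₁ V₂),
        P.objective (WithLp.toLp 2 (X₀, Z₀)) ≠ ⊤ →
        ∃ (X : ℕ → XSpace E) (Z : ℕ → ZSpace G₀ G₁ G₂) (W : ℕ → WSpace V₁ V₂),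
          X 0 = X₀ ∧ Z 0 = Z₀ ∧ W 0 = W₀ ∧ P.IsADMMSequence ρ X Z W) ∧
      (∀ (X : ℕ → XSpace E) (Z : ℕ → ZSpace G₀ G₁ G₂) (W : ℕ → WSpace V₁ V₂),
        P.IsADMMSequence ρ X Z W →
        ∃! q : XSpace E × ZSpace G₀ G₁ G₂ × WSpace V₁ V₂,
          Tendsto (fun k => (X k, Z k, W k)) atTop (𝓝 q) ∧
          P.IsConstrainedStationary (WithLp.toLp 2 (q.1, q.2.1)) q.2.2) := by
  obtain ⟨ρ₁, hatt⟩ := hP.attained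
  have hS := hP.regular
  obtain ⟨a, ha, ρ₂, hρ₂, hdesc⟩ := SplitProblem.exists_descent_bounded hS
  refine ⟨max ρ₁ ρ₂, lt_max_of_lt_right hρ₂, fun ρ hρ hKL => ⟨fun X₀ Z₀ W₀ hfin => ?_,
    fun X Z W hADMM => ?_⟩⟩
  · rw [← Problem.toSplit_objective] at hfin
    exact Problem.exists_isADMMSequence hP (hatt ρ ((le_max_left _ _).trans_lt hρ)) W₀
      ((SplitProblem.objective_ne_top_iff hS).1 hfin)
  · have hρ' : ρ₂ < ρ := (le_max_right _ _).trans_lt hρ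
    have hI := hADMM.isIteration hP
    obtain ⟨hdec, hlow, hbdd⟩ := hdesc ρ hρ' _ _ _ hI
    rw [← Problem.toSplit_augLagrangian] at hKL
    obtain ⟨X', Z', W', hX, hZ, hW, hC, v, hv, hvd⟩ :=
      hI.exists_tendsto hS (hρ₂.trans hρ') ha hdec hlow hbdd hKL
    rw [Problem.toSplit_objective] at hv
    have hlim : Tendsto (fun k => (X k, Z k, W k)) atTop (𝓝 (X', Z', W')) :=
      ((tendsto_add_atTop_iff_nat 1).1 hX).prodMk_nhds
        (((tendsto_add_atTop_iff_nat 1).1 hZ).prodMk_nhds ((tendsto_add_atTop_iff_nat 1).1 hW))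
    exact ⟨(X', Z', W'), ⟨hlim, hC, v, hv, hvd⟩, fun q hq => tendsto_nhds_unique hq.1 hlim⟩
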